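/- **Theorem 3.2 (Boundary estimate).** Let $n\ge 2$, $m\ge 0$, and let $\Omega\subset\mathbb R^n$ be a Lipschitz domain: either the domain above the graph of a Lipschitz function with Lipschitz constant $L$, or a bounded domain such that for some $\rho>0$ with $\operatorname{diam}\Omega\le D\rho$ and every $z\in\partial\Omega$ the set $\Omega\cap B_\rho(z)$ is, in suitable Cartesian coordinates, the part in $B_\rho(z)$ of the region above a Lipschitz graph with constant $L$. Put $\delta(y)=\operatorname{dist}(y,\partial\Omega)$. Consider $$(\mathcal Lu)_\alpha=\partial_h\big(A^{hk}_{\alpha\beta}\,\partial_ku^\beta\big)+B^h_{\alpha\beta}\,\partial_hu^\beta ,\qquad \alpha=1,\dots,m,$$ with complex measurable coefficients on $\Omega$, $|A^{hk}_{\alpha\beta}|\le\Lambda$ a.e. For $p\in(1,\infty)$, $A$ is called (integrally) $p$-elliptic with constant $\lambda_p>0$ if for all $v\in W^{1,2}_0(\Omega;\mathbb C^m)$ $$\Re e\int_\Omega\Big\langle A\Big(\nabla v-\big(1-\tfrac2p\big)\tfrac{v}{|v|}\nabla|v|\Big),\ \nabla v+\big(1-\tfrac2p\big)\tfrac{v}{|v|}\nabla|v|\Big\rangle\,dx\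 \ge\ \lambda_p\int_\Omega|\nabla v|^2dx ,$$ where $\langle A\xi,\zeta\rangle=A^{hk}_{\alpha\beta}\xi_k^\beta\overline{\zeta_h^\alpha}$ and $\tfrac{v}{|v|}\nabla|v|:=0$ where $v=0$. Assume throughout that $A$ is $2$-elliptic with constant $\lambda>0$, and let $p_0=\sup\{p>1: A\text{ is }p\text{-elliptic}\}\in(2,\infty]$. For $K>0$ let $\mathcal S_K$ be the set of all $(u,x,r)$ such that $x\in\overline\Omega$, $r>0$, $u\in W^{1,2}_{loc}(\Omega;\mathbb C^m)$ is a weak solution of $\mathcal Lu=0$ in $\Omega$, i.e. $\int_\Omega\big(A^{hk}_{\alpha\beta}\partial_ku^\beta\,\overline{\partial_hv^\alpha}-B^h_{\alpha\beta}\partial_hu^\beta\,\overline{v^\alpha}\big)dy=0$ for all $v\in C_0^\infty(\Omega;\mathbb C^m)$, for some $B$ with $|B^h_{\alpha\beta}(y)|\le K/\delta(y)$ for a.e. $y\in\Omega$, and $\operatorname{Tr}(u)=0$ on $B_{3r}(x)\cap\partial\Omega$, i.e. $\varphi u\in W^{1,2}_0(\Omega;\mathbb C^m)$ for every $\varphi\in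 C_0^\infty(B_{3r}(x))$. Consider the inequalities (where $\operatorname*{avg}_Ef=\frac1{|E|}\int_Ef\,dy$) $$(\mathrm C_p)\quad \operatorname*{avg}_{B_r(x)\cap\Omega}|u|^{p-2}|\nabla u|^2\le\frac{C}{r^2}\operatorname*{avg}_{B_{2r}(x)\cap\Omega}|u|^p,\qquad(\mathrm{RH}_q)\quad\Big(\operatorname*{avg}_{B_r(x)\cap\Omega}|u|^q\Big)^{1/q}\le C\operatorname*{avg}_{B_{2r}(x)\cap\Omega}|u| .$$ 1. Let $p\in(1,\infty)$ be such that $A$ is $p$-elliptic with constant $\lambda_p$. There is $K>0$ depending only on $n,m,p,\lambda,\lambda_p,\Lambda$ and the Lipschitz character $(L,D)$ of $\Omega$ such that: $(\mathrm C_p)$ holds for all $(u,x,r)\in\mathcal S_K$ with a constant $C$ depending only on the same quantities; and for every $q\ge1$ with $q(n-2)<pn$, $(\mathrm{RH}_q)$ holds for all $(u,x,r)\in\mathcal S_K$ with a constant $C$ depending only on the same quantities and $q$. 2. In particular, for every $p\in[2,p_0)$ there are $K,C>0$ such that $(\mathrm C_p)$ holds on $\mathcal S_K$, and for every $q\in[1,\frac{p_0n}{n-2})$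 (every $q\in[1,\infty)$ if $n=2$ or $p_0=\infty$) there are $K,C>0$ such that $(\mathrm{RH}_q)$ holds on $\mathcal S_K$. -/

import Mathlib

open MeasureTheory
open scoped ENNReal NNReal ContDiff

namespace PEllipticSystem

/-- The underlying space `ℝⁿ`. -/
abbrev Pt (n : ℕ) := EuclideanSpace ℝ (Fin n)

/-- Values `ℂᵐ` of the unknown function. -/
abbrev Val (m : ℕ) := EuclideanSpace ℂ (Fin m)

/-- Tensors `ξ = (ξ_h^α)`, `1 ≤ h ≤ n`, `1 ≤ α ≤ m`, with the Euclidean norm; the gradient of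
`u` is the tensor with entry `∂_h u^α` at `(h, α)`. -/
abbrev Tens (n m : ℕ) := EuclideanSpace ℂ (Fin n × Fin m)

/-- Fourth order coefficient tensors: `a h k α β` is `A^{hk}_{αβ}`. -/
abbrev Coeff2 (n m : ℕ) := Fin n → Fin n → Fin m → Fin m → ℂ

/-- First order coefficients: `b h α β` is `B^h_{αβ}`. -/
abbrev Coeff1 (n m : ℕ) := Fin n → Fin m → Fin m → ℂ

/-! ### Lipschitz domains -/

/-- The open set above the graph of `φ` (restricted to the hyperplane `e^⊥`) in the direction of
the unit vector `e`. -/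
def aboveGraph {n : ℕ} (e : Pt n) (φ : Pt n → ℝ) : Set (Pt n) :=
  {y | φ (y - inner ℝ e y • e) < inner ℝ e y}

/-- `Ω` is either the domain above a Lipschitz graph with Lipschitz constant `L`, or a bounded
Lipschitz domain whose boundary is, in a ball of a fixed radius `ρ ≥ diam Ω / D` about each
boundary point, a Lipschitz graph with constant `L`. The numbers `L`, `D` are the (scale invariant)
Lipschitz character. Every bounded Lipschitz domain satisfies this for some `L`, `D`. -/
def IsLipschitzDomain {n : ℕ} (L : ℝ≥0) (D : ℝ) (Ω : Set (Pt n)) : Prop :=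
  (∃ (e : Pt n) (φ : Pt n → ℝ), ‖e‖ = 1 ∧ LipschitzWith L φ ∧ Ω = aboveGraph e φ) ∨
  (IsOpen Ω ∧ IsConnected Ω ∧ Bornology.IsBounded Ω ∧
    ∃ ρ : ℝ, 0 < ρ ∧ Metric.diam Ω ≤ D * ρ ∧
      ∀ z ∈ frontier Ω, ∃ (e : Pt n) (φ : Pt n → ℝ), ‖e‖ = 1 ∧ LipschitzWith L φ ∧
        Ω ∩ Metric.ball z ρ = aboveGraph e φ ∩ Metric.ball z ρ)

/-! ### Sobolev functions -/

/-- Functions in `C_0^∞(Ω; F)`. -/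
def IsTest {n : ℕ} {F : Type*} [NormedAddCommGroup F] [NormedSpace ℝ F]
    (Ω : Set (Pt n)) (ψ : Pt n → F) : Prop :=
  ContDiff ℝ ∞ ψ ∧ HasCompactSupport ψ ∧ tsupport ψ ⊆ Ω

/-- The classical partial derivative `∂_h ψ`. -/
noncomputable def pderiv {n : ℕ} {F : Type*} [NormedAddCommGroup F] [NormedSpace ℝ F]
    (h : Fin n) (ψ : Pt n → F) (y : Pt n) : F :=
  fderiv ℝ ψ y (EuclideanSpace.single h (1 : ℝ))

/-- The classical gradient of a `ℂᵐ`-valued function. -/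
noncomputable def grad {n m : ℕ} (v : Pt n → Val m) (y : Pt n) : Tens n m :=
  WithLp.toLp 2 (fun i : Fin n × Fin m => pderiv i.1 v y i.2)

/-- `u ∈ W^{1,2}_loc(Ω; ℂᵐ)` with weak gradient `G`. -/
def MemW12Loc {n m : ℕ} (Ω : Set (Pt n)) (u : Pt n → Val m) (G : Pt n → Tens n m) : Prop :=
  (∀ S : Set (Pt n), IsCompact S → S ⊆ Ω →
    MemLp u 2 (volume.restrict S) ∧ MemLp G 2 (volume.restrict S)) ∧
  ∀ ψ : Pt n → ℝ, IsTest Ω ψ → ∀ (h : Fin n) (α : Fin m),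
    ∫ y in Ω, ((pderiv h ψ y : ℝ) : ℂ) * u y α = - ∫ y in Ω, (ψ y : ℂ) * G y (h, α)

/-- `v ∈ W^{1,2}_0(Ω; ℂᵐ)` with weak gradient `G`: the closure of `C_0^∞(Ω; ℂᵐ)` in the
norm of `W^{1,2}(Ω; ℂᵐ)`. -/
def MemW12Zero {n m : ℕ} (Ω : Set (Pt n)) (v : Pt n → Val m) (G : Pt n → Tens n m) : Prop :=
  MemLp v 2 (volume.restrict Ω) ∧ MemLp G 2 (volume.restrict Ω) ∧
  ∀ ε : ℝ≥0∞, 0 < ε → ∃ φ : Pt n → Val m, IsTest Ω φ ∧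
    eLpNorm (fun y => v y - φ y) 2 (volume.restrict Ω) < ε ∧
    eLpNorm (fun y => G y - grad φ y) 2 (volume.restrict Ω) < ε

/-- `Tr(u) = 0` on `U ∩ ∂Ω`, for an open set `U`: every localization of `u` inside `U` belongs
to `W^{1,2}_0(Ω; ℂᵐ)` (so that `u` is in particular `W^{1,2}` up to that part of `∂Ω`). -/
def HasZeroTraceOn {n m : ℕ} (Ω U : Set (Pt n)) (u : Pt n → Val m) : Prop :=
  ∀ φ : Pt n → ℝ, IsTest U φ → ∃ G : Pt n → Tens n m, MemW12Zero Ω (fun y => φ y • u y) G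

/-! ### Ellipticity -/

/-- `⟨a ξ, ζ⟩ = a^{hk}_{αβ} ξ_k^β conj(ζ_h^α)`. -/
noncomputable def form2 {n m : ℕ} (a : Coeff2 n m) (ξ ζ : Tens n m) : ℂ :=
  ∑ h, ∑ k, ∑ α, ∑ β, a h k α β * ξ (k, β) * (starRingEnd ℂ) (ζ (h, α))

/-- `⟨b ξ, w⟩ = b^h_{αβ} ξ_h^β conj(w^α)`. -/
noncomputable def form1 {n m : ℕ} (b : Coeff1 n m) (ξ : Tens n m) (w : Val m) : ℂ :=
  ∑ h, ∑ α, ∑ β, b h α β * ξ (h, β) * (starRingEnd ℂ) (w α)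

/-- The tensor `(v/|v|) ∇|v|` for the value `v = w` and the gradient `∇v = ξ`, that is
`(w^α / |w|²) Re (w^β conj(ξ_h^β))`; it is `0` where `w = 0`. -/
noncomputable def radialPart {n m : ℕ} (w : Val m) (ξ : Tens n m) : Tens n m :=
  WithLp.toLp 2 (fun i : Fin n × Fin m =>
    w i.2 * (((∑ β, w β * (starRingEnd ℂ) (ξ (i.1, β))).re / ‖w‖ ^ 2 : ℝ) : ℂ))

/-- The tensor field `A` is measurable with entries bounded by `Λ` almost everywhere in `Ω`. -/
def IsBoundedCoeff {n m : ℕ} (Ω : Set (Pt n)) (A : Pt n → Coeff2 n m) (Λ : ℝ) : Prop :=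
  ∀ h k α β, AEStronglyMeasurable (fun y => A y h k α β) (volume.restrict Ω) ∧
    ∀ᵐ y ∂(volume.restrict Ω), ‖A y h k α β‖ ≤ Λ

/-- The integral `p`-ellipticity condition with constant `c`. For `p = 2` this is
the usual integral ellipticity condition. -/
def IsPEllipticWith {n m : ℕ} (Ω : Set (Pt n)) (A : Pt n → Coeff2 n m) (p c : ℝ) : Prop :=
  ∀ (v : Pt n → Val m) (G : Pt n → Tens n m), MemW12Zero Ω v G →
    c * ∫ y in Ω, ‖G y‖ ^ 2 ≤
      (∫ y in Ω, form2 (A y)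
        (G y - (1 - 2 / p : ℝ) • radialPart (v y) (G y))
        (G y + (1 - 2 / p : ℝ) • radialPart (v y) (G y))).re

/-- The integral `p`-ellipticity condition. -/
def IsPElliptic {n m : ℕ} (Ω : Set (Pt n)) (A : Pt n → Coeff2 n m) (p : ℝ) : Prop :=
  ∃ c : ℝ, 0 < c ∧ IsPEllipticWith Ω A p c

/-- `p₀ = sup {p > 1 : A satisfies the integral p-ellipticity condition}`, possibly `∞`. -/
noncomputable def pZero {n m : ℕ} (Ω : Set (Pt n)) (A : Pt n → Coeff2 n m) : ℝ≥0∞ :=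
  ⨆ (p : ℝ) (_ : 1 < p ∧ IsPElliptic Ω A p), ENNReal.ofReal p

/-! ### The equation -/

/-- `B` is measurable and `|B^h_{αβ}(y)| ≤ K / δ(y)`, where `δ(y)` is the distance to `∂Ω`
(in particular `B` is locally bounded in `Ω`). -/
def IsDriftBound {n m : ℕ} (Ω : Set (Pt n)) (B : Pt n → Coeff1 n m) (K : ℝ) : Prop :=
  ∀ h α β, AEStronglyMeasurable (fun y => B y h α β) (volume.restrict Ω) ∧
    ∀ᵐ y ∂(volume.restrict Ω), ‖B y h α β‖ ≤ K / Metric.infDist y (frontier Ω)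

/-- `u ∈ W^{1,2}_loc(Ω; ℂᵐ)`, with weak gradient `G`, is a weak solution of
`∂_h (A^{hk}_{αβ} ∂_k u^β) + B^h_{αβ} ∂_h u^β = 0` in `Ω`. -/
def IsWeakSolution {n m : ℕ} (Ω : Set (Pt n)) (A : Pt n → Coeff2 n m) (B : Pt n → Coeff1 n m)
    (u : Pt n → Val m) (G : Pt n → Tens n m) : Prop :=
  MemW12Loc Ω u G ∧
  ∀ v : Pt n → Val m, IsTest Ω v →
    ∫ y in Ω, (form2 (A y) (G y) (grad v y) - form1 (B y) (G y) (v y)) = 0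

/-! ### The two estimates -/

/-- The Caccioppoli-type inequality with exponent `p` and constant `C` for all weak
solutions that vanish on `B_{3r}(x) ∩ ∂Ω`, for all drifts `B` with `|B| ≤ K/δ`. -/
def CaccioppoliEstimate {n m : ℕ} (Ω : Set (Pt n)) (A : Pt n → Coeff2 n m) (K p C : ℝ) : Prop :=
  ∀ B : Pt n → Coeff1 n m, IsDriftBound Ω B K →
  ∀ (u : Pt n → Val m) (G : Pt n → Tens n m), IsWeakSolution Ω A B u G →
  ∀ x ∈ closure Ω, ∀ r : ℝ, 0 < r → HasZeroTraceOn Ω (Metric.ball x (3 * r)) u →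
    ⨍⁻ y in Metric.ball x r ∩ Ω, ENNReal.ofReal (‖u y‖ ^ (p - 2) * ‖G y‖ ^ 2) ∂volume ≤
      ENNReal.ofReal (C / r ^ 2) *
        ⨍⁻ y in Metric.ball x (2 * r) ∩ Ω, ENNReal.ofReal (‖u y‖ ^ p) ∂volume

/-- The reverse Hölder inequality with exponent `q` and constant `C` for all weak
solutions that vanish on `B_{3r}(x) ∩ ∂Ω`, for all drifts `B` with `|B| ≤ K/δ`. -/
def ReverseHolderEstimate {n m : ℕ} (Ω : Set (Pt n)) (A : Pt n → Coeff2 n m) (K q C : ℝ) : Prop :=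
  ∀ B : Pt n → Coeff1 n m, IsDriftBound Ω B K →
  ∀ (u : Pt n → Val m) (G : Pt n → Tens n m), IsWeakSolution Ω A B u G →
  ∀ x ∈ closure Ω, ∀ r : ℝ, 0 < r → HasZeroTraceOn Ω (Metric.ball x (3 * r)) u →
    (⨍⁻ y in Metric.ball x r ∩ Ω, ENNReal.ofReal (‖u y‖ ^ q) ∂volume) ^ (1 / q) ≤
      ENNReal.ofReal C * ⨍⁻ y in Metric.ball x (2 * r) ∩ Ω, ENNReal.ofReal ‖u y‖ ∂volume

end PEllipticSystem

/-! For an exponent q between 2 and p the natural test function is η²|u|^{q-2}u. If v =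
η|u|^{(q-2)/2}u were admissible, p-ellipticity applied to v would (for q = p) give exactly the
coercivity needed. But v need not belong to W^{1,2}_0, so the power has to be truncated, and a crude
truncation destroys the algebra that links the equation to the p-form.

The remedy is a truncation with slowly varying exponent. The factor |u|^{(q-2)/2} is replaced by
f(log|u|) with f' = σf, where σ equals (q-2)/2 on a long interval and 0 far out (`SlowPower`,
`exists_slowPower_exponent`). With μ = 1 - 2/p, the exponent σ is tied to a partition c1² + c0² = 1
by σ = μc1²(1+σ). One applies p-ellipticity to c1·v and 2-ellipticity to c0·v. Up to errors from ∇η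
and from the derivatives of c1, c0, which are at most ε, the form controlled by the equation equals
the sum of these two forms plus (μc0c1(1+σ))²⟨AY,Y⟩, where Y is the radial part of the gradient
(`pointwise_form_inequality`). The extra term has a nonnegative integral: in the 2-ellipticity
inequality for ηk(log|u|)e^{it log|u|}u it is the coefficient of t²
(`integral_form2Re_radial_nonneg`). Since ε does not depend on the length of the interval, the
truncation can be removed by Fatou's lemma.

The drift is bounded by K/δ, and Hardy's inequality (`hardy_test`) bounds v/δ by ∇v in L²; for small
K the drift term is absorbed. Hardy's inequality itself comes from integration by parts in the
direction of the graph, localized by averaging over balls, with Friedrichs' inequality for the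
zeroth order remainder. This gives the Caccioppoli inequality (`caccioppoli_slowPower`,
`exists_local_estimate`).

The same bound on the gradient of ηf(log|u|)u, combined with Sobolev's inequality, improves L^q to
L^{qκ} on smaller balls for all q between 2 and max(p,2). The zero trace provides L² to start from;
finitely many steps give local finiteness, and interpolation with L¹ plus an iteration over radii
puts the L¹ norm on the right (`exists_reverseHolder_of_gain`). Volumes of B_r ∩ Ω are comparable to
a power of an effective radius (`exists_volume_estimates`), which turns integrals into averages. -/

namespace PEllipticSystem

/-! ### Tensor algebra -/

/-- The tensor `b ⊗ w` with entry `b_h w^α` at `(h, α)`. -/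
noncomputable def tensor {n m : ℕ} (b : Fin n → ℝ) (w : Val m) : Tens n m :=
  WithLp.toLp 2 (fun i : Fin n × Fin m => (b i.1 : ℂ) * w i.2)

/-- The `h`-th row `(ξ_h^α)_α` of a tensor. -/
noncomputable def row {n m : ℕ} (h : Fin n) (ξ : Tens n m) : Val m :=
  WithLp.toLp 2 (fun α => ξ (h, α))

variable {n m : ℕ}

@[simp] lemma tensor_apply (b : Fin n → ℝ) (w : Val m) (i : Fin n × Fin m) :
    tensor b w i = (b i.1 : ℂ) * w i.2 := rfl

@[simp] lemma row_apply (h : Fin n) (ξ : Tens n m) (α : Fin m) : row h ξ α = ξ (h, α) := rfl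

lemma real_inner_eq (w z : Val m) :
    inner ℝ w z = (∑ β, w β * (starRingEnd ℂ) (z β)).re := by
  simp only [PiLp.inner_apply, Complex.re_sum]
  refine Finset.sum_congr rfl fun i _ => ?_
  simp [Complex.inner, mul_comm]

lemma radialPart_eq_tensor (w : Val m) (ξ : Tens n m) :
    radialPart w ξ = tensor (fun h => inner ℝ w (row h ξ) / ‖w‖ ^ 2) w := by
  ext i
  simp [radialPart, real_inner_eq, mul_comm]

lemma norm_sq_eq_sum_row (ξ : Tens n m) : ‖ξ‖ ^ 2 = ∑ h, ‖row h ξ‖ ^ 2 := by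
  simp only [EuclideanSpace.norm_sq_eq, row_apply]
  exact Fintype.sum_prod_type _

lemma norm_row_le (h : Fin n) (ξ : Tens n m) : ‖row h ξ‖ ≤ ‖ξ‖ := by
  refine le_of_sq_le_sq ?_ (norm_nonneg _)
  rw [norm_sq_eq_sum_row]
  exact Finset.single_le_sum (f := fun h => ‖row h ξ‖ ^ 2) (fun _ _ => sq_nonneg _)
    (Finset.mem_univ h)

lemma row_tensor (b : Fin n → ℝ) (w : Val m) (h : Fin n) : row h (tensor b w) = b h • w := by
  ext α; simp

lemma row_add (h : Fin n) (ξ ζ : Tens n m) : row h (ξ + ζ) = row h ξ + row h ζ := rfl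

lemma row_smul (h : Fin n) (c : ℝ) (ξ : Tens n m) : row h (c • ξ) = c • row h ξ := rfl

lemma norm_tensor_sq (b : Fin n → ℝ) (w : Val m) :
    ‖tensor b w‖ ^ 2 = (∑ h, b h ^ 2) * ‖w‖ ^ 2 := by
  simp only [norm_sq_eq_sum_row, row_tensor, norm_smul, mul_pow, Real.norm_eq_abs, sq_abs,
    Finset.sum_mul]

/-- Each row of the radial part is the real orthogonal projection of the row of ξ onto the line
through w, so Cauchy–Schwarz applies row by row. -/
lemma norm_radialPart_le (w : Val m) (ξ : Tens n m) : ‖radialPart w ξ‖ ≤ ‖ξ‖ := by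
  refine le_of_sq_le_sq ?_ (norm_nonneg _)
  rw [radialPart_eq_tensor, norm_tensor_sq, norm_sq_eq_sum_row ξ, Finset.sum_mul]
  refine Finset.sum_le_sum fun h _ => ?_
  rcases eq_or_ne w 0 with rfl | hw
  · simp
  have hw' : 0 < ‖w‖ := norm_pos_iff.2 hw
  have h1 : inner ℝ w (row h ξ) ^ 2 ≤ (‖w‖ * ‖row h ξ‖) ^ 2 :=
    sq_le_sq' (by linarith [neg_abs_le (inner ℝ w (row h ξ)), abs_real_inner_le_norm w (row h ξ)])
      (real_inner_le_norm _ _)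
  rw [div_pow, div_mul_eq_mul_div, div_le_iff₀ (by positivity)]
  nlinarith [sq_nonneg ‖w‖]

/-- How the radial part behaves under multiplication by scalar functions. -/
lemma radialPart_combination (w : Val m) (ξ : Tens n m) (c d : ℝ) (b : Fin n → ℝ)
    (h0 : c = 0 → d = 0 ∧ b = 0) :
    radialPart (c • w) (c • ξ + d • radialPart w ξ + tensor b w) =
      (c + d) • radialPart w ξ + tensor b w := by
  -- Where c = 0 the left side vanishes by the convention at a zero value, so d and b must vanish
  -- there too; this is the purpose of `h0`.
  rcases eq_or_ne c 0 with rfl | hc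
  · obtain ⟨rfl, rfl⟩ := h0 rfl
    ext i; simp [radialPart]
  rcases eq_or_ne w 0 with rfl | hw
  · ext i; simp [radialPart]
  have hw' : ‖w‖ ≠ 0 := norm_ne_zero_iff.2 hw
  rw [radialPart_eq_tensor, radialPart_eq_tensor]
  ext i
  simp only [tensor_apply, row_add, row_smul, row_tensor, PiLp.smul_apply, PiLp.add_apply,
    inner_add_right, inner_smul_left, inner_smul_right, real_inner_self_eq_norm_sq, norm_smul,
    Real.norm_eq_abs, mul_pow, sq_abs, Complex.real_smul, RCLike.conj_to_real]
  simp only [← mul_assoc, ← Complex.ofReal_mul, ← add_mul, ← Complex.ofReal_add]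
  congr 2
  field_simp

/-- `form2` is real bilinear. -/
noncomputable def form2Re (a : Coeff2 n m) : Tens n m →ₗ[ℝ] Tens n m →ₗ[ℝ] ℝ :=
  LinearMap.mk₂ ℝ (fun ξ ζ => (form2 a ξ ζ).re)
    (fun ξ ξ' ζ => by
      simp only [form2, ← Complex.add_re, ← Finset.sum_add_distrib, PiLp.add_apply]
      congr; ext; congr; ext; congr; ext; congr; ext; ring)
    (fun c ξ ζ => by
      simp only [form2, PiLp.smul_apply, smul_eq_mul, Complex.real_smul]
      rw [← Complex.re_ofReal_mul]
      simp only [Finset.mul_sum]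
      congr; ext; congr; ext; congr; ext; congr; ext; ring)
    (fun ξ ζ ζ' => by
      simp only [form2, ← Complex.add_re, ← Finset.sum_add_distrib, PiLp.add_apply, map_add]
      congr; ext; congr; ext; congr; ext; congr; ext; ring)
    (fun c ξ ζ => by
      simp only [form2, PiLp.smul_apply, smul_eq_mul, Complex.real_smul, map_mul,
        Complex.conj_ofReal]
      rw [← Complex.re_ofReal_mul]
      simp only [Finset.mul_sum]
      congr; ext; congr; ext; congr; ext; congr; ext; ring)

@[simp] lemma form2Re_apply (a : Coeff2 n m) (ξ ζ : Tens n m) :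
    form2Re a ξ ζ = (form2 a ξ ζ).re := rfl

/-- Sesquilinearity leaves only |c|². In particular a phase e^{it log|U|} drops out of the form,
which is what makes oscillating test functions useful. -/
lemma form2_smul_smul (a : Coeff2 n m) (c : ℂ) (ξ ζ : Tens n m) :
    form2 a (c • ξ) (c • ζ) = ((‖c‖ ^ 2 : ℝ) : ℂ) * form2 a ξ ζ := by
  have hc : c * (starRingEnd ℂ) c = ((‖c‖ ^ 2 : ℝ) : ℂ) := by
    rw [Complex.mul_conj, Complex.normSq_eq_norm_sq]
  simp only [form2, PiLp.smul_apply, smul_eq_mul, map_mul, ← hc, Finset.mul_sum]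
  congr; ext; congr; ext; congr; ext; congr; ext; ring

lemma norm_form2_le (a : Coeff2 n m) {Λ : ℝ} (hΛ : 0 ≤ Λ) (ha : ∀ h k α β, ‖a h k α β‖ ≤ Λ)
    (ξ ζ : Tens n m) : ‖form2 a ξ ζ‖ ≤ (n ^ 2 * m ^ 2 * Λ) * ‖ξ‖ * ‖ζ‖ := by
  have key : ∀ h k α β, ‖a h k α β * ξ (k, β) * (starRingEnd ℂ) (ζ (h, α))‖ ≤ Λ * ‖ξ‖ * ‖ζ‖ := by
    intro h k α β
    rw [norm_mul, norm_mul, RCLike.norm_conj]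
    have h1 := PiLp.norm_apply_le ξ (k, β)
    have h2 := PiLp.norm_apply_le ζ (h, α)
    have h3 := ha h k α β
    gcongr
  calc ‖form2 a ξ ζ‖ ≤ ∑ _h : Fin n, ∑ _k : Fin n, ∑ _α : Fin m, ∑ _β : Fin m, Λ * ‖ξ‖ * ‖ζ‖ :=
        norm_sum_le_of_le _ fun h _ => norm_sum_le_of_le _ fun k _ => norm_sum_le_of_le _
          fun α _ => norm_sum_le_of_le _ fun β _ => key h k α β
    _ = _ := by simp; ring

lemma norm_form1_le (b : Coeff1 n m) {c : ℝ} (hb : ∀ h α β, ‖b h α β‖ ≤ c)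
    (ξ : Tens n m) (w : Val m) : ‖form1 b ξ w‖ ≤ (n * m ^ 2) * (c * ‖ξ‖ * ‖w‖) := by
  have key : ∀ h α β, ‖b h α β * ξ (h, β) * (starRingEnd ℂ) (w α)‖ ≤ c * ‖ξ‖ * ‖w‖ := by
    intro h α β
    rw [norm_mul, norm_mul, RCLike.norm_conj]
    have h1 := PiLp.norm_apply_le ξ (h, β)
    have h2 := PiLp.norm_apply_le w α
    have h3 := hb h α β
    have : 0 ≤ c := (norm_nonneg _).trans h3
    gcongr
  calc ‖form1 b ξ w‖ ≤ ∑ _h : Fin n, ∑ _α : Fin m, ∑ _β : Fin m, c * ‖ξ‖ * ‖w‖ :=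
        norm_sum_le_of_le _ fun h _ => norm_sum_le_of_le _ fun α _ => norm_sum_le_of_le _
          fun β _ => key h α β
    _ = _ := by simp; ring

/-! ### The pointwise inequality for the partition -/

set_option maxHeartbeats 1000000 in
/-- The algebraic heart of the Caccioppoli inequality: the form tested with the pieces
`c₁ v`, `c₀ v` of a slowly varying partition, compared with the form that the equation controls. -/
lemma pointwise_form_inequality {V : Type*} [NormedAddCommGroup V] [NormedSpace ℝ V]
    (b : V →ₗ[ℝ] V →ₗ[ℝ] ℝ) {M S ε l mup c1 c0 d1 d0 σ : ℝ}
    (hb : ∀ x y, |b x y| ≤ M * ‖x‖ * ‖y‖) (hM : 0 ≤ M) (hl : 0 < l)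
    (hmup : |mup| ≤ 1) (hS : 1 ≤ S) (hσS : |σ| ≤ S)
    (hσ : σ = mup * c1 ^ 2 * (1 + σ)) (hc : c1 ^ 2 + c0 ^ 2 = 1)
    (hd1 : |d1| ≤ ε) (hd0 : |d0| ≤ ε) (hε1 : ε ≤ 1)
    (hε : ε * (64 * M * S + 32 * M + 4 * l) ≤ l / 32)
    {l1 l0 : ℝ} (hl1 : l ≤ l1) (hl0 : l ≤ l0)
    (X Y Z : V) (hYX : ‖Y‖ ≤ ‖X‖) (hX : ‖X‖ ≤ 2 * ‖X + σ • Y‖) :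
    b ((c1 • (X + σ • Y + Z) + d1 • Y) - mup • (c1 • ((1 + σ) • Y + Z) + d1 • Y))
        ((c1 • (X + σ • Y + Z) + d1 • Y) + mup • (c1 • ((1 + σ) • Y + Z) + d1 • Y))
      + b (c0 • (X + σ • Y + Z) + d0 • Y) (c0 • (X + σ • Y + Z) + d0 • Y)
      + (mup * c0 * c1 * (1 + σ)) ^ 2 * b Y Y
      - l1 * ‖c1 • (X + σ • Y + Z) + d1 • Y‖ ^ 2 - l0 * ‖c0 • (X + σ • Y + Z) + d0 • Y‖ ^ 2
      ≤ b X (X + (2 * σ) • Y) - l / 16 * ‖X‖ ^ 2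
        + (8 * (64 * M * S) ^ 2 / l + 32 * M + 4 * l) * ‖Z‖ ^ 2 := by
  have hε0 : 0 ≤ ε := (abs_nonneg _).trans hd1
  set x := ‖X‖ with hx
  set z := ‖Z‖ with hz
  have hx0 : 0 ≤ x := norm_nonneg _
  have hz0 : 0 ≤ z := norm_nonneg _
  have hc1 : |c1| ≤ 1 := (sq_le_one_iff_abs_le_one c1).1 (by nlinarith [sq_nonneg c0])
  have hc0 : |c0| ≤ 1 := (sq_le_one_iff_abs_le_one c0).1 (by nlinarith [sq_nonneg c1])
  -- All errors are measured by w: the contribution Z of the gradient of the cut-off, plus ε‖X‖ from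
  -- the derivatives of the partition.
  set w := z + ε * x with hw
  have hw0 : 0 ≤ w := by positivity
  -- the general perturbation estimate
  have pert : ∀ P P' e e' : V, ‖P‖ ≤ 4 * S * x → ‖P'‖ ≤ 4 * S * x → ‖e‖ ≤ 2 * w → ‖e'‖ ≤ 2 * w →
      b (P + e) (P' + e') ≤ b P P' + M * (16 * S * x * w + 4 * w ^ 2) := by
    intro P P' e e' hP hP' he he'
    have h1 := (le_abs_self _).trans (hb P e')
    have h2 := (le_abs_self _).trans (hb e P')
    have h3 := (le_abs_self _).trans (hb e e')
    have h4 : M * ‖P‖ * ‖e'‖ ≤ M * (4 * S * x) * (2 * w) := by gcongr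
    have h5 : M * ‖e‖ * ‖P'‖ ≤ M * (2 * w) * (4 * S * x) := by gcongr
    have h6 : M * ‖e‖ * ‖e'‖ ≤ M * (2 * w) * (2 * w) := by gcongr
    simp only [map_add, LinearMap.add_apply]
    linarith
  have bd : ∀ c d : ℝ, |c| ≤ 2 → |d| ≤ 2 * ε → ‖c • Z + d • Y‖ ≤ 2 * w := by
    intro c d hc' hd'
    calc ‖c • Z + d • Y‖ ≤ |c| * z + |d| * ‖Y‖ := by
          refine (norm_add_le _ _).trans ?_
          simp [norm_smul, hz]
      _ ≤ 2 * z + 2 * ε * x := by gcongr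
      _ = 2 * w := by rw [hw]; ring
  have bdP : ∀ c t : ℝ, |c| ≤ 1 → |t| ≤ 3 * S → ‖c • (X + t • Y)‖ ≤ 4 * S * x := by
    intro c t hc' ht
    calc ‖c • (X + t • Y)‖ ≤ |c| * (x + |t| * ‖Y‖) := by
          rw [norm_smul, Real.norm_eq_abs]
          refine mul_le_mul_of_nonneg_left ((norm_add_le _ _).trans ?_) (abs_nonneg _)
          simp [norm_smul, hx]
      _ ≤ 1 * (x + 3 * S * x) := by gcongr
      _ ≤ 4 * S * x := by nlinarith
  have hσ1 : |1 + σ| ≤ 2 * S := (abs_add_le _ _).trans (by rw [abs_one]; linarith)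
  have hmσ : |mup * (1 + σ)| ≤ 2 * S := by
    rw [abs_mul]
    calc |mup| * |1 + σ| ≤ 1 * (2 * S) := by gcongr
      _ = 2 * S := one_mul _
  have hm1 := abs_le.1 hmup
  have hm2 : |1 - mup| ≤ 2 := abs_le.2 ⟨by linarith, by linarith⟩
  have hm3 : |1 + mup| ≤ 2 := abs_le.2 ⟨by linarith, by linarith⟩
  have hprod : ∀ {a t A : ℝ}, |a| ≤ A → |t| ≤ 2 → |a * t| ≤ 2 * A := by
    intro a t A ha ht
    rw [abs_mul, mul_comm]
    exact mul_le_mul ht ha (abs_nonneg _) (by norm_num)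
  have hdd1 : |d1 * (1 - mup)| ≤ 2 * ε := hprod hd1 hm2
  have hdd1' : |d1 * (1 + mup)| ≤ 2 * ε := hprod hd1 hm3
  have hcc1 : |c1 * (1 - mup)| ≤ 2 := (hprod hc1 hm2).trans (by norm_num)
  have hcc1' : |c1 * (1 + mup)| ≤ 2 := (hprod hc1 hm3).trans (by norm_num)
  have e1 := pert (c1 • (X + (σ - mup * (1 + σ)) • Y)) (c1 • (X + (σ + mup * (1 + σ)) • Y))
    ((c1 * (1 - mup)) • Z + (d1 * (1 - mup)) • Y) ((c1 * (1 + mup)) • Z + (d1 * (1 + mup)) • Y)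
    (bdP _ _ hc1 ((abs_sub _ _).trans (by linarith)))
    (bdP _ _ hc1 ((abs_add_le _ _).trans (by linarith)))
    (bd _ _ hcc1 hdd1) (bd _ _ hcc1' hdd1')
  have e0 := pert (c0 • (X + σ • Y)) (c0 • (X + σ • Y)) (c0 • Z + d0 • Y) (c0 • Z + d0 • Y)
    (bdP _ _ hc0 (by linarith)) (bdP _ _ hc0 (by linarith))
    (bd _ _ (by linarith) (by linarith)) (bd _ _ (by linarith) (by linarith))
  have r1 : (c1 • (X + σ • Y + Z) + d1 • Y) - mup • (c1 • ((1 + σ) • Y + Z) + d1 • Y) =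
      c1 • (X + (σ - mup * (1 + σ)) • Y) + ((c1 * (1 - mup)) • Z + (d1 * (1 - mup)) • Y) := by
    module
  have r2 : (c1 • (X + σ • Y + Z) + d1 • Y) + mup • (c1 • ((1 + σ) • Y + Z) + d1 • Y) =
      c1 • (X + (σ + mup * (1 + σ)) • Y) + ((c1 * (1 + mup)) • Z + (d1 * (1 + mup)) • Y) := by
    module
  have r0 : c0 • (X + σ • Y + Z) + d0 • Y = c0 • (X + σ • Y) + (c0 • Z + d0 • Y) := by module
  have r1' : c1 • (X + σ • Y + Z) + d1 • Y = c1 • (X + σ • Y) + (c1 • Z + d1 • Y) := by module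
  -- the exact identity
  have exact_id : b (c1 • (X + (σ - mup * (1 + σ)) • Y)) (c1 • (X + (σ + mup * (1 + σ)) • Y)) +
      b (c0 • (X + σ • Y)) (c0 • (X + σ • Y)) + (mup * c0 * c1 * (1 + σ)) ^ 2 * b Y Y =
      b X (X + (2 * σ) • Y) := by
    have hc0' : c0 ^ 2 = 1 - c1 ^ 2 := by linarith
    simp only [map_add, map_smul, LinearMap.add_apply, LinearMap.smul_apply, smul_eq_mul]
    -- The coefficients of b X Y and b Y X are σ ± μc1²(1+σ), that is 2σ and 0. That of b Y Y from
    -- the first two forms is σ² - μ²c1²(1+σ)² = -(μc0c1(1+σ))², which the third term cancels.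
    linear_combination (b X X + σ * b X Y + σ * b Y X + σ ^ 2 * b Y Y
        + (mup * c1 * (1 + σ)) ^ 2 * b Y Y) * hc
      + (- b X Y + b Y X + (σ + mup * c1 ^ 2 * (1 + σ)) * b Y Y) * hσ
  have nl : ∀ c d : ℝ, |c| ≤ 1 → |d| ≤ ε →
      c ^ 2 * ‖X + σ • Y‖ ^ 2 / 2 - w ^ 2 ≤ ‖c • (X + σ • Y) + (c • Z + d • Y)‖ ^ 2 := by
    intro c d hc' hd'
    have h1 : ‖c • Z + d • Y‖ ≤ w := by
      calc ‖c • Z + d • Y‖ ≤ |c| * z + |d| * ‖Y‖ := by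
            refine (norm_add_le _ _).trans ?_
            simp [norm_smul, hz]
        _ ≤ 1 * z + ε * x := by gcongr
        _ = w := by rw [hw]; ring
    have h2 : |c| * ‖X + σ • Y‖ ≤ ‖c • (X + σ • Y) + (c • Z + d • Y)‖ + ‖c • Z + d • Y‖ := by
      rw [← Real.norm_eq_abs, ← norm_smul]
      calc ‖c • (X + σ • Y)‖ = ‖(c • (X + σ • Y) + (c • Z + d • Y)) - (c • Z + d • Y)‖ := by
            rw [add_sub_cancel_right]
        _ ≤ _ := norm_sub_le _ _
    have h3 : |c| * ‖X + σ • Y‖ ≤ ‖c • (X + σ • Y) + (c • Z + d • Y)‖ + w := by linarith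
    have h4 : (|c| * ‖X + σ • Y‖) ^ 2 ≤ (‖c • (X + σ • Y) + (c • Z + d • Y)‖ + w) ^ 2 := by
      gcongr
    rw [mul_pow, sq_abs] at h4
    linarith [sq_nonneg (‖c • (X + σ • Y) + (c • Z + d • Y)‖ - w),
      add_sq (‖c • (X + σ • Y) + (c • Z + d • Y)‖) w, sub_sq (‖c • (X + σ • Y) + (c • Z + d • Y)‖) w]
  have n1 := nl c1 d1 hc1 hd1
  have n0 := nl c0 d0 hc0 hd0
  rw [r1, r2, r0, r1']
  set N1 := ‖c1 • (X + σ • Y) + (c1 • Z + d1 • Y)‖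
  set N0 := ‖c0 • (X + σ • Y) + (c0 • Z + d0 • Y)‖
  have hT : x ^ 2 ≤ 4 * ‖X + σ • Y‖ ^ 2 := by
    calc x ^ 2 ≤ (2 * ‖X + σ • Y‖) ^ 2 := by gcongr
      _ = _ := by ring
  have hN : x ^ 2 / 8 - 2 * w ^ 2 ≤ N1 ^ 2 + N0 ^ 2 := by
    have : c1 ^ 2 * ‖X + σ • Y‖ ^ 2 + c0 ^ 2 * ‖X + σ • Y‖ ^ 2 = ‖X + σ • Y‖ ^ 2 := by
      rw [← add_mul, hc, one_mul]
    linarith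
  have hN' : l * (x ^ 2 / 8 - 2 * w ^ 2) ≤ l1 * N1 ^ 2 + l0 * N0 ^ 2 := by
    have := mul_le_mul_of_nonneg_left hN hl.le
    linarith [mul_le_mul_of_nonneg_right hl1 (sq_nonneg N1),
      mul_le_mul_of_nonneg_right hl0 (sq_nonneg N0)]
  have hw2 : w ^ 2 ≤ 2 * z ^ 2 + 2 * ε * x ^ 2 := by
    have h1 : w ^ 2 ≤ 2 * z ^ 2 + 2 * ε ^ 2 * x ^ 2 := by
      rw [hw]; nlinarith [sq_nonneg (z - ε * x)]
    have h2 : ε ^ 2 ≤ ε := by nlinarith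
    linarith [mul_le_mul_of_nonneg_right h2 (sq_nonneg x)]
  have hxz : 64 * M * S * (x * z) ≤ l / 32 * x ^ 2 + 8 * (64 * M * S) ^ 2 / l * z ^ 2 := by
    have : 0 ≤ (l / 4 * x - 4 * (64 * M * S) * z) ^ 2 / (2 * l) := by positivity
    have e : (l / 4 * x - 4 * (64 * M * S) * z) ^ 2 / (2 * l) =
        l / 32 * x ^ 2 + 8 * (64 * M * S) ^ 2 / l * z ^ 2 - 64 * M * S * (x * z) := by
      field_simp; ring
    linarith
  have hMw := mul_le_mul_of_nonneg_left hw2 hM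
  have hlw := mul_le_mul_of_nonneg_left hw2 hl.le
  have hεx := mul_le_mul_of_nonneg_right hε (sq_nonneg x)
  have hMSx : 0 ≤ M * S * (x * z) := by positivity
  have hMSx2 : 0 ≤ M * S * ε * x ^ 2 := by positivity
  have hMxw : M * (16 * S * x * w) = 16 * (M * S * (x * z)) + 16 * (M * S * ε * x ^ 2) := by
    rw [hw]; ring
  -- Of the coercive l/8, Young's inequality for ‖X‖‖Z‖ uses l/32 and the terms with ε use l/32 by
  -- `hε`; l/16 remains.
  linarith [mul_nonneg hM (sq_nonneg w)]

end PEllipticSystem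

namespace PEllipticSystem
open Filter Topology

variable {n m : ℕ}

/-! ### Convergence in `L²` -/

lemma tendsto_eLpNorm_two_of_dominated {α E : Type*} [MeasurableSpace α] {μ : Measure α}
    [NormedAddCommGroup E] {F : ℕ → α → E} {g : α → ℝ}
    (hF : ∀ k, AEStronglyMeasurable (F k) μ) (hg : MemLp g 2 μ)
    (hle : ∀ k, ∀ᵐ y ∂μ, ‖F k y‖ ≤ g y)
    (hlim : ∀ᵐ y ∂μ, Tendsto (fun k => F k y) atTop (𝓝 0)) :
    Tendsto (fun k => eLpNorm (F k) 2 μ) atTop (𝓝 0) := by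
  have hg2 : ∫⁻ y, ‖g y‖ₑ ^ (2 : ℝ) ∂μ ≠ ⊤ := by
    have := (eLpNorm_lt_top_iff_lintegral_rpow_enorm_lt_top (p := 2) (by simp) (by simp)).1 hg.2
    simpa using this.ne
  have h := tendsto_lintegral_of_dominated_convergence' (μ := μ)
    (F := fun k y => ‖F k y‖ₑ ^ (2 : ℝ)) (f := fun _ => 0) (fun y => ‖g y‖ₑ ^ (2 : ℝ))
    (fun k => (hF k).enorm.pow_const _)
    (fun k => by
      filter_upwards [hle k] with y hy
      have : ‖F k y‖ₑ ≤ ‖g y‖ₑ := by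
        rw [enorm_le_iff_norm_le]
        exact hy.trans (le_abs_self _)
      gcongr)
    hg2
    (by
      filter_upwards [hlim] with y hy
      have h1 : Tendsto (fun k => ‖F k y‖ₑ) atTop (𝓝 0) := by
        have := hy.enorm; simpa using this
      have := h1.ennrpow_const 2
      simpa using this)
  simp only [lintegral_zero] at h
  have h2 := h.ennrpow_const (1 / 2)
  simp only [one_div, ENNReal.zero_rpow_of_pos (show (0 : ℝ) < 2⁻¹ by norm_num)] at h2
  refine h2.congr fun k => ?_
  rw [eLpNorm_eq_lintegral_rpow_enorm_toReal (by simp) (by simp)]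
  simp

/-- Cauchy–Schwarz against a fixed L² function converts L² convergence into convergence of
integrals. This is the device for passing from test functions to W^{1,2}_0 in bilinear expressions.
-/
lemma tendsto_integral_of_eLpNorm_two {α E F : Type*} [MeasurableSpace α] {μ : Measure α}
    [NormedAddCommGroup E] [NormedAddCommGroup F] [NormedSpace ℝ F] {f : ℕ → α → E} {g : α → ℝ}
    {H : ℕ → α → F} {H₀ : α → F} (hf : ∀ k, AEStronglyMeasurable (f k) μ) (hg : MemLp g 2 μ)
    (hH : ∀ k, Integrable (H k) μ) (hH₀ : Integrable H₀ μ)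
    (hle : ∀ k, ∀ᵐ y ∂μ, ‖H k y - H₀ y‖ ≤ g y * ‖f k y‖)
    (hlim : Tendsto (fun k => eLpNorm (f k) 2 μ) atTop (𝓝 0)) :
    Tendsto (fun k => ∫ y, H k y ∂μ) atTop (𝓝 (∫ y, H₀ y ∂μ)) := by
  refine tendsto_integral_of_L1 H₀ hH₀.1 (Eventually.of_forall hH) ?_
  have h1 : ∀ k, ∫⁻ y, ‖H k y - H₀ y‖ₑ ∂μ ≤ eLpNorm g 2 μ * eLpNorm (f k) 2 μ := by
    intro k
    calc ∫⁻ y, ‖H k y - H₀ y‖ₑ ∂μ ≤ ∫⁻ y, ‖g y * ‖f k y‖‖ₑ ∂μ := by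
          refine lintegral_mono_ae ?_
          filter_upwards [hle k] with y hy
          rw [enorm_le_iff_norm_le]
          exact hy.trans (le_abs_self _)
      _ = eLpNorm (g • fun y => ‖f k y‖) 1 μ := by
          rw [eLpNorm_one_eq_lintegral_enorm]; rfl
      _ ≤ eLpNorm g 2 μ * eLpNorm (fun y => ‖f k y‖) 2 μ :=
          eLpNorm_smul_le_mul_eLpNorm (hf k).norm hg.1
      _ = eLpNorm g 2 μ * eLpNorm (f k) 2 μ := by rw [eLpNorm_norm]
  have h2 : Tendsto (fun k => eLpNorm g 2 μ * eLpNorm (f k) 2 μ) atTop (𝓝 0) := by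
    have := ENNReal.Tendsto.const_mul (a := eLpNorm g 2 μ) hlim (Or.inr hg.2.ne)
    simpa using this
  exact tendsto_of_tendsto_of_tendsto_of_le_of_le tendsto_const_nhds h2 (fun _ => zero_le) h1

/-! ### Classical gradients -/

/-- The linear map sending a derivative to the tensor of its partial derivatives. -/
noncomputable def gradOfFDeriv (T : Pt n →L[ℝ] Val m) : Tens n m :=
  WithLp.toLp 2 (fun i : Fin n × Fin m => T (EuclideanSpace.single i.1 (1 : ℝ)) i.2)

lemma continuous_gradOfFDeriv : Continuous (gradOfFDeriv : (Pt n →L[ℝ] Val m) → Tens n m) := by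
  unfold gradOfFDeriv
  fun_prop

lemma norm_fderiv_apply_le (v : Pt n → Val m) (y z : Pt n) :
    ‖fderiv ℝ v y z‖ ≤ n * ‖grad v y‖ * ‖z‖ := by
  have hz : z = ∑ h, z h • EuclideanSpace.single h (1 : ℝ) := by
    ext i
    simp [Finset.sum_apply, Pi.single_apply]
  conv_lhs => rw [hz]
  rw [map_sum]
  calc ‖∑ h, fderiv ℝ v y (z h • EuclideanSpace.single h (1 : ℝ))‖
      ≤ ∑ _h : Fin n, ‖grad v y‖ * ‖z‖ := by
        refine norm_sum_le_of_le _ fun h _ => ?_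
        rw [map_smul, norm_smul, mul_comm]
        have h1 : ‖fderiv ℝ v y (EuclideanSpace.single h (1 : ℝ))‖ ≤ ‖grad v y‖ :=
          norm_row_le h (grad v y)
        have h2 := PiLp.norm_apply_le z h
        gcongr
    _ = _ := by simp; ring

lemma norm_fderiv_le (v : Pt n → Val m) (y : Pt n) : ‖fderiv ℝ v y‖ ≤ n * ‖grad v y‖ :=
  ContinuousLinearMap.opNorm_le_bound _ (by positivity) fun z => norm_fderiv_apply_le v y z

lemma grad_sub {v w : Pt n → Val m} {y : Pt n} (hv : DifferentiableAt ℝ v y)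
    (hw : DifferentiableAt ℝ w y) : grad (fun y => v y - w y) y = grad v y - grad w y := by
  ext i
  simp [grad, pderiv, fderiv_fun_sub hv hw]

lemma grad_smul {η : Pt n → ℝ} {w : Pt n → Val m} {y : Pt n} (hη : DifferentiableAt ℝ η y)
    (hw : DifferentiableAt ℝ w y) :
    grad (fun y => η y • w y) y = η y • grad w y + tensor (fun h => pderiv h η y) (w y) := by
  ext i
  simp [grad, pderiv, fderiv_fun_smul hη hw]

/-- Apply a real linear map to each row of a tensor. -/
noncomputable def mapRows (T : Val m →L[ℝ] Val m) (ξ : Tens n m) : Tens n m :=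
  WithLp.toLp 2 (fun i : Fin n × Fin m => T (row i.1 ξ) i.2)

lemma row_mapRows (T : Val m →L[ℝ] Val m) (ξ : Tens n m) (h : Fin n) :
    row h (mapRows T ξ) = T (row h ξ) := rfl

lemma norm_mapRows_le (T : Val m →L[ℝ] Val m) (ξ : Tens n m) : ‖mapRows T ξ‖ ≤ ‖T‖ * ‖ξ‖ := by
  refine le_of_sq_le_sq ?_ (by positivity)
  rw [mul_pow, norm_sq_eq_sum_row, norm_sq_eq_sum_row ξ, Finset.mul_sum]
  refine Finset.sum_le_sum fun h _ => ?_
  rw [row_mapRows, ← mul_pow]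
  gcongr
  exact T.le_opNorm _

lemma mapRows_sub_right (T : Val m →L[ℝ] Val m) (ξ ζ : Tens n m) :
    mapRows T (ξ - ζ) = mapRows T ξ - mapRows T ζ := by
  ext i
  have : row i.1 (ξ - ζ) = row i.1 ξ - row i.1 ζ := rfl
  simp [mapRows, this]

lemma mapRows_sub_left (T S : Val m →L[ℝ] Val m) (ξ : Tens n m) :
    mapRows (T - S) ξ = mapRows T ξ - mapRows S ξ := by
  ext i; simp [mapRows]

lemma continuous_row (h : Fin n) : Continuous (row h : Tens n m → Val m) := by
  unfold row; fun_prop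

lemma continuous_mapRows :
    Continuous (fun q : (Val m →L[ℝ] Val m) × Tens n m => mapRows q.1 q.2) := by
  unfold mapRows
  refine (PiLp.continuous_toLp 2 _).comp (continuous_pi fun i => ?_)
  have h1 : Continuous fun q : (Val m →L[ℝ] Val m) × Tens n m => q.1 (row i.1 q.2) :=
    continuous_fst.clm_apply ((continuous_row i.1).comp continuous_snd)
  fun_prop

lemma grad_comp {F : Val m → Val m} {v : Pt n → Val m} {y : Pt n}
    (hF : DifferentiableAt ℝ F (v y)) (hv : DifferentiableAt ℝ v y) :
    grad (fun y => F (v y)) y = mapRows (fderiv ℝ F (v y)) (grad v y) := by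
  ext i
  have := fderiv_comp (𝕜 := ℝ) y (g := F) (f := v) hF hv
  simp only [grad, pderiv, mapRows]
  change (fderiv ℝ (F ∘ v) y _) _ = _
  rw [this]
  rfl

lemma tensor_sub_right (b : Fin n → ℝ) (w w' : Val m) :
    tensor b (w - w') = tensor b w - tensor b w' := by
  ext i; simp [mul_sub]

lemma continuous_tensor : Continuous (fun q : (Fin n → ℝ) × Val m => tensor q.1 q.2) := by
  unfold tensor; fun_prop

lemma norm_tensor_le {b : Fin n → ℝ} {c : ℝ} (hc : 0 ≤ c) (hb : ∀ h, |b h| ≤ c) (w : Val m) :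
    ‖tensor b w‖ ≤ (n * c) * ‖w‖ := by
  refine le_of_sq_le_sq ?_ (by positivity)
  rw [norm_tensor_sq, mul_pow]
  gcongr
  calc ∑ h, b h ^ 2 ≤ ∑ _h : Fin n, c ^ 2 := Finset.sum_le_sum fun h _ => by
        rw [← sq_abs]; gcongr; exact hb h
    _ = n * c ^ 2 := by simp
    _ ≤ (n * c) ^ 2 := by
        rw [mul_pow]
        gcongr
        rcases n.eq_zero_or_pos with h | h
        · simp [h]
        · have : (1 : ℝ) ≤ n := by exact_mod_cast h
          nlinarith

section IsTest
variable {F : Type*} [NormedAddCommGroup F] [NormedSpace ℝ F] {Ω : Set (Pt n)}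

lemma IsTest.continuous_pderiv {ψ : Pt n → F} (hψ : IsTest Ω ψ) (h : Fin n) :
    Continuous (pderiv h ψ) :=
  (hψ.1.continuous_fderiv (by simp)).clm_apply continuous_const

lemma IsTest.hasCompactSupport_pderiv {ψ : Pt n → F} (hψ : IsTest Ω ψ) (h : Fin n) :
    HasCompactSupport (pderiv h ψ) :=
  hψ.2.1.fderiv_apply ℝ _

lemma IsTest.exists_bound {ψ : Pt n → F} (hψ : IsTest Ω ψ) :
    ∃ C : ℝ, 0 ≤ C ∧ (∀ y, ‖ψ y‖ ≤ C) ∧ ∀ h y, ‖pderiv h ψ y‖ ≤ C := by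
  obtain ⟨C, hC⟩ := hψ.2.1.exists_bound_of_continuous hψ.1.continuous
  choose D hD using fun h =>
    (hψ.hasCompactSupport_pderiv h).exists_bound_of_continuous (hψ.continuous_pderiv h)
  have hD0 : ∀ h, 0 ≤ D h := fun h => (norm_nonneg _).trans (hD h 0)
  have hC0 : 0 ≤ C := (norm_nonneg _).trans (hC 0)
  have hs : 0 ≤ ∑ h, D h := Finset.sum_nonneg fun h _ => hD0 h
  refine ⟨C + ∑ h, D h, by positivity, fun y => (hC y).trans (by linarith), fun h y => ?_⟩
  refine (hD h y).trans ?_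
  have := Finset.single_le_sum (f := D) (fun h _ => hD0 h) (Finset.mem_univ h)
  linarith

lemma IsTest.mono {ψ : Pt n → F} {Ω' : Set (Pt n)} (hψ : IsTest Ω ψ) (h : Ω ⊆ Ω') : IsTest Ω' ψ :=
  ⟨hψ.1, hψ.2.1, hψ.2.2.trans h⟩

lemma IsTest.differentiable {ψ : Pt n → F} (hψ : IsTest Ω ψ) : Differentiable ℝ ψ :=
  hψ.1.differentiable (by simp)

lemma IsTest.continuous_grad {φ : Pt n → Val m} (hφ : IsTest Ω φ) : Continuous (grad φ) :=
  continuous_gradOfFDeriv.comp (hφ.1.continuous_fderiv (by simp))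

lemma IsTest.hasCompactSupport_grad {φ : Pt n → Val m} (hφ : IsTest Ω φ) :
    HasCompactSupport (grad φ) := by
  have := (hφ.2.1.fderiv ℝ).comp_left (g := (gradOfFDeriv : (Pt n →L[ℝ] Val m) → Tens n m))
    (by ext i; simp [gradOfFDeriv])
  exact this

lemma IsTest.grad_eq_zero {φ : Pt n → Val m} (hφ : IsTest Ω φ) {y : Pt n} (hy : y ∉ Ω) :
    grad φ y = 0 := by
  have h0 : fderiv ℝ φ y = 0 := by
    by_contra h
    exact hy (hφ.2.2 (support_fderiv_subset ℝ h))
  ext i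
  simp [grad, pderiv, h0]

lemma IsTest.eq_zero {ψ : Pt n → F} (hψ : IsTest Ω ψ) {y : Pt n} (hy : y ∉ Ω) : ψ y = 0 :=
  image_eq_zero_of_notMem_tsupport fun h => hy (hψ.2.2 h)

lemma IsTest.pderiv_eq_zero {ψ : Pt n → F} (hψ : IsTest Ω ψ) {y : Pt n} (hy : y ∉ Ω) (h : Fin n) :
    pderiv h ψ y = 0 := by
  have h0 : fderiv ℝ ψ y = 0 := by
    by_contra h
    exact hy (hψ.2.2 (support_fderiv_subset ℝ h))
  simp [pderiv, h0]

lemma IsTest.memLp {ψ : Pt n → F} (hψ : IsTest Ω ψ) (p : ℝ≥0∞) (S : Set (Pt n)) :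
    MemLp ψ p (volume.restrict S) :=
  (hψ.1.continuous.memLp_of_hasCompactSupport hψ.2.1).restrict S

lemma IsTest.memLp_grad {φ : Pt n → Val m} (hφ : IsTest Ω φ) (p : ℝ≥0∞) (S : Set (Pt n)) :
    MemLp (grad φ) p (volume.restrict S) :=
  (hφ.continuous_grad.memLp_of_hasCompactSupport hφ.hasCompactSupport_grad).restrict S

lemma IsTest.sub {ψ χ : Pt n → F} (hψ : IsTest Ω ψ) (hχ : IsTest Ω χ) :
    IsTest Ω (fun y => ψ y - χ y) :=
  ⟨hψ.1.sub hχ.1, hψ.2.1.sub hχ.2.1,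
    (tsupport_sub ψ χ).trans (Set.union_subset hψ.2.2 hχ.2.2)⟩

end IsTest

/-! ### Functions approximated by test functions -/

/-- `v`, with gradient `G`, is the limit in `W^{1,2}(Ω)` of a sequence of test functions
supported in `V`, which also converges almost everywhere. -/
def W0On (Ω V : Set (Pt n)) (v : Pt n → Val m) (G : Pt n → Tens n m) : Prop :=
  MemLp v 2 (volume.restrict Ω) ∧ MemLp G 2 (volume.restrict Ω) ∧
  ∃ φ : ℕ → Pt n → Val m, (∀ k, IsTest V (φ k)) ∧
    Tendsto (fun k => eLpNorm (fun y => v y - φ k y) 2 (volume.restrict Ω)) atTop (𝓝 0) ∧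
    Tendsto (fun k => eLpNorm (fun y => G y - grad (φ k) y) 2 (volume.restrict Ω)) atTop (𝓝 0) ∧
    ∀ᵐ y ∂(volume.restrict Ω), Tendsto (fun k => φ k y) atTop (𝓝 (v y))

variable {Ω V : Set (Pt n)} {v : Pt n → Val m} {G : Pt n → Tens n m}

lemma W0On.memW12Zero (h : W0On Ω V v G) (hV : V ⊆ Ω) : MemW12Zero Ω v G := by
  obtain ⟨hv, hG, φ, hφ, h1, h2, -⟩ := h
  refine ⟨hv, hG, fun ε hε => ?_⟩
  obtain ⟨k, hk1, hk2⟩ := ((h1.eventually (gt_mem_nhds hε)).and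
    (h2.eventually (gt_mem_nhds hε))).exists
  exact ⟨φ k, (hφ k).mono hV, hk1, hk2⟩

/-- Approximations with errors 1/(k+1) converge in L², hence in measure, and a subsequence converges
almost everywhere. The pointwise convergence is needed for the chain rule and for Fatou's lemma. -/
lemma MemW12Zero.w0On (h : MemW12Zero Ω v G) : W0On Ω Ω v G := by
  obtain ⟨hv, hG, h⟩ := h
  choose φ hφ h1 h2 using fun k : ℕ => h ((k : ℝ≥0∞) + 1)⁻¹ (by simp)
  have hlim : Tendsto (fun k : ℕ => ((k : ℝ≥0∞) + 1)⁻¹) atTop (𝓝 0) := by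
    have := (tendsto_add_atTop_iff_nat 1).2 ENNReal.tendsto_inv_nat_nhds_zero
    simpa using this
  have t1 : Tendsto (fun k => eLpNorm (fun y => v y - φ k y) 2 (volume.restrict Ω)) atTop (𝓝 0) :=
    tendsto_of_tendsto_of_tendsto_of_le_of_le tendsto_const_nhds hlim (fun _ => zero_le)
      fun k => (h1 k).le
  have t2 : Tendsto (fun k => eLpNorm (fun y => G y - grad (φ k) y) 2 (volume.restrict Ω)) atTop
      (𝓝 0) :=
    tendsto_of_tendsto_of_tendsto_of_le_of_le tendsto_const_nhds hlim (fun _ => zero_le)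
      fun k => (h2 k).le
  obtain ⟨ns, hns, hae⟩ := (tendstoInMeasure_of_tendsto_eLpNorm (p := 2) (by simp)
    (fun k => ((hφ k).memLp 2 Ω).1) hv.1 (by
      refine t1.congr fun k => ?_
      rw [← eLpNorm_neg]
      congr 1
      ext1 y
      simp)).exists_seq_tendsto_ae
  exact ⟨hv, hG, fun k => φ (ns k), fun k => hφ _, t1.comp hns.tendsto_atTop,
    t2.comp hns.tendsto_atTop, hae⟩

lemma W0On.sub_test (h : W0On Ω V v G) {φ : Pt n → Val m} (hφ : IsTest V φ) :
    W0On Ω V (fun y => v y - φ y) (fun y => G y - grad φ y) := by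
  obtain ⟨hv, hG, ψ, hψ, h1, h2, h3⟩ := h
  refine ⟨hv.sub (hφ.memLp 2 Ω), hG.sub (hφ.memLp_grad 2 Ω), fun k y => ψ k y - φ y,
    fun k => (hψ k).sub hφ, ?_, ?_, ?_⟩
  · simpa using h1
  · refine h2.congr fun k => ?_
    congr 1
    ext1 y
    rw [grad_sub ((hψ k).differentiable y) (hφ.differentiable y)]
    simp
  · filter_upwards [h3] with y hy
    exact hy.sub_const _

/-- Chain rule for smooth maps with bounded derivative, with an additional cut-off. -/
lemma W0On.chain {U : Set (Pt n)} {F : Val m → Val m} {C : ℝ} (h : W0On Ω V v G)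
    (hF : ContDiff ℝ ∞ F) (hF0 : F 0 = 0) (hC : ∀ z, ‖fderiv ℝ F z‖ ≤ C) {η : Pt n → ℝ}
    (hη : IsTest U η) :
    W0On Ω (V ∩ U) (fun y => η y • F (v y))
      (fun y => η y • mapRows (fderiv ℝ F (v y)) (G y) +
        tensor (fun h => pderiv h η y) (F (v y))) := by
  obtain ⟨hv, hG, φ, hφ, h1, h2, h3⟩ := h
  obtain ⟨c, hc0, hc1, hc2⟩ := hη.exists_bound
  have hC0 : 0 ≤ C := (norm_nonneg _).trans (hC 0)
  have hFd : Differentiable ℝ F := hF.differentiable (by simp)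
  have hFd' : Continuous (fderiv ℝ F) := hF.continuous_fderiv (by simp)
  have hLip : ∀ z z', ‖F z - F z'‖ ≤ C * ‖z - z'‖ := fun z z' =>
    Convex.norm_image_sub_le_of_norm_fderiv_le (fun x _ => hFd x) (fun x _ => hC x)
      convex_univ (Set.mem_univ _) (Set.mem_univ _)
  have hLip0 : ∀ z, ‖F z‖ ≤ C * ‖z‖ := fun z => by simpa [hF0] using hLip z 0
  have hηc : Continuous η := hη.1.continuous
  have hηd : Continuous fun y => fun h => pderiv h η y :=
    continuous_pi fun h => hη.continuous_pderiv h
  have hb : ∀ y, ∀ h, |pderiv h η y| ≤ c := fun y h => hc2 h y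
  have hc1' : ∀ y, |η y| ≤ c := fun y => hc1 y
  have mFv : AEStronglyMeasurable (fun y => F (v y)) (volume.restrict Ω) :=
    hF.continuous.comp_aestronglyMeasurable hv.1
  have mten : ∀ {w : Pt n → Val m}, AEStronglyMeasurable w (volume.restrict Ω) →
      AEStronglyMeasurable (fun y => tensor (fun h => pderiv h η y) (w y)) (volume.restrict Ω) :=
    fun hw => continuous_tensor.comp_aestronglyMeasurable
      (hηd.aestronglyMeasurable.prodMk hw)
  have mrow : ∀ {T : Pt n → Val m →L[ℝ] Val m} {H : Pt n → Tens n m},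
      AEStronglyMeasurable T (volume.restrict Ω) → AEStronglyMeasurable H (volume.restrict Ω) →
      AEStronglyMeasurable (fun y => η y • mapRows (T y) (H y)) (volume.restrict Ω) :=
    fun hT hH => hηc.aestronglyMeasurable.smul
      (continuous_mapRows.comp_aestronglyMeasurable (hT.prodMk hH))
  have mDF : AEStronglyMeasurable (fun y => fderiv ℝ F (v y)) (volume.restrict Ω) :=
    hFd'.comp_aestronglyMeasurable hv.1
  have mDFk : ∀ k, AEStronglyMeasurable (fun y => fderiv ℝ F (φ k y)) (volume.restrict Ω) :=
    fun k => (hFd'.comp (hφ k).1.continuous).aestronglyMeasurable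
  have mG : ∀ k, AEStronglyMeasurable (fun y => G y - grad (φ k) y) (volume.restrict Ω) :=
    fun k => hG.1.sub ((hφ k).memLp_grad 2 Ω).1
  have mFF : ∀ k, AEStronglyMeasurable (fun y => F (v y) - F (φ k y)) (volume.restrict Ω) :=
    fun k => mFv.sub (hF.continuous.comp (hφ k).1.continuous).aestronglyMeasurable
  have bF : ∀ y, ‖η y • F (v y)‖ ≤ c * C * ‖v y‖ := fun y => by
    rw [norm_smul, mul_assoc]
    exact mul_le_mul (hc1 y) (hLip0 _) (norm_nonneg _) hc0
  have bt : ∀ y (w : Val m), ‖tensor (fun h => pderiv h η y) w‖ ≤ n * c * ‖w‖ :=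
    fun y w => norm_tensor_le hc0 (hb y) w
  have br : ∀ y z (H : Tens n m), ‖η y • mapRows (fderiv ℝ F z) H‖ ≤ c * C * ‖H‖ := by
    intro y z H
    rw [norm_smul, mul_assoc]
    refine mul_le_mul (hc1 y) ((norm_mapRows_le _ _).trans ?_) (norm_nonneg _) hc0
    gcongr
    exact hC z
  have scale : ∀ (c : ℝ) {f : ℕ → ℝ≥0∞}, Tendsto f atTop (𝓝 0) →
      Tendsto (fun k => ENNReal.ofReal c * f k) atTop (𝓝 0) := by
    intro c f hf
    have := ENNReal.Tendsto.const_mul (a := ENNReal.ofReal c) hf (Or.inr ENNReal.ofReal_ne_top)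
    simpa using this
  refine ⟨hv.of_le_mul (hηc.aestronglyMeasurable.smul mFv) (Eventually.of_forall bF),
    (hG.of_le_mul (mrow mDF hG.1) (Eventually.of_forall fun y => br y _ _)).add
      (hv.of_le_mul (c := n * c * C) (mten mFv) (Eventually.of_forall fun y => ?_)),
    fun k y => η y • F (φ k y), fun k => ⟨hη.1.smul (hF.comp (hφ k).1), ?_, ?_⟩, ?_, ?_, ?_⟩
  · refine (bt y _).trans ?_
    rw [mul_assoc (n * c : ℝ)]
    gcongr
    exact hLip0 _
  · exact hη.2.1.smul_right
  · refine Set.subset_inter ?_ ?_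
    · refine ((closure_mono ?_ : tsupport (fun y => η y • F (φ k y)) ⊆ tsupport (φ k))).trans
        (hφ k).2.2
      intro y hy h0
      exact hy (by simp only [h0, hF0, smul_zero])
    · refine ((closure_mono ?_ : tsupport (fun y => η y • F (φ k y)) ⊆ tsupport η)).trans hη.2.2
      intro y hy h0
      exact hy (by simp only [h0, zero_smul])
  · refine tendsto_of_tendsto_of_tendsto_of_le_of_le tendsto_const_nhds (scale (c * C) h1)
      (fun _ => zero_le) fun k => eLpNorm_le_mul_eLpNorm_of_ae_le_mul
        (Eventually.of_forall fun y => ?_) 2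
    rw [← smul_sub, norm_smul, mul_assoc]
    exact mul_le_mul (hc1 y) (hLip _ _) (norm_nonneg _) hc0
  · have d : ∀ k y, η y • mapRows (fderiv ℝ F (v y)) (G y) +
          tensor (fun h => pderiv h η y) (F (v y)) - grad (fun y => η y • F (φ k y)) y =
        η y • mapRows (fderiv ℝ F (φ k y)) (G y - grad (φ k) y) +
        tensor (fun h => pderiv h η y) (F (v y) - F (φ k y)) +
        η y • mapRows (fderiv ℝ F (v y) - fderiv ℝ F (φ k y)) (G y) := by
      intro k y
      rw [grad_smul (w := fun y => F (φ k y)) (hη.differentiable y)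
          ((hFd.comp (hφ k).differentiable) y),
        grad_comp (hFd _) ((hφ k).differentiable y), mapRows_sub_right, mapRows_sub_left,
        tensor_sub_right]
      module
    have t1 := scale (c * C) h2
    have t2 := scale (n * c * C) h1
    -- The derivative of F is not assumed Lipschitz, so the fixed gradient G is multiplied by a
    -- factor that is only bounded and tends to 0 almost everywhere; dominated convergence is used
    -- here, while the other two terms are linear in the errors.
    have t3 : Tendsto (fun k => eLpNorm (fun y => η y • mapRows (fderiv ℝ F (v y) -
        fderiv ℝ F (φ k y)) (G y)) 2 (volume.restrict Ω)) atTop (𝓝 0) := by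
      refine tendsto_eLpNorm_two_of_dominated (fun k => mrow (mDF.sub (mDFk k)) hG.1)
        (hG.norm.const_mul (c * (C + C))) (fun k => Eventually.of_forall fun y => ?_) ?_
      · rw [norm_smul, mul_assoc]
        refine mul_le_mul (hc1 y) ((norm_mapRows_le _ _).trans ?_) (norm_nonneg _) hc0
        gcongr
        exact (norm_sub_le _ _).trans (add_le_add (hC _) (hC _))
      · filter_upwards [h3] with y hy
        have : Tendsto (fun k => η y • mapRows (fderiv ℝ F (v y) - fderiv ℝ F (φ k y)) (G y)) atTop
            (𝓝 (η y • mapRows (fderiv ℝ F (v y) - fderiv ℝ F (v y)) (G y))) := by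
          refine (((continuous_mapRows (n := n) (m := m)).tendsto _).comp
            (Tendsto.prodMk_nhds (tendsto_const_nhds.sub ?_) tendsto_const_nhds)).const_smul _
          exact (hFd'.tendsto _).comp hy
        have z0 : mapRows (fderiv ℝ F (v y) - fderiv ℝ F (v y)) (G y) = 0 := by
          rw [sub_self]; ext i; simp [mapRows]
        rwa [z0, smul_zero] at this
    have t := (t1.add t2).add t3
    simp only [add_zero] at t
    refine tendsto_of_tendsto_of_tendsto_of_le_of_le tendsto_const_nhds t
      (fun _ => zero_le) fun k => ?_
    simp only [d]
    refine (eLpNorm_add_le ((mrow (mDFk k) (mG k)).add (mten (mFF k)))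
      (mrow (mDF.sub (mDFk k)) hG.1) (by norm_num)).trans ?_
    refine add_le_add ((eLpNorm_add_le (mrow (mDFk k) (mG k)) (mten (mFF k))
      (by norm_num)).trans (add_le_add ?_ ?_)) le_rfl
    · exact eLpNorm_le_mul_eLpNorm_of_ae_le_mul (Eventually.of_forall fun y => br y _ _) 2
    · refine eLpNorm_le_mul_eLpNorm_of_ae_le_mul (Eventually.of_forall fun y => ?_) 2
      refine (bt y _).trans ?_
      rw [mul_assoc (n * c : ℝ)]
      gcongr
      exact hLip _ _
  · filter_upwards [h3] with y hy
    exact ((hF.continuous.tendsto _).comp hy).const_smul _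

end PEllipticSystem

namespace PEllipticSystem
open Filter Topology

variable {n m : ℕ} {Ω V : Set (Pt n)} {v : Pt n → Val m} {G : Pt n → Tens n m}

/-! ### Uniqueness of weak gradients -/

/-- Since φ vanishes off Ω, both integrals are integrals over the whole space, where integration by
parts has no boundary term. Hence ψ may be supported elsewhere. -/
lemma IsTest.integral_pderiv_mul {Ω' : Set (Pt n)} {φ : Pt n → Val m} {ψ : Pt n → ℝ}
    (hφ : IsTest Ω φ) (hψ : IsTest Ω' ψ) (h : Fin n) (α : Fin m) :
    ∫ y in Ω, ((pderiv h ψ y : ℝ) : ℂ) * φ y α = - ∫ y in Ω, (ψ y : ℂ) * grad φ y (h, α) := by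
  rw [setIntegral_eq_integral_of_forall_compl_eq_zero fun y hy => by simp [hφ.eq_zero hy],
    setIntegral_eq_integral_of_forall_compl_eq_zero fun y hy => by simp [hφ.grad_eq_zero hy]]
  have hψd : ∀ y, HasFDerivAt (fun y => (ψ y : ℂ)) (Complex.ofRealCLM.comp (fderiv ℝ ψ y)) y :=
    fun y => Complex.ofRealCLM.hasFDerivAt.comp y (hψ.differentiable y).hasFDerivAt
  let P : Val m →L[ℝ] ℂ := (EuclideanSpace.proj (𝕜 := ℂ) α).restrictScalars ℝ
  have hφd : ∀ y, HasFDerivAt (fun y => φ y α) (P.comp (fderiv ℝ φ y)) y :=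
    fun y => P.hasFDerivAt.comp y (hφ.differentiable y).hasFDerivAt
  have e1 : ∀ y, fderiv ℝ (fun y => (ψ y : ℂ)) y (EuclideanSpace.single h (1 : ℝ)) =
      ((pderiv h ψ y : ℝ) : ℂ) := fun y => by rw [(hψd y).fderiv]; rfl
  have e2 : ∀ y, fderiv ℝ (fun y => φ y α) y (EuclideanSpace.single h (1 : ℝ)) =
      grad φ y (h, α) := fun y => by rw [(hφd y).fderiv]; rfl
  have cφ : Continuous fun y => φ y α := P.continuous.comp hφ.1.continuous
  have cψ : Continuous fun y => (ψ y : ℂ) := Complex.continuous_ofReal.comp hψ.1.continuous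
  have cg : Continuous fun y => grad φ y (h, α) :=
    (EuclideanSpace.proj (𝕜 := ℂ) (h, α)).continuous.comp hφ.continuous_grad
  have cψ' : Continuous fun y => ((pderiv h ψ y : ℝ) : ℂ) :=
    Complex.continuous_ofReal.comp (hψ.continuous_pderiv h)
  have sψ : HasCompactSupport fun y => (ψ y : ℂ) := hψ.2.1.comp_left Complex.ofReal_zero
  have sψ' : HasCompactSupport fun y => ((pderiv h ψ y : ℝ) : ℂ) :=
    (hψ.hasCompactSupport_pderiv h).comp_left Complex.ofReal_zero
  have key := integral_mul_fderiv_eq_neg_fderiv_mul_of_integrable (μ := volume) (𝕜 := ℂ)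
    (f := fun y => φ y α) (g := fun y => (ψ y : ℂ)) (v := EuclideanSpace.single h (1 : ℝ))
    (by simp only [e2]; exact (cg.mul cψ).integrable_of_hasCompactSupport sψ.mul_left)
    (by simp only [e1]; exact (cφ.mul cψ').integrable_of_hasCompactSupport sψ'.mul_left)
    ((cφ.mul cψ).integrable_of_hasCompactSupport sψ.mul_left)
    (fun y _ => (hφd y).differentiableAt) (fun y _ => (hψd y).differentiableAt)
  simp only [e1, e2] at key
  simpa only [mul_comm] using key

lemma W0On.integral_pderiv_mul (hv : W0On Ω V v G) (hV : V ⊆ Ω) {Ω' : Set (Pt n)} {ψ : Pt n → ℝ}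
    (hψ : IsTest Ω' ψ) (h : Fin n) (α : Fin m) :
    ∫ y in Ω, ((pderiv h ψ y : ℝ) : ℂ) * v y α = - ∫ y in Ω, (ψ y : ℂ) * G y (h, α) := by
  obtain ⟨hv, hG, φ, hφ, h1, h2, -⟩ := hv
  have mψ : MemLp (fun y => (ψ y : ℂ)) 2 (volume.restrict Ω) := (hψ.memLp 2 Ω).ofReal
  have mψ' : MemLp (fun y => ((pderiv h ψ y : ℝ) : ℂ)) 2 (volume.restrict Ω) :=
    (((hψ.continuous_pderiv h).memLp_of_hasCompactSupport
      (hψ.hasCompactSupport_pderiv h)).restrict Ω).ofReal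
  have pv : ∀ {w : Pt n → Val m}, MemLp w 2 (volume.restrict Ω) →
      MemLp (fun y => w y α) 2 (volume.restrict Ω) := fun {w} hw =>
    hw.of_le ((EuclideanSpace.proj (𝕜 := ℂ) α).continuous.comp_aestronglyMeasurable hw.1)
      (Eventually.of_forall fun y => PiLp.norm_apply_le (w y) α)
  have pG : ∀ {w : Pt n → Tens n m}, MemLp w 2 (volume.restrict Ω) →
      MemLp (fun y => w y (h, α)) 2 (volume.restrict Ω) := fun {w} hw =>
    hw.of_le ((EuclideanSpace.proj (𝕜 := ℂ) (h, α)).continuous.comp_aestronglyMeasurable hw.1)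
      (Eventually.of_forall fun y => PiLp.norm_apply_le (w y) (h, α))
  have l1 := tendsto_integral_of_eLpNorm_two (μ := volume.restrict Ω)
    (f := fun k y => v y - φ k y) (g := fun y => ‖((pderiv h ψ y : ℝ) : ℂ)‖)
    (H := fun k y => ((pderiv h ψ y : ℝ) : ℂ) * φ k y α)
    (H₀ := fun y => ((pderiv h ψ y : ℝ) : ℂ) * v y α)
    (fun k => hv.1.sub ((hφ k).memLp 2 Ω).1) mψ'.norm
    (fun k => mψ'.integrable_mul (pv ((hφ k).memLp 2 Ω))) (mψ'.integrable_mul (pv hv))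
    (fun k => Eventually.of_forall fun y => by
      rw [← mul_sub, norm_mul, norm_sub_rev]
      exact mul_le_mul_of_nonneg_left (PiLp.norm_apply_le (v y - φ k y) α) (norm_nonneg _)) h1
  have l2 := tendsto_integral_of_eLpNorm_two (μ := volume.restrict Ω)
    (f := fun k y => G y - grad (φ k) y) (g := fun y => ‖(ψ y : ℂ)‖)
    (H := fun k y => (ψ y : ℂ) * grad (φ k) y (h, α))
    (H₀ := fun y => (ψ y : ℂ) * G y (h, α))
    (fun k => hG.1.sub ((hφ k).memLp_grad 2 Ω).1) mψ.norm
    (fun k => mψ.integrable_mul (pG ((hφ k).memLp_grad 2 Ω))) (mψ.integrable_mul (pG hG))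
    (fun k => Eventually.of_forall fun y => by
      rw [← mul_sub, norm_mul, norm_sub_rev]
      exact mul_le_mul_of_nonneg_left (PiLp.norm_apply_le (G y - grad (φ k) y) (h, α))
        (norm_nonneg _)) h2
  refine tendsto_nhds_unique l1 (l2.neg.congr fun k => ?_)
  exact (((hφ k).mono hV).integral_pderiv_mul hψ h α).symm

/-- The fundamental lemma of the calculus of variations on Ω ∩ O. It identifies the gradient
supplied by the zero trace condition with that of the solution, wherever the cut-off equals 1. -/
lemma MemW12Loc.gradient_ae_eq {u : Pt n → Val m} {H : Pt n → Tens n m} {O : Set (Pt n)}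
    (hu : MemW12Loc Ω u H) (hv : W0On Ω V v G) (hV : V ⊆ Ω) (hΩ : IsOpen Ω) (hO : IsOpen O)
    (huv : ∀ y ∈ O, v y = u y) : ∀ᵐ y ∂(volume.restrict Ω), y ∈ O → G y = H y := by
  have hW : IsOpen (Ω ∩ O) := hΩ.inter hO
  have key : ∀ i : Fin n × Fin m, ∀ᵐ y ∂volume, y ∈ Ω ∩ O → G y i - H y i = 0 := by
    rintro ⟨h, α⟩
    refine hW.ae_eq_zero_of_integral_contDiff_smul_eq_zero ?_ fun ψ h1 h2 h3 => ?_
    · rw [locallyIntegrableOn_iff hW.isLocallyClosed]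
      intro S hS hSc
      have : IsFiniteMeasure (volume.restrict S) := ⟨by simpa using hSc.measure_lt_top⟩
      have hSΩ : S ⊆ Ω := hS.trans Set.inter_subset_left
      have hG' : MemLp G 2 (volume.restrict S) :=
        hv.2.1.mono_measure (Measure.restrict_mono hSΩ le_rfl)
      have hd : MemLp (fun y => G y - H y) 2 (volume.restrict S) := hG'.sub (hu.1 S hSc hSΩ).2
      refine (hd.integrable (by norm_num)).mono
        ((EuclideanSpace.proj (𝕜 := ℂ) (h, α)).continuous.comp_aestronglyMeasurable hd.1)
        (Eventually.of_forall fun y => PiLp.norm_apply_le (G y - H y) (h, α))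
    · have hψ : IsTest (Ω ∩ O) ψ := ⟨h1, h2, h3⟩
      have e1 := hu.2 ψ (hψ.mono Set.inter_subset_left) h α
      have e2 := hv.integral_pderiv_mul hV hψ h α
      have e3 : ∫ y in Ω, ((pderiv h ψ y : ℝ) : ℂ) * v y α =
          ∫ y in Ω, ((pderiv h ψ y : ℝ) : ℂ) * u y α := by
        refine integral_congr_ae (Eventually.of_forall fun y => ?_)
        by_cases hy : y ∈ Ω ∩ O
        · simp [huv y hy.2]
        · simp [hψ.pderiv_eq_zero hy]
      have hint : ∀ {K : Pt n → Tens n m}, MemLp K 2 (volume.restrict (tsupport ψ)) →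
          Integrable (fun y => (ψ y : ℂ) * K y (h, α)) (volume.restrict Ω) := by
        intro K hK
        have hK' : MemLp (fun y => K y (h, α)) 2 (volume.restrict (tsupport ψ)) := hK.of_le
          ((EuclideanSpace.proj (𝕜 := ℂ) (h, α)).continuous.comp_aestronglyMeasurable hK.1)
          (Eventually.of_forall fun y => PiLp.norm_apply_le (K y) (h, α))
        have mψ : MemLp (fun y => (ψ y : ℂ)) 2 (volume.restrict (tsupport ψ)) :=
          (hψ.memLp 2 _).ofReal
        have h4 : IntegrableOn (fun y => (ψ y : ℂ) * K y (h, α)) (tsupport ψ) :=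
          mψ.integrable_mul hK'
        have h5 := (integrableOn_iff_integrable_of_support_subset (μ := volume) (fun y hy => by
          refine subset_tsupport ψ fun h0 => hy ?_
          simp [h0])).1 h4
        exact h5.integrableOn
      have hts : tsupport ψ ⊆ Ω := h3.trans Set.inter_subset_left
      have i1 := hint (hu.1 _ h2 hts).2
      have i2 := hint (hv.2.1.mono_measure (Measure.restrict_mono hts le_rfl))
      rw [← setIntegral_eq_integral_of_forall_compl_eq_zero (s := Ω) fun y hy => by
        rw [hψ.eq_zero fun h => hy h.1, zero_smul]]
      have : ∀ y, ψ y • (G y (h, α) - H y (h, α)) =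
          (ψ y : ℂ) * G y (h, α) - (ψ y : ℂ) * H y (h, α) := fun y => by
        rw [Complex.real_smul, mul_sub]
      simp only [this]
      rw [integral_sub i2 i1]
      linear_combination e2 - e1 - e3
  rw [ae_restrict_iff' hΩ.measurableSet]
  filter_upwards [ae_all_iff.2 key] with y hy hyΩ hyO
  ext i
  exact sub_eq_zero.1 (hy i ⟨hyΩ, hyO⟩)

/-! ### Radial maps -/

/-- The logarithm of the norm, cut off below at `-a`. -/
noncomputable def logNorm (a : ℝ) (z : Val m) : ℝ := Real.log (max ‖z‖ (Real.exp (-a)))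

lemma continuous_logNorm (a : ℝ) : Continuous (logNorm a : Val m → ℝ) := by
  unfold logNorm
  refine Continuous.log (by fun_prop) fun z => ?_
  exact (lt_max_of_lt_right (Real.exp_pos _)).ne'

lemma logNorm_of_le {a : ℝ} {z : Val m} (hz : ‖z‖ ≤ Real.exp (-a)) : logNorm a z = -a := by
  rw [logNorm, max_eq_right hz, Real.log_exp]

lemma logNorm_of_ge {a : ℝ} {z : Val m} (hz : Real.exp (-a) ≤ ‖z‖) :
    logNorm a z = Real.log ‖z‖ := by
  rw [logNorm, max_eq_left hz]

/-- Smooth functions on the line that are constant on `(-∞, -a]` and on `[a, ∞)`. -/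
structure IsProfile {E : Type*} [NormedAddCommGroup E] [NormedSpace ℝ E] (a : ℝ) (K : ℝ → E) :
    Prop where
  contDiff : ContDiff ℝ ∞ K
  left : ∀ τ ≤ -a, K τ = K (-a)
  right : ∀ τ, a ≤ τ → K τ = K a

section Profile
variable {E : Type*} [NormedAddCommGroup E] [NormedSpace ℝ E] {a : ℝ} {K : ℝ → E}

lemma IsProfile.hasDerivAt (hK : IsProfile a K) (τ : ℝ) : HasDerivAt K (deriv K τ) τ :=
  (hK.contDiff.differentiable (by simp) τ).hasDerivAt

lemma IsProfile.deriv_left (hK : IsProfile a K) {τ : ℝ} (hτ : τ ≤ -a) : deriv K τ = 0 := by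
  have h1 : HasDerivWithinAt K (deriv K τ) (Set.Iic τ) τ := (hK.hasDerivAt τ).hasDerivWithinAt
  have h2 : HasDerivWithinAt K 0 (Set.Iic τ) τ :=
    (hasDerivWithinAt_const τ (Set.Iic τ) (K (-a))).congr
      (fun s hs => hK.left s (le_trans hs hτ)) (hK.left τ hτ)
  exact (uniqueDiffWithinAt_Iic τ).eq_deriv _ h1 h2

lemma IsProfile.deriv_right (hK : IsProfile a K) {τ : ℝ} (hτ : a ≤ τ) : deriv K τ = 0 := by
  have h1 : HasDerivWithinAt K (deriv K τ) (Set.Ici τ) τ := (hK.hasDerivAt τ).hasDerivWithinAt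
  have h2 : HasDerivWithinAt K 0 (Set.Ici τ) τ :=
    (hasDerivWithinAt_const τ (Set.Ici τ) (K a)).congr
      (fun s hs => hK.right s (le_trans hτ hs)) (hK.right τ hτ)
  exact (uniqueDiffWithinAt_Ici τ).eq_deriv _ h1 h2

lemma IsProfile.exists_bound (hK : IsProfile a K) :
    ∃ C : ℝ, 0 ≤ C ∧ (∀ τ, ‖K τ‖ ≤ C) ∧ ∀ τ, ‖deriv K τ‖ ≤ C := by
  have cK : Continuous K := hK.contDiff.continuous
  have cK' : Continuous (deriv K) := hK.contDiff.continuous_deriv (by simp)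
  obtain ⟨C₁, h₁⟩ := (isCompact_Icc (a := -a) (b := a)).exists_bound_of_continuousOn cK.continuousOn
  obtain ⟨C₂, h₂⟩ := (isCompact_Icc (a := -a) (b := a)).exists_bound_of_continuousOn
    cK'.continuousOn
  have hmax : 0 ≤ max (max C₁ C₂) (max ‖K (-a)‖ ‖K a‖) :=
    le_max_of_le_right (le_max_of_le_left (norm_nonneg _))
  refine ⟨max (max C₁ C₂) (max ‖K (-a)‖ ‖K a‖), hmax, fun τ => ?_, fun τ => ?_⟩
  · rcases le_total τ (-a) with h | h
    · rw [hK.left τ h]; exact le_max_of_le_right (le_max_left _ _)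
    rcases le_total a τ with h' | h'
    · rw [hK.right τ h']; exact le_max_of_le_right (le_max_right _ _)
    · exact (h₁ τ ⟨h, h'⟩).trans (le_max_of_le_left (le_max_left _ _))
  · rcases le_total τ (-a) with h | h
    · rw [hK.deriv_left h, norm_zero]; exact hmax
    rcases le_total a τ with h' | h'
    · rw [hK.deriv_right h', norm_zero]; exact hmax
    · exact (h₂ τ ⟨h, h'⟩).trans (le_max_of_le_left (le_max_right _ _))

lemma IsProfile.mul {A : Type*} [NormedRing A] [NormedAlgebra ℝ A] {K K' : ℝ → A}
    (hK : IsProfile a K) (hK' : IsProfile a K') : IsProfile a (fun τ => K τ * K' τ) where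
  contDiff := hK.contDiff.mul hK'.contDiff
  left τ h := by simp only [hK.left τ h, hK'.left τ h]
  right τ h := by simp only [hK.right τ h, hK'.right τ h]

lemma IsProfile.ofReal {k : ℝ → ℝ} (hk : IsProfile a k) : IsProfile a (fun τ => (k τ : ℂ)) where
  contDiff := Complex.ofRealCLM.contDiff.comp hk.contDiff
  left τ h := by rw [hk.left τ h]
  right τ h := by rw [hk.right τ h]

end Profile

variable {a : ℝ} {K : ℝ → ℂ}

lemma hasFDerivAt_log_norm {z : Val m} (hz : z ≠ 0) :
    HasFDerivAt (fun z : Val m => Real.log ‖z‖) ((‖z‖ ^ 2)⁻¹ • innerSL ℝ z) z := by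
  have h1 : HasFDerivAt (fun z : Val m => ‖z‖ ^ 2) (2 • innerSL ℝ z) z :=
    (hasStrictFDerivAt_norm_sq z).hasFDerivAt
  have hz' : ‖z‖ ^ 2 ≠ 0 := pow_ne_zero _ (norm_ne_zero_iff.2 hz)
  have h2 := (h1.log hz').const_mul (1 / 2 : ℝ)
  have e1 : (fun z : Val m => 1 / 2 * Real.log (‖z‖ ^ 2)) = fun z : Val m => Real.log ‖z‖ := by
    ext1 z; rw [Real.log_pow]; push_cast; ring
  rw [e1] at h2
  convert! h2 using 1
  ext ζ
  simp
  ring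

lemma IsProfile.apply_logNorm (hK : IsProfile a K) {z : Val m} (hz : z ≠ 0) :
    K (logNorm a z) = K (Real.log ‖z‖) := by
  rcases le_total ‖z‖ (Real.exp (-a)) with h | h
  · rw [logNorm_of_le h, hK.left (Real.log ‖z‖)]
    rwa [Real.log_le_iff_le_exp (norm_pos_iff.2 hz)]
  · rw [logNorm_of_ge h]

lemma IsProfile.deriv_apply_logNorm (hK : IsProfile a K) {z : Val m} (hz : z ≠ 0) :
    deriv K (logNorm a z) = deriv K (Real.log ‖z‖) := by
  rcases le_total ‖z‖ (Real.exp (-a)) with h | h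
  · rw [logNorm_of_le h, hK.deriv_left le_rfl, hK.deriv_left]
    rwa [Real.log_le_iff_le_exp (norm_pos_iff.2 hz)]
  · rw [logNorm_of_ge h]

lemma radialMap_eventuallyEq_zero (a : ℝ) (K : ℝ → ℂ) :
    (fun z : Val m => K (logNorm a z) • z) =ᶠ[𝓝 0] fun z => K (-a) • z := by
  have : Metric.ball (0 : Val m) (Real.exp (-a)) ∈ 𝓝 0 := Metric.ball_mem_nhds _ (Real.exp_pos _)
  filter_upwards [this] with z hz
  rw [logNorm_of_le (by simpa using (mem_ball_zero_iff.1 hz).le)]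

lemma IsProfile.radialMap_eventuallyEq (hK : IsProfile a K) {z : Val m} (hz : z ≠ 0) :
    (fun z : Val m => K (logNorm a z) • z) =ᶠ[𝓝 z] fun z => K (Real.log ‖z‖) • z := by
  filter_upwards [isOpen_ne.mem_nhds hz] with y hy
  rw [hK.apply_logNorm hy]

/-- Near the origin K ∘ `logNorm` is constant and the map is linear. Elsewhere log‖z‖ is smooth, and
K does not see the cut-off in `logNorm`. -/
lemma IsProfile.contDiff_radialMap (hK : IsProfile a K) :
    ContDiff ℝ ∞ (fun z : Val m => K (logNorm a z) • z) := by
  rw [contDiff_iff_contDiffAt]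
  intro z
  rcases eq_or_ne z 0 with rfl | hz
  · exact ContDiffAt.congr_of_eventuallyEq (contDiff_id.const_smul _).contDiffAt
      (radialMap_eventuallyEq_zero a K)
  · refine ContDiffAt.congr_of_eventuallyEq ?_ (hK.radialMap_eventuallyEq hz)
    have h1 : ContDiffAt ℝ ∞ (fun z : Val m => Real.log ‖z‖) z :=
      (contDiffAt_norm ℝ hz).log (norm_ne_zero_iff.2 hz)
    exact (hK.contDiff.contDiffAt.comp z h1).smul contDiffAt_id

lemma IsProfile.fderiv_radialMap (hK : IsProfile a K) (z ζ : Val m) :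
    fderiv ℝ (fun z : Val m => K (logNorm a z) • z) z ζ =
      K (logNorm a z) • ζ + (deriv K (logNorm a z) * ((inner ℝ z ζ / ‖z‖ ^ 2 : ℝ) : ℂ)) • z := by
  rcases eq_or_ne z 0 with rfl | hz
  · rw [(radialMap_eventuallyEq_zero a K).fderiv_eq, logNorm_of_le (by simpa using Real.exp_nonneg _)]
    have : HasFDerivAt (fun z : Val m => K (-a) • z) (K (-a) • ContinuousLinearMap.id ℝ (Val m)) 0 :=
      (hasFDerivAt_id (𝕜 := ℝ) (0 : Val m)).const_smul (K (-a))
    rw [this.fderiv]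
    simp
  · rw [(hK.radialMap_eventuallyEq hz).fderiv_eq, hK.apply_logNorm hz, hK.deriv_apply_logNorm hz]
    have h1 := (hK.hasDerivAt (Real.log ‖z‖)).hasFDerivAt.comp z (hasFDerivAt_log_norm hz)
    have h2 := h1.smul (hasFDerivAt_id (𝕜 := ℝ) z)
    have h3 : fderiv ℝ (fun z : Val m => K (Real.log ‖z‖) • z) z = _ := h2.fderiv
    rw [h3]
    simp only [Function.comp_apply, id_eq, add_apply, smul_apply, ContinuousLinearMap.id_apply,
      ContinuousLinearMap.smulRight_apply]
    congr 2
    simp [div_eq_inv_mul]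
    ring

/-- K and K' are bounded, and the factor ‖z‖⁻² is compensated by one ‖z‖ from Cauchy–Schwarz and one
from the vector z. This is the hypothesis of the chain rule `W0On.chain`. -/
lemma IsProfile.exists_fderiv_radialMap_bound (hK : IsProfile a K) :
    ∃ C : ℝ, ∀ z : Val m, ‖fderiv ℝ (fun z : Val m => K (logNorm a z) • z) z‖ ≤ C := by
  obtain ⟨C, hC, h1, h2⟩ := hK.exists_bound
  refine ⟨2 * C, fun z => ContinuousLinearMap.opNorm_le_bound _ (by positivity) fun ζ => ?_⟩
  rw [hK.fderiv_radialMap]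
  refine (norm_add_le _ _).trans ?_
  rw [norm_smul, norm_smul, norm_mul, Complex.norm_real]
  have h3 : ‖inner ℝ z ζ / ‖z‖ ^ 2‖ * ‖z‖ ≤ ‖ζ‖ := by
    rcases eq_or_ne z 0 with rfl | hz
    · simp
    have hz' : 0 < ‖z‖ := norm_pos_iff.2 hz
    rw [norm_div, Real.norm_of_nonneg (sq_nonneg ‖z‖), div_mul_eq_mul_div,
      div_le_iff₀ (by positivity)]
    have := abs_real_inner_le_norm z ζ
    rw [Real.norm_eq_abs]
    nlinarith
  calc ‖K (logNorm a z)‖ * ‖ζ‖ + ‖deriv K (logNorm a z)‖ * ‖inner ℝ z ζ / ‖z‖ ^ 2‖ * ‖z‖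
      = ‖K (logNorm a z)‖ * ‖ζ‖ + ‖deriv K (logNorm a z)‖ * (‖inner ℝ z ζ / ‖z‖ ^ 2‖ * ‖z‖) := by
        ring
    _ ≤ C * ‖ζ‖ + C * ‖ζ‖ := by
        gcongr
        · exact h1 _
        · exact h2 _
    _ = 2 * C * ‖ζ‖ := by ring

lemma IsProfile.mapRows_radialMap (hK : IsProfile a K) (z : Val m) (ξ : Tens n m) :
    mapRows (fderiv ℝ (fun z : Val m => K (logNorm a z) • z) z) ξ =
      K (logNorm a z) • ξ + deriv K (logNorm a z) • radialPart z ξ := by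
  ext i
  simp only [mapRows, hK.fderiv_radialMap, radialPart_eq_tensor, PiLp.add_apply, PiLp.smul_apply,
    row_apply, tensor_apply, smul_eq_mul]
  ring

/-- Complex profiles are admitted because of the phases e^{it log|v|} used for the radial
positivity. -/
lemma W0On.radial (hv : W0On Ω V v G) (hK : IsProfile a K) {U : Set (Pt n)} {η : Pt n → ℝ}
    (hη : IsTest U η) :
    W0On Ω (V ∩ U) (fun y => ((η y : ℂ) * K (logNorm a (v y))) • v y)
      (fun y => ((η y : ℂ) * K (logNorm a (v y))) • G y +
        ((η y : ℂ) * deriv K (logNorm a (v y))) • radialPart (v y) (G y) +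
        K (logNorm a (v y)) • tensor (fun h => pderiv h η y) (v y)) := by
  obtain ⟨C, hC⟩ := hK.exists_fderiv_radialMap_bound (m := m)
  have h := hv.chain hK.contDiff_radialMap (by simp) hC hη
  convert! h using 1
  · ext y i
    simp
    ring
  · ext y i
    rw [hK.mapRows_radialMap]
    simp
    ring

lemma W0On.radial_real {k : ℝ → ℝ} (hv : W0On Ω V v G) (hk : IsProfile a k) {U : Set (Pt n)}
    {η : Pt n → ℝ} (hη : IsTest U η) :
    W0On Ω (V ∩ U) (fun y => (η y * k (logNorm a (v y))) • v y)
      (fun y => (η y * k (logNorm a (v y))) • G y +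
        (η y * deriv k (logNorm a (v y))) • radialPart (v y) (G y) +
        tensor (fun h => k (logNorm a (v y)) * pderiv h η y) (v y)) := by
  have h := hv.radial hk.ofReal hη
  have hd : ∀ τ, deriv (fun τ => (k τ : ℂ)) τ = ((deriv k τ : ℝ) : ℂ) := fun τ =>
    (hk.hasDerivAt τ).ofReal_comp.deriv
  convert! h using 1
  · ext y i
    simp
  · ext y i
    simp only [hd]
    simp [mul_assoc]

end PEllipticSystem

namespace PEllipticSystem
open Filter Topology

variable {n m : ℕ}

/-! ### Cut-off functions -/

lemma isProfile_smoothTransition : IsProfile 1 Real.smoothTransition where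
  contDiff := Real.smoothTransition.contDiff
  left τ h := by
    rw [Real.smoothTransition.zero_of_nonpos (by linarith),
      Real.smoothTransition.zero_of_nonpos (by norm_num)]
  right τ h := by
    rw [Real.smoothTransition.one_of_one_le h, Real.smoothTransition.one_of_one_le le_rfl]

/-- The transition function is composed with a quadratic polynomial in ‖y - x‖, which is smooth at
the centre. Stopping at the midpoint of s and t keeps the closed support inside the open ball. -/
lemma exists_cutoff (n : ℕ) : ∃ C : ℝ, 0 < C ∧ ∀ (x : Pt n) (s t : ℝ), 0 ≤ s → s < t →
    ∃ η : Pt n → ℝ, IsTest (Metric.ball x t) η ∧ (∀ y, 0 ≤ η y) ∧ (∀ y, η y ≤ 1) ∧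
      (∀ y ∈ Metric.ball x s, η y = 1) ∧ ∀ y z, |fderiv ℝ η y z| ≤ C / (t - s) * ‖z‖ := by
  obtain ⟨C, hC, -, hC'⟩ := isProfile_smoothTransition.exists_bound
  refine ⟨4 * (C + 1), by positivity, fun x s t hs hst => ?_⟩
  set τ := (s + t) / 2 with hτ
  have hsτ : s < τ := by rw [hτ]; linarith
  have hτt : τ < t := by rw [hτ]; linarith
  have hτ0 : 0 < τ := by linarith
  have hd : 0 < τ ^ 2 - s ^ 2 := by nlinarith
  have hq : ContDiff ℝ ∞ fun y : Pt n => (τ ^ 2 - ‖y - x‖ ^ 2) / (τ ^ 2 - s ^ 2) :=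
    (contDiff_const.sub ((contDiff_id.sub contDiff_const).norm_sq ℝ)).div_const _
  have hsupp : Function.support (fun y : Pt n =>
      Real.smoothTransition ((τ ^ 2 - ‖y - x‖ ^ 2) / (τ ^ 2 - s ^ 2))) ⊆ Metric.closedBall x τ := by
    intro y hy
    by_contra h
    rw [Metric.mem_closedBall, not_le, dist_eq_norm] at h
    refine hy (Real.smoothTransition.zero_of_nonpos (div_nonpos_of_nonpos_of_nonneg ?_ hd.le))
    nlinarith
  have hts := closure_minimal hsupp Metric.isClosed_closedBall
  refine ⟨fun y => Real.smoothTransition ((τ ^ 2 - ‖y - x‖ ^ 2) / (τ ^ 2 - s ^ 2)),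
    ⟨Real.smoothTransition.contDiff.comp hq,
      HasCompactSupport.intro' (isCompact_closedBall x τ) Metric.isClosed_closedBall
        fun y hy => Function.notMem_support.1 fun h => hy (hsupp h),
      hts.trans (Metric.closedBall_subset_ball hτt)⟩,
    fun y => Real.smoothTransition.nonneg _, fun y => Real.smoothTransition.le_one _,
    fun y hy => ?_, fun y z => ?_⟩
  · refine Real.smoothTransition.one_of_one_le ?_
    rw [Metric.mem_ball, dist_eq_norm] at hy
    rw [one_le_div hd]
    nlinarith [norm_nonneg (y - x)]
  · by_cases hy : y ∈ Metric.closedBall x τ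
    · have h1 : HasFDerivAt (fun y : Pt n => ‖y - x‖ ^ 2) (2 • (innerSL ℝ (y - x))) y := by
        have := (hasStrictFDerivAt_norm_sq (y - x)).hasFDerivAt.comp y
          ((hasFDerivAt_id (𝕜 := ℝ) y).sub_const x)
        simpa using! this
      have h2 := ((h1.const_sub (τ ^ 2)).mul_const (τ ^ 2 - s ^ 2)⁻¹)
      have h3 := (isProfile_smoothTransition.hasDerivAt
        ((τ ^ 2 - ‖y - x‖ ^ 2) * (τ ^ 2 - s ^ 2)⁻¹)).comp_hasFDerivAt y h2
      have h4 : fderiv ℝ (fun y => Real.smoothTransition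
        ((τ ^ 2 - ‖y - x‖ ^ 2) / (τ ^ 2 - s ^ 2))) y = _ := h3.fderiv
      rw [h4]
      simp only [smul_apply, neg_apply, innerSL_apply_apply, smul_eq_mul, nsmul_eq_mul, Nat.cast_ofNat]
      rw [Metric.mem_closedBall, dist_eq_norm] at hy
      have h5 := abs_real_inner_le_norm (y - x) z
      have h6 := hC' ((τ ^ 2 - ‖y - x‖ ^ 2) / (τ ^ 2 - s ^ 2))
      rw [Real.norm_eq_abs] at h6
      rw [abs_mul, abs_mul, abs_neg, abs_mul, abs_inv, abs_of_pos hd, abs_two]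
      -- Here τ² - s² = (τ - s)(τ + s) with τ - s = (t - s)/2, and 2τ ≤ 2(τ + s).
      have h7 : (τ ^ 2 - s ^ 2)⁻¹ * (2 * τ) ≤ 4 / (t - s) := by
        rw [← div_eq_inv_mul, div_le_div_iff₀ hd (by linarith)]
        have : τ - s = (t - s) / 2 := by rw [hτ]; ring
        nlinarith
      calc |deriv Real.smoothTransition ((τ ^ 2 - ‖y - x‖ ^ 2) / (τ ^ 2 - s ^ 2))| *
            ((τ ^ 2 - s ^ 2)⁻¹ * (2 * |inner ℝ (y - x) z|))
          ≤ (C + 1) * ((τ ^ 2 - s ^ 2)⁻¹ * (2 * (τ * ‖z‖))) := by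
            gcongr
            · linarith
            · exact h5.trans (by gcongr)
        _ = (C + 1) * ((τ ^ 2 - s ^ 2)⁻¹ * (2 * τ)) * ‖z‖ := by ring
        _ ≤ (C + 1) * (4 / (t - s)) * ‖z‖ := by gcongr
        _ = 4 * (C + 1) / (t - s) * ‖z‖ := by ring
    · have h0 : fderiv ℝ (fun y => Real.smoothTransition
        ((τ ^ 2 - ‖y - x‖ ^ 2) / (τ ^ 2 - s ^ 2))) y = 0 := by
        by_contra h
        exact hy (hts (support_fderiv_subset ℝ h))
      rw [h0]
      have : 0 < t - s := by linarith
      simp only [zero_apply, abs_zero]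
      positivity

/-! ### Height above a graph -/

/-- The height above the graph of `φ` in direction `e`. -/
noncomputable def height (e : Pt n) (φ : Pt n → ℝ) (y : Pt n) : ℝ :=
  inner ℝ e y - φ (y - inner ℝ e y • e)

lemma mem_aboveGraph {e : Pt n} {φ : Pt n → ℝ} {y : Pt n} :
    y ∈ aboveGraph e φ ↔ 0 < height e φ y := by
  simp [aboveGraph, height]

section height
variable {L : ℝ≥0} {e : Pt n} {φ : Pt n → ℝ}

lemma height_add_smul (he : ‖e‖ = 1) (y : Pt n) (s : ℝ) : height e φ (y + s • e) = height e φ y + s := by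
  have h1 : inner ℝ e e = (1 : ℝ) := by rw [real_inner_self_eq_norm_sq, he]; norm_num
  have h2 : y + s • e - (inner ℝ e y + s) • e = y - inner ℝ e y • e := by module
  simp only [height, inner_add_right, inner_smul_right, h1, mul_one, h2]
  ring

lemma height_sub_le (he : ‖e‖ = 1) (hφ : LipschitzWith L φ) (y y' : Pt n) :
    height e φ y - height e φ y' ≤ (1 + L) * dist y y' := by
  have h1 : inner ℝ e y - inner ℝ e y' ≤ dist y y' := by
    rw [← inner_sub_right, dist_eq_norm]
    simpa [he] using real_inner_le_norm e (y - y')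
  have h2 := hφ.dist_le_mul (y' - inner ℝ e y' • e) (y - inner ℝ e y • e)
  have h3 : dist (y' - inner ℝ e y' • e) (y - inner ℝ e y • e) ≤ dist y y' := by
    rw [dist_eq_norm, dist_comm, dist_eq_norm]
    have : y' - inner ℝ e y' • e - (y - inner ℝ e y • e) = (y' - y) - inner ℝ e (y' - y) • e := by
      rw [inner_sub_right]; module
    rw [this]
    refine le_of_sq_le_sq ?_ (norm_nonneg _)
    rw [norm_sub_sq_real, inner_smul_right, norm_smul, he, real_inner_comm, Real.norm_eq_abs,
      mul_one, sq_abs]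
    nlinarith [sq_nonneg (inner ℝ e (y' - y))]
  have h4 := le_abs_self (φ (y' - inner ℝ e y' • e) - φ (y - inner ℝ e y • e))
  rw [← Real.dist_eq] at h4
  simp only [height]
  have : (L : ℝ) * dist (y' - inner ℝ e y' • e) (y - inner ℝ e y • e) ≤ L * dist y y' := by
    gcongr
  linarith

lemma continuous_height (hφ : LipschitzWith L φ) : Continuous (height e φ) := by
  have := hφ.continuous
  unfold height
  fun_prop

/-- Hardy's inequality above a Lipschitz graph. -/
lemma hardy_aboveGraph (he : ‖e‖ = 1) (hφ : LipschitzWith L φ) {w : Pt n → Val m}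
    (hw : IsTest (aboveGraph e φ) w) :
    Integrable (fun y => (‖w y‖ / height e φ y) ^ 2) ∧
    ∫ y, (‖w y‖ / height e φ y) ^ 2 ≤ 4 * ∫ y, ‖fderiv ℝ w y e‖ ^ 2 := by
  have hopen : IsOpen (aboveGraph e φ) := by
    have : aboveGraph e φ = height e φ ⁻¹' Set.Ioi 0 := by ext y; exact mem_aboveGraph
    rw [this]
    exact isOpen_Ioi.preimage (continuous_height hφ)
  have hc : ContinuousOn (height e φ) (aboveGraph e φ) := (continuous_height hφ).continuousOn
  have hne : ∀ y ∈ aboveGraph e φ, height e φ y ≠ 0 := fun y hy => (mem_aboveGraph.1 hy).ne'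
  have cw : Continuous w := hw.1.continuous
  have cw' : Continuous fun y => fderiv ℝ w y e :=
    (hw.1.continuous_fderiv (by simp)).clm_apply continuous_const
  have sw : HasCompactSupport fun y => ‖w y‖ ^ 2 := hw.2.1.comp_left (g := fun z => ‖z‖ ^ 2) (by simp)
  have sw1 : HasCompactSupport fun y => 2 * inner ℝ (w y) (fderiv ℝ w y e) := by
    refine hw.2.1.mono' fun y hy => subset_tsupport _ fun h0 => hy ?_
    simp [h0]
  have ts : tsupport (fun y => ‖w y‖ ^ 2) ⊆ aboveGraph e φ :=
    (closure_mono fun y (hy : _ ≠ _) (h0 : w y = 0) => hy (by simp [h0])).trans hw.2.2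
  have ts1 : tsupport (fun y => 2 * inner ℝ (w y) (fderiv ℝ w y e)) ⊆ aboveGraph e φ :=
    (closure_mono fun y (hy : _ ≠ _) (h0 : w y = 0) => hy (by simp [h0])).trans hw.2.2
  have integ : ∀ {f g : Pt n → ℝ}, Continuous f → HasCompactSupport f →
      tsupport f ⊆ aboveGraph e φ → ContinuousOn g (aboveGraph e φ) →
      Integrable fun y => f y * g y := by
    intro f g hf hfs hft hg
    refine Continuous.integrable_of_hasCompactSupport ?_ hfs.mul_right
    refine (hf.continuousOn.mul hg).continuous_of_tsupport_subset hopen ?_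
    exact (tsupport_mul_subset_left).trans hft
  have cg : ContinuousOn (fun y => (height e φ y)⁻¹) (aboveGraph e φ) := hc.inv₀ hne
  have cg' : ContinuousOn (fun y => -((height e φ y)⁻¹) ^ 2) (aboveGraph e φ) := (cg.pow 2).neg
  have i1 := integ (f := fun y => ‖w y‖ ^ 2) (by fun_prop) sw ts cg'
  have i2 := integ (f := fun y => 2 * inner ℝ (w y) (fderiv ℝ w y e)) (by fun_prop) sw1 ts1 cg
  have i3 := integ (f := fun y => ‖w y‖ ^ 2) (by fun_prop) sw ts cg
  -- Along e the height h has slope one, so the derivative of h⁻¹ is -h⁻² although φ is merely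
  -- Lipschitz. Integrating ‖w‖²h⁻² by parts and using 2ab ≤ a²/2 + 2b² absorbs half of the left
  -- side, whence the constant 4.
  have key := integral_bilinear_hasLineDerivAt_right_eq_neg_left_of_integrable
    (μ := (volume : Measure (Pt n)))
    (f := fun y => ‖w y‖ ^ 2) (f' := fun y => 2 * inner ℝ (w y) (fderiv ℝ w y e))
    (g := fun y => (height e φ y)⁻¹) (g' := fun y => -((height e φ y)⁻¹) ^ 2)
    (v := e) (B := ContinuousLinearMap.mul ℝ ℝ) i2 i1 i3
    (fun y _ => by
      have h1 := ((hw.differentiable y).hasFDerivAt.norm_sq).hasLineDerivAt e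
      simpa [real_inner_comm] using! h1)
    (fun y hy => by
      have hy' := hne y (ts hy)
      have h1 : HasDerivAt (fun s : ℝ => height e φ y + s) 1 0 := by
        simpa using (hasDerivAt_id (0 : ℝ)).const_add (height e φ y)
      have h2 := h1.fun_inv (by simpa using hy')
      unfold HasLineDerivAt
      simp only [height_add_smul he]
      convert! h2 using 1
      simp [neg_div])
  simp only [ContinuousLinearMap.mul_apply'] at key
  have e1 : ∀ y, (‖w y‖ / height e φ y) ^ 2 = -(‖w y‖ ^ 2 * -((height e φ y)⁻¹) ^ 2) := by
    intro y; rw [div_eq_mul_inv]; ring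
  have I1 : Integrable (fun y => (‖w y‖ / height e φ y) ^ 2) := by
    simp only [e1]; exact i1.neg
  refine ⟨I1, ?_⟩
  have I2 : Integrable (fun y => ‖fderiv ℝ w y e‖ ^ 2) :=
    Continuous.integrable_of_hasCompactSupport (by fun_prop)
      ((hw.2.1.fderiv_apply ℝ e).comp_left (g := fun z => ‖z‖ ^ 2) (by simp))
  have e2 : ∫ y, (‖w y‖ / height e φ y) ^ 2 =
      ∫ y, 2 * inner ℝ (w y) (fderiv ℝ w y e) * (height e φ y)⁻¹ := by
    simp only [e1, integral_neg]
    rw [key, neg_neg]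
  have e3 : ∫ y, 2 * inner ℝ (w y) (fderiv ℝ w y e) * (height e φ y)⁻¹ ≤
      ∫ y, (1 / 2 * (‖w y‖ / height e φ y) ^ 2 + 2 * ‖fderiv ℝ w y e‖ ^ 2) := by
    refine integral_mono i2 ((I1.const_mul _).add (I2.const_mul _)) fun y => ?_
    have h1 := abs_real_inner_le_norm (w y) (fderiv ℝ w y e)
    calc 2 * inner ℝ (w y) (fderiv ℝ w y e) * (height e φ y)⁻¹
        ≤ |2 * inner ℝ (w y) (fderiv ℝ w y e) * (height e φ y)⁻¹| := le_abs_self _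
      _ = 2 * |inner ℝ (w y) (fderiv ℝ w y e)| * |height e φ y|⁻¹ := by
          rw [abs_mul, abs_mul, abs_two, abs_inv]
      _ ≤ 2 * (‖w y‖ * ‖fderiv ℝ w y e‖) * |height e φ y|⁻¹ := by gcongr
      _ = 2 * (‖w y‖ / |height e φ y|) * ‖fderiv ℝ w y e‖ := by ring
      _ ≤ 1 / 2 * (‖w y‖ / |height e φ y|) ^ 2 + 2 * ‖fderiv ℝ w y e‖ ^ 2 := by
          nlinarith [sq_nonneg (‖w y‖ / |height e φ y| - 2 * ‖fderiv ℝ w y e‖)]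
      _ = _ := by rw [div_pow, div_pow, sq_abs]
  rw [integral_add (I1.const_mul _) (I2.const_mul _), integral_const_mul, integral_const_mul] at e3
  linarith

end height

/-- Friedrichs' inequality for test functions. -/
lemma friedrichs_test {Ω : Set (Pt n)} {w : Pt n → Val m} (hw : IsTest Ω w) {e y₀ : Pt n}
    {d : ℝ} (hd : ∀ y ∈ Ω, |inner ℝ e (y - y₀)| ≤ d) (he : ‖e‖ = 1) :
    ∫ y, ‖w y‖ ^ 2 ≤ 4 * d ^ 2 * ∫ y, ‖fderiv ℝ w y e‖ ^ 2 := by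
  have cw : Continuous w := hw.1.continuous
  have cw' : Continuous fun y => fderiv ℝ w y e :=
    (hw.1.continuous_fderiv (by simp)).clm_apply continuous_const
  have sw : HasCompactSupport fun y => ‖w y‖ ^ 2 := hw.2.1.comp_left (g := fun z => ‖z‖ ^ 2) (by simp)
  have sw1 : HasCompactSupport fun y => 2 * inner ℝ (w y) (fderiv ℝ w y e) := by
    refine hw.2.1.mono' fun y hy => subset_tsupport _ fun h0 => hy ?_
    simp [h0]
  have i2 : Integrable fun y => 2 * inner ℝ (w y) (fderiv ℝ w y e) * inner ℝ e (y - y₀) :=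
    Continuous.integrable_of_hasCompactSupport (by fun_prop) sw1.mul_right
  have i3 : Integrable fun y => ‖w y‖ ^ 2 * inner ℝ e (y - y₀) :=
    Continuous.integrable_of_hasCompactSupport (by fun_prop) sw.mul_right
  have i1 : Integrable fun y => ‖w y‖ ^ 2 * (1 : ℝ) :=
    Continuous.integrable_of_hasCompactSupport (by fun_prop) sw.mul_right
  -- The same argument as for Hardy's inequality, with the linear function ⟨e, y - y₀⟩ of slope one
  -- in place of the inverse height.
  have key := integral_bilinear_hasLineDerivAt_right_eq_neg_left_of_integrable
    (μ := (volume : Measure (Pt n)))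
    (f := fun y => ‖w y‖ ^ 2) (f' := fun y => 2 * inner ℝ (w y) (fderiv ℝ w y e))
    (g := fun y => inner ℝ e (y - y₀)) (g' := fun _ => (1 : ℝ))
    (v := e) (B := ContinuousLinearMap.mul ℝ ℝ) i2 i1 i3
    (fun y _ => by
      have h1 := ((hw.differentiable y).hasFDerivAt.norm_sq).hasLineDerivAt e
      simpa [real_inner_comm] using! h1)
    (fun y _ => by
      have h1 : HasDerivAt (fun s : ℝ => inner ℝ e (y - y₀) + s) 1 0 := by
        simpa using (hasDerivAt_id (0 : ℝ)).const_add (inner ℝ e (y - y₀))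
      unfold HasLineDerivAt
      convert! h1 using 1
      ext s
      beta_reduce
      have : y + s • e - y₀ = (y - y₀) + s • e := by abel
      rw [this, inner_add_right, inner_smul_right, real_inner_self_eq_norm_sq, he]
      ring)
  simp only [ContinuousLinearMap.mul_apply', mul_one] at key i1
  have I2 : Integrable (fun y => ‖fderiv ℝ w y e‖ ^ 2) :=
    Continuous.integrable_of_hasCompactSupport (by fun_prop)
      ((hw.2.1.fderiv_apply ℝ e).comp_left (g := fun z => ‖z‖ ^ 2) (by simp))
  have e3 : -∫ y, 2 * inner ℝ (w y) (fderiv ℝ w y e) * inner ℝ e (y - y₀) ≤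
      ∫ y, (1 / 2 * ‖w y‖ ^ 2 + 2 * d ^ 2 * ‖fderiv ℝ w y e‖ ^ 2) := by
    rw [← integral_neg]
    refine integral_mono i2.neg ((i1.const_mul _).add (I2.const_mul _)) fun y => ?_
    by_cases hy : y ∈ Ω
    · have h1 := abs_real_inner_le_norm (w y) (fderiv ℝ w y e)
      have h2 := hd y hy
      calc -(2 * inner ℝ (w y) (fderiv ℝ w y e) * inner ℝ e (y - y₀))
          ≤ |2 * inner ℝ (w y) (fderiv ℝ w y e) * inner ℝ e (y - y₀)| := neg_le_abs _
        _ = 2 * |inner ℝ (w y) (fderiv ℝ w y e)| * |inner ℝ e (y - y₀)| := by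
            rw [abs_mul, abs_mul, abs_two]
        _ ≤ 2 * (‖w y‖ * ‖fderiv ℝ w y e‖) * d := by gcongr
        _ ≤ 1 / 2 * ‖w y‖ ^ 2 + 2 * d ^ 2 * ‖fderiv ℝ w y e‖ ^ 2 := by
            nlinarith [sq_nonneg (‖w y‖ - 2 * d * ‖fderiv ℝ w y e‖)]
    · simp only [hw.eq_zero hy, inner_zero_left, mul_zero, zero_mul, neg_zero, norm_zero]
      positivity
  rw [integral_add (i1.const_mul _) (I2.const_mul _), integral_const_mul, integral_const_mul] at e3
  linarith

end PEllipticSystem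

namespace PEllipticSystem
open Filter Topology

variable {n m : ℕ}

/-! ### Hardy's inequality in Lipschitz domains -/

/-- Tonelli's theorem. Averaging a local inequality over all centres replaces a covering argument
and keeps the constants explicit. -/
lemma lintegral_lintegral_ball {Φ : Pt n → ℝ≥0∞} (hΦ : Measurable Φ) (R : ℝ) :
    ∫⁻ a, ∫⁻ y in Metric.ball a R, Φ y = volume (Metric.ball (0 : Pt n) R) * ∫⁻ y, Φ y := by
  have h1 : ∀ a, ∫⁻ y in Metric.ball a R, Φ y =
      ∫⁻ y, {q : Pt n × Pt n | dist q.2 q.1 < R}.indicator (fun q => Φ q.2) (a, y) := by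
    intro a
    rw [← lintegral_indicator Metric.isOpen_ball.measurableSet]
    rfl
  have hm : MeasurableSet {q : Pt n × Pt n | dist q.2 q.1 < R} :=
    (isOpen_lt (by fun_prop) (by fun_prop)).measurableSet
  simp only [h1]
  have hmeas : Measurable ({q : Pt n × Pt n | dist q.2 q.1 < R}.indicator fun q => Φ q.2) :=
    (hΦ.comp measurable_snd).indicator hm
  rw [lintegral_lintegral_swap (f := fun a y =>
      {q : Pt n × Pt n | dist q.2 q.1 < R}.indicator (fun q => Φ q.2) (a, y)) hmeas.aemeasurable,
    ← lintegral_const_mul _ hΦ]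
  refine lintegral_congr fun y => ?_
  have h2 : ∀ a, {q : Pt n × Pt n | dist q.2 q.1 < R}.indicator (fun q => Φ q.2) (a, y) =
      (Metric.ball y R).indicator (fun _ => Φ y) a := by
    intro a
    by_cases h : dist y a < R
    · have h1 : (a, y) ∈ {q : Pt n × Pt n | dist q.2 q.1 < R} := h
      have h2 : a ∈ Metric.ball y R := by rwa [Metric.mem_ball, dist_comm]
      rw [Set.indicator_of_mem h1, Set.indicator_of_mem h2]
    · have h1 : (a, y) ∉ {q : Pt n × Pt n | dist q.2 q.1 < R} := h
      have h2 : a ∉ Metric.ball y R := by rwa [Metric.mem_ball, dist_comm]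
      rw [Set.indicator_of_notMem h1, Set.indicator_of_notMem h2]
  simp only [h2]
  rw [lintegral_indicator Metric.isOpen_ball.measurableSet, lintegral_const,
    Measure.restrict_apply_univ, Measure.addHaar_ball_center, mul_comm]

/-- The nearest boundary point is no farther from y than z, hence still in the coordinate ball. Its
height is nonpositive, and the height is Lipschitz with constant 1 + L. -/
lemma height_le_infDist {L : ℝ≥0} {Ω : Set (Pt n)} {e z : Pt n} {φ : Pt n → ℝ} {ρ : ℝ}
    (hΩ : IsOpen Ω) (he : ‖e‖ = 1) (hφ : LipschitzWith L φ)
    (hgr : Ω ∩ Metric.ball z ρ = aboveGraph e φ ∩ Metric.ball z ρ) (hz : z ∈ frontier Ω)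
    {y : Pt n} (hy : dist y z < ρ / 2) :
    height e φ y ≤ (1 + L) * Metric.infDist y (frontier Ω) := by
  obtain ⟨z', hz', hd⟩ := isClosed_frontier.exists_infDist_eq_dist ⟨z, hz⟩ y
  have h1 : dist y z' ≤ dist y z := hd ▸ Metric.infDist_le_dist_of_mem hz
  have h2 : z' ∈ Metric.ball z ρ := by
    rw [Metric.mem_ball]
    calc dist z' z ≤ dist z' y + dist y z := dist_triangle _ _ _
      _ < ρ := by rw [dist_comm z' y]; linarith
  have h3 : z' ∉ Ω := fun h => by
    rw [frontier, hΩ.interior_eq] at hz'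
    exact hz'.2 h
  have h4 : height e φ z' ≤ 0 := by
    by_contra h
    push Not at h
    have : z' ∈ aboveGraph e φ ∩ Metric.ball z ρ := ⟨mem_aboveGraph.2 h, h2⟩
    rw [← hgr] at this
    exact h3 this.1
  have h5 := height_sub_le he hφ y z'
  rw [hd]
  linarith

/-- The version of `height_le_infDist` for a full graph domain. -/
lemma height_le_infDist_aboveGraph {L : ℝ≥0} {e : Pt n} {φ : Pt n → ℝ}
    (he : ‖e‖ = 1) (hφ : LipschitzWith L φ) (y : Pt n) :
    height e φ y ≤ (1 + L) * Metric.infDist y (frontier (aboveGraph e φ)) := by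
  have heq : aboveGraph e φ = height e φ ⁻¹' Set.Ioi 0 := by ext y; exact mem_aboveGraph
  have hΩ : IsOpen (aboveGraph e φ) := heq ▸ isOpen_Ioi.preimage (continuous_height hφ)
  have hne : (frontier (aboveGraph e φ)).Nonempty := by
    by_contra h
    rw [Set.not_nonempty_iff_eq_empty, frontier_eq_empty_iff] at h
    have h1 : y + (1 - height e φ y) • e ∈ aboveGraph e φ := by
      rw [mem_aboveGraph, height_add_smul he]; linarith
    have h2 : y + (-1 - height e φ y) • e ∉ aboveGraph e φ := by
      rw [mem_aboveGraph, height_add_smul he]; linarith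
    rcases h with h | h
    · rw [h] at h1; exact h1
    · rw [h] at h2; exact h2 (Set.mem_univ _)
  obtain ⟨z, hz⟩ := hne
  exact height_le_infDist (ρ := 2 * (dist y z + 1)) hΩ he hφ rfl hz (by linarith)

lemma lintegral_hardy_aboveGraph {L : ℝ≥0} {e : Pt n} {φ : Pt n → ℝ} (he : ‖e‖ = 1)
    (hφ : LipschitzWith L φ) {w : Pt n → Val m} (hw : IsTest (aboveGraph e φ) w) :
    ∫⁻ y, ENNReal.ofReal ((‖w y‖ / height e φ y) ^ 2) ≤
      ENNReal.ofReal 4 * ∫⁻ y, ENNReal.ofReal (‖fderiv ℝ w y e‖ ^ 2) := by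
  obtain ⟨h1, h2⟩ := hardy_aboveGraph he hφ hw
  have cw' : Continuous fun y => fderiv ℝ w y e :=
    (hw.1.continuous_fderiv (by simp)).clm_apply continuous_const
  have I2 : Integrable (fun y => ‖fderiv ℝ w y e‖ ^ 2) :=
    Continuous.integrable_of_hasCompactSupport (by fun_prop)
      ((hw.2.1.fderiv_apply ℝ e).comp_left (g := fun z => ‖z‖ ^ 2) (by simp))
  rw [← ofReal_integral_eq_lintegral_ofReal h1 (Eventually.of_forall fun _ => sq_nonneg _),
    ← ofReal_integral_eq_lintegral_ofReal I2 (Eventually.of_forall fun _ => sq_nonneg _),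
    ← ENNReal.ofReal_mul (by norm_num)]
  exact ENNReal.ofReal_le_ofReal h2

lemma lintegral_friedrichs_test {Ω : Set (Pt n)} {w : Pt n → Val m} (hw : IsTest Ω w)
    {e y₀ : Pt n} {d : ℝ} (hd : ∀ y ∈ Ω, |inner ℝ e (y - y₀)| ≤ d) (he : ‖e‖ = 1) :
    ∫⁻ y, ENNReal.ofReal (‖w y‖ ^ 2) ≤
      ENNReal.ofReal (4 * d ^ 2) * ∫⁻ y, ENNReal.ofReal (‖fderiv ℝ w y e‖ ^ 2) := by
  have cw : Continuous w := hw.1.continuous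
  have cw' : Continuous fun y => fderiv ℝ w y e :=
    (hw.1.continuous_fderiv (by simp)).clm_apply continuous_const
  have I1 : Integrable (fun y => ‖w y‖ ^ 2) :=
    Continuous.integrable_of_hasCompactSupport (by fun_prop)
      (hw.2.1.comp_left (g := fun z => ‖z‖ ^ 2) (by simp))
  have I2 : Integrable (fun y => ‖fderiv ℝ w y e‖ ^ 2) :=
    Continuous.integrable_of_hasCompactSupport (by fun_prop)
      ((hw.2.1.fderiv_apply ℝ e).comp_left (g := fun z => ‖z‖ ^ 2) (by simp))
  rw [← ofReal_integral_eq_lintegral_ofReal I1 (Eventually.of_forall fun _ => sq_nonneg _),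
    ← ofReal_integral_eq_lintegral_ofReal I2 (Eventually.of_forall fun _ => sq_nonneg _),
    ← ENNReal.ofReal_mul (by positivity)]
  exact ENNReal.ofReal_le_ofReal (friedrichs_test hw hd he)

lemma div_infDist_sq_le {L : ℝ≥0} {h δ a : ℝ} (hh : 0 < h) (hle : h ≤ (1 + L) * δ) :
    (a / δ) ^ 2 ≤ (1 + L) ^ 2 * (a / h) ^ 2 := by
  have hδ : 0 < δ := by
    by_contra hc
    push Not at hc
    have : (1 + (L : ℝ)) * δ ≤ 0 := mul_nonpos_of_nonneg_of_nonpos (by positivity) hc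
    linarith
  rw [div_pow, div_pow, ← mul_div_assoc, div_le_div_iff₀ (by positivity) (by positivity)]
  have : h ^ 2 ≤ (1 + L) ^ 2 * δ ^ 2 := by rw [← mul_pow]; gcongr
  nlinarith [sq_nonneg a]

lemma sq_norm_fderiv_le (w : Pt n → Val m) (y e : Pt n) (he : ‖e‖ = 1) :
    ‖fderiv ℝ w y e‖ ^ 2 ≤ n ^ 2 * ‖grad w y‖ ^ 2 := by
  have := norm_fderiv_apply_le w y e
  rw [he, mul_one] at this
  rw [← mul_pow]
  gcongr

/-- Local form of Hardy's inequality in a bounded Lipschitz domain. -/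
lemma hardy_local {L : ℝ≥0} {Ω : Set (Pt n)} {ρ Cη : ℝ} (hΩ : IsOpen Ω) (hρ : 0 < ρ)
    (hgr : ∀ z ∈ frontier Ω, ∃ (e : Pt n) (φ : Pt n → ℝ), ‖e‖ = 1 ∧ LipschitzWith L φ ∧
        Ω ∩ Metric.ball z ρ = aboveGraph e φ ∩ Metric.ball z ρ)
    (hCη : ∀ (x : Pt n) (s t : ℝ), 0 ≤ s → s < t →
      ∃ η : Pt n → ℝ, IsTest (Metric.ball x t) η ∧ (∀ y, 0 ≤ η y) ∧ (∀ y, η y ≤ 1) ∧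
      (∀ y ∈ Metric.ball x s, η y = 1) ∧ ∀ y z, |fderiv ℝ η y z| ≤ Cη / (t - s) * ‖z‖)
    {v : Pt n → Val m} (hv : IsTest Ω v) (a : Pt n) :
    ∫⁻ y in Metric.ball a (ρ / 16), ENNReal.ofReal ((‖v y‖ / Metric.infDist y (frontier Ω)) ^ 2) ≤
      ∫⁻ y in Metric.ball a (ρ / 8), ENNReal.ofReal
        ((8 * (1 + L) ^ 2 * n ^ 2) * ‖grad v y‖ ^ 2 +
          ((8 * (1 + L) ^ 2 * (16 * Cη) ^ 2 + 64) / ρ ^ 2) * ‖v y‖ ^ 2) := by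
  have hsub : Metric.ball a (ρ / 16) ⊆ Metric.ball a (ρ / 8) := Metric.ball_subset_ball (by linarith)
  rcases (frontier Ω).eq_empty_or_nonempty with hemp | hne
  -- With an empty boundary `infDist` is 0 and the quotient is 0 by convention.
  · simp [hemp]
  -- Near the boundary, the cut-off function times v is supported in one coordinate ball, and
  -- Hardy's inequality above that graph applies; the derivative of the cut-off produces the term
  -- with ‖v‖²/ρ².
  by_cases hcase : ∃ z ∈ frontier Ω, dist a z < ρ / 4
  · obtain ⟨z, hz, haz⟩ := hcase
    obtain ⟨e, φ, he, hφ, hgr⟩ := hgr z hz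
    obtain ⟨η, hη, hη0, hη1, hη2, hη3⟩ := hCη a (ρ / 16) (ρ / 8) (by positivity) (by linarith)
    have hw : IsTest (aboveGraph e φ) (fun y => η y • v y) := by
      refine ⟨hη.1.smul hv.1, hη.2.1.smul_right, fun y hy => ?_⟩
      have h1 : y ∈ Ω := hv.2.2 (closure_mono (fun y (hy : _ ≠ _) (h0 : v y = 0) =>
        hy (by simp [h0])) hy)
      have h2 : y ∈ Metric.ball a (ρ / 8) := hη.2.2 (closure_mono
        (fun y (hy : _ ≠ _) (h0 : η y = 0) => hy (by simp [h0])) hy)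
      have h3 : y ∈ Metric.ball z ρ := by
        rw [Metric.mem_ball] at h2 ⊢
        linarith [dist_triangle y a z]
      have : y ∈ Ω ∩ Metric.ball z ρ := ⟨h1, h3⟩
      rw [hgr] at this
      exact this.1
    have hardy := lintegral_hardy_aboveGraph he hφ hw
    calc ∫⁻ y in Metric.ball a (ρ / 16),
          ENNReal.ofReal ((‖v y‖ / Metric.infDist y (frontier Ω)) ^ 2)
        ≤ ∫⁻ y in Metric.ball a (ρ / 16),
          ENNReal.ofReal ((1 + L) ^ 2) * ENNReal.ofReal ((‖η y • v y‖ / height e φ y) ^ 2) := by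
          refine setLIntegral_mono_ae' Metric.isOpen_ball.measurableSet
            (Eventually.of_forall fun y hy => ?_)
          rw [← ENNReal.ofReal_mul (by positivity)]
          refine ENNReal.ofReal_le_ofReal ?_
          rw [hη2 y hy, one_smul]
          by_cases hyΩ : y ∈ Ω
          · rw [Metric.mem_ball] at hy
            have hyz : dist y z < ρ / 2 := by linarith [dist_triangle y a z]
            have hyg : y ∈ aboveGraph e φ ∩ Metric.ball z ρ := by
              rw [← hgr]
              exact ⟨hyΩ, by rw [Metric.mem_ball]; linarith⟩
            exact div_infDist_sq_le (mem_aboveGraph.1 hyg.1) (height_le_infDist hΩ he hφ hgr hz hyz)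
          · simp [hv.eq_zero hyΩ]
      _ ≤ ENNReal.ofReal ((1 + L) ^ 2) *
            ∫⁻ y, ENNReal.ofReal ((‖η y • v y‖ / height e φ y) ^ 2) := by
          rw [lintegral_const_mul' _ _ ENNReal.ofReal_ne_top]
          exact mul_le_mul_right (setLIntegral_le_lintegral _ _) _
      _ ≤ ENNReal.ofReal ((1 + L) ^ 2) * (ENNReal.ofReal 4 *
            ∫⁻ y, ENNReal.ofReal (‖fderiv ℝ (fun y => η y • v y) y e‖ ^ 2)) := by
          gcongr
      _ = ∫⁻ y, ENNReal.ofReal (4 * (1 + L) ^ 2 * ‖fderiv ℝ (fun y => η y • v y) y e‖ ^ 2) := by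
          rw [← mul_assoc, ← ENNReal.ofReal_mul (by positivity),
            ← lintegral_const_mul' _ _ ENNReal.ofReal_ne_top]
          refine lintegral_congr fun y => ?_
          rw [← ENNReal.ofReal_mul (by positivity)]
          ring_nf
      _ = ∫⁻ y in Metric.ball a (ρ / 8),
            ENNReal.ofReal (4 * (1 + L) ^ 2 * ‖fderiv ℝ (fun y => η y • v y) y e‖ ^ 2) := by
          refine (setLIntegral_eq_of_support_subset fun y hy => ?_).symm
          by_contra h
          refine hy ?_
          have h0 : fderiv ℝ (fun y => η y • v y) y = 0 := by
            by_contra h'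
            have h2 : y ∈ tsupport η := closure_mono
              (fun y (hy : _ ≠ _) (h0 : η y = 0) => hy (by simp [h0]))
              (support_fderiv_subset ℝ h')
            exact h (hη.2.2 h2)
          simp [h0]
      _ ≤ _ := by
          refine lintegral_mono fun y => ENNReal.ofReal_le_ofReal ?_
          have hd : fderiv ℝ (fun y => η y • v y) y e = η y • fderiv ℝ v y e + fderiv ℝ η y e • v y := by
            rw [fderiv_fun_smul (hη.differentiable y) (hv.differentiable y)]
            simp
          have h1 : ‖fderiv ℝ (fun y => η y • v y) y e‖ ≤ n * ‖grad v y‖ + 16 * Cη / ρ * ‖v y‖ := by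
            rw [hd]
            refine (norm_add_le _ _).trans ?_
            rw [norm_smul, norm_smul, Real.norm_of_nonneg (hη0 y)]
            have h2 := norm_fderiv_apply_le v y e
            have h3 := hη3 y e
            rw [he, mul_one] at h2 h3
            have h4 : Cη / (ρ / 8 - ρ / 16) = 16 * Cη / ρ := by field_simp; ring
            rw [h4] at h3
            have h5 := hη1 y
            have h6 : η y * ‖fderiv ℝ v y e‖ ≤ 1 * (n * ‖grad v y‖) := by gcongr
            have h7 : ‖fderiv ℝ η y e‖ * ‖v y‖ ≤ 16 * Cη / ρ * ‖v y‖ := by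
              rw [Real.norm_eq_abs]; gcongr
            linarith
          have h2 : ‖fderiv ℝ (fun y => η y • v y) y e‖ ^ 2 ≤
              2 * n ^ 2 * ‖grad v y‖ ^ 2 + 2 * (16 * Cη) ^ 2 / ρ ^ 2 * ‖v y‖ ^ 2 := by
            calc _ ≤ (n * ‖grad v y‖ + 16 * Cη / ρ * ‖v y‖) ^ 2 := by gcongr
              _ ≤ 2 * (n * ‖grad v y‖) ^ 2 + 2 * (16 * Cη / ρ * ‖v y‖) ^ 2 := by
                nlinarith [sq_nonneg (n * ‖grad v y‖ - 16 * Cη / ρ * ‖v y‖)]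
              _ = _ := by ring
          calc _ ≤ 4 * (1 + L) ^ 2 *
                (2 * n ^ 2 * ‖grad v y‖ ^ 2 + 2 * (16 * Cη) ^ 2 / ρ ^ 2 * ‖v y‖ ^ 2) := by gcongr
            _ = (8 * (1 + L) ^ 2 * n ^ 2) * ‖grad v y‖ ^ 2 +
                ((8 * (1 + L) ^ 2 * (16 * Cη) ^ 2 + 0) / ρ ^ 2) * ‖v y‖ ^ 2 := by ring
            _ ≤ _ := by gcongr; norm_num
  -- Away from the boundary δ ≥ ρ/8, so ‖v‖²/δ² is bounded by 64‖v‖²/ρ².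
  · push Not at hcase
    refine le_trans (setLIntegral_mono_ae' Metric.isOpen_ball.measurableSet
      (Eventually.of_forall fun y hy => ?_)) (lintegral_mono_set hsub)
    refine ENNReal.ofReal_le_ofReal ?_
    have h1 : ρ / 8 ≤ Metric.infDist y (frontier Ω) := by
      rw [Metric.le_infDist hne]
      intro z hz
      have := hcase z hz
      rw [Metric.mem_ball] at hy
      rw [dist_comm] at hy
      linarith [dist_triangle a y z]
    have h2 : (‖v y‖ / Metric.infDist y (frontier Ω)) ^ 2 ≤ (‖v y‖ / (ρ / 8)) ^ 2 := by
      have : 0 ≤ ‖v y‖ / Metric.infDist y (frontier Ω) :=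
        div_nonneg (norm_nonneg _) Metric.infDist_nonneg
      gcongr
    have h3 : (‖v y‖ / (ρ / 8)) ^ 2 = (0 + 64) / ρ ^ 2 * ‖v y‖ ^ 2 := by field_simp; ring
    have h4 : (0 + 64) / ρ ^ 2 * ‖v y‖ ^ 2 ≤
        ((8 * (1 + L) ^ 2 * (16 * Cη) ^ 2 + 64) / ρ ^ 2) * ‖v y‖ ^ 2 := by
      gcongr
      positivity
    have h5 : 0 ≤ (8 * (1 + (L : ℝ)) ^ 2 * n ^ 2) * ‖grad v y‖ ^ 2 := by positivity
    linarith

lemma IsLipschitzDomain.isOpen {L : ℝ≥0} {D : ℝ} {Ω : Set (Pt n)} (h : IsLipschitzDomain L D Ω) :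
    IsOpen Ω := by
  rcases h with ⟨e, φ, he, hφ, rfl⟩ | h
  · have heq : aboveGraph e φ = height e φ ⁻¹' Set.Ioi 0 := by ext y; exact mem_aboveGraph
    rw [heq]
    exact isOpen_Ioi.preimage (continuous_height hφ)
  · exact h.1

/-- Hardy's inequality for test functions in a Lipschitz domain. -/
lemma hardy_test (hn : 2 ≤ n) (m : ℕ) (L : ℝ≥0) (D : ℝ) : ∃ C : ℝ, 0 < C ∧ ∀ Ω : Set (Pt n),
    IsLipschitzDomain L D Ω → ∀ v : Pt n → Val m, IsTest Ω v →
    ∫⁻ y, ENNReal.ofReal ((‖v y‖ / Metric.infDist y (frontier Ω)) ^ 2) ≤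
      ENNReal.ofReal C * ∫⁻ y, ENNReal.ofReal (‖grad v y‖ ^ 2) := by
  obtain ⟨Cη, hCη0, hCη⟩ := exists_cutoff n
  set C₁ : ℝ := 8 * (1 + L) ^ 2 * n ^ 2 with hC₁
  set C₂ : ℝ := 8 * (1 + L) ^ 2 * (16 * Cη) ^ 2 + 64 with hC₂
  have hC₂0 : 0 ≤ C₂ := by rw [hC₂]; positivity
  refine ⟨4 * (1 + L) ^ 2 * n ^ 2 + 2 ^ n * (C₁ + C₂ * (4 * D ^ 2) * n ^ 2) + 1, by positivity,
    fun Ω hΩL v hv => ?_⟩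
  have hΩ := hΩL.isOpen
  rcases hΩL with ⟨e, φ, he, hφ, rfl⟩ | ⟨-, hconn, hbdd, ρ, hρ, hdiam, hgr⟩
  · calc ∫⁻ y, ENNReal.ofReal ((‖v y‖ / Metric.infDist y (frontier (aboveGraph e φ))) ^ 2)
        ≤ ∫⁻ y, ENNReal.ofReal ((1 + L) ^ 2) * ENNReal.ofReal ((‖v y‖ / height e φ y) ^ 2) := by
          refine lintegral_mono fun y => ?_
          rw [← ENNReal.ofReal_mul (by positivity)]
          refine ENNReal.ofReal_le_ofReal ?_
          by_cases hy : y ∈ aboveGraph e φ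
          · exact div_infDist_sq_le (mem_aboveGraph.1 hy) (height_le_infDist_aboveGraph he hφ y)
          · simp [hv.eq_zero hy]
      _ ≤ ENNReal.ofReal ((1 + L) ^ 2) * (ENNReal.ofReal 4 *
            ∫⁻ y, ENNReal.ofReal (‖fderiv ℝ v y e‖ ^ 2)) := by
          rw [lintegral_const_mul' _ _ ENNReal.ofReal_ne_top]
          gcongr
          exact lintegral_hardy_aboveGraph he hφ hv
      _ ≤ ENNReal.ofReal ((1 + L) ^ 2) * (ENNReal.ofReal 4 *
            ∫⁻ y, ENNReal.ofReal (n ^ 2) * ENNReal.ofReal (‖grad v y‖ ^ 2)) := by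
          gcongr with y
          rw [← ENNReal.ofReal_mul (by positivity)]
          exact ENNReal.ofReal_le_ofReal (sq_norm_fderiv_le v y e he)
      _ = ENNReal.ofReal (4 * (1 + L) ^ 2 * n ^ 2) * ∫⁻ y, ENNReal.ofReal (‖grad v y‖ ^ 2) := by
          rw [lintegral_const_mul' _ _ ENNReal.ofReal_ne_top, ← mul_assoc, ← mul_assoc,
            ← ENNReal.ofReal_mul (by positivity), ← ENNReal.ofReal_mul (by positivity)]
          ring_nf
      _ ≤ _ := by
          gcongr
          have : 0 ≤ 2 ^ n * (C₁ + C₂ * (4 * D ^ 2) * n ^ 2) := by positivity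
          linarith
  · have cv : Continuous v := hv.1.continuous
    have cg : Continuous (grad v) := hv.continuous_grad
    have mΦ : Measurable fun y =>
        ENNReal.ofReal ((‖v y‖ / Metric.infDist y (frontier Ω)) ^ 2) := by
      have := (Metric.continuous_infDist_pt (frontier Ω)).measurable
      have := cv.measurable
      fun_prop
    have mΨ : Measurable fun y => ENNReal.ofReal (C₁ * ‖grad v y‖ ^ 2 + C₂ / ρ ^ 2 * ‖v y‖ ^ 2) := by
      fun_prop
    -- Integration over all centres multiplies the two sides by the volumes of balls of radii ρ/16
    -- and ρ/8, whose ratio is 2^n.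
    have h1 := lintegral_mono (μ := volume) fun a => hardy_local hΩ hρ hgr hCη hv a
    rw [lintegral_lintegral_ball mΦ, lintegral_lintegral_ball mΨ] at h1
    have hvol : volume (Metric.ball (0 : Pt n) (ρ / 8)) =
        ENNReal.ofReal (2 ^ n) * volume (Metric.ball (0 : Pt n) (ρ / 16)) := by
      have h2 : ρ / 8 = 2 * (ρ / 16) := by ring
      rw [h2, Measure.addHaar_ball_mul_of_pos _ _ (by norm_num)]
      simp
    rw [hvol, mul_comm (ENNReal.ofReal _), mul_assoc] at h1
    have hpos : volume (Metric.ball (0 : Pt n) (ρ / 16)) ≠ 0 :=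
      (Metric.measure_ball_pos _ _ (by positivity)).ne'
    have h2 := (ENNReal.mul_le_mul_iff_right hpos measure_ball_lt_top.ne).1 h1
    -- Friedrichs
    have hn0 : 0 < n := by omega
    let e : Pt n := EuclideanSpace.single ⟨0, hn0⟩ (1 : ℝ)
    have he : ‖e‖ = 1 := by simp [e]
    obtain ⟨y₀, hy₀⟩ := hconn.nonempty
    have hd : ∀ y ∈ Ω, |inner ℝ e (y - y₀)| ≤ D * ρ := fun y hy => by
      refine (abs_real_inner_le_norm _ _).trans ?_
      rw [he, one_mul, ← dist_eq_norm]
      exact (Metric.dist_le_diam_of_mem hbdd hy hy₀).trans hdiam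
    have h3 := lintegral_friedrichs_test hv hd he
    have h4 : ∫⁻ y, ENNReal.ofReal (‖fderiv ℝ v y e‖ ^ 2) ≤
        ENNReal.ofReal (n ^ 2) * ∫⁻ y, ENNReal.ofReal (‖grad v y‖ ^ 2) := by
      rw [← lintegral_const_mul' _ _ ENNReal.ofReal_ne_top]
      refine lintegral_mono fun y => ?_
      rw [← ENNReal.ofReal_mul (by positivity)]
      exact ENNReal.ofReal_le_ofReal (sq_norm_fderiv_le v y e he)
    set I := ∫⁻ y, ENNReal.ofReal (‖grad v y‖ ^ 2)
    have hC₁0 : 0 ≤ C₁ := by rw [hC₁]; positivity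
    calc ∫⁻ y, ENNReal.ofReal ((‖v y‖ / Metric.infDist y (frontier Ω)) ^ 2)
        ≤ ENNReal.ofReal (2 ^ n) *
          ∫⁻ y, ENNReal.ofReal (C₁ * ‖grad v y‖ ^ 2 + C₂ / ρ ^ 2 * ‖v y‖ ^ 2) := h2
      _ = ENNReal.ofReal (2 ^ n) * (ENNReal.ofReal C₁ * I +
          ENNReal.ofReal (C₂ / ρ ^ 2) * ∫⁻ y, ENNReal.ofReal (‖v y‖ ^ 2)) := by
          congr 1
          rw [← lintegral_const_mul' _ _ ENNReal.ofReal_ne_top,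
            ← lintegral_const_mul' _ _ ENNReal.ofReal_ne_top, ← lintegral_add_left (by fun_prop)]
          refine lintegral_congr fun y => ?_
          rw [← ENNReal.ofReal_mul (by positivity), ← ENNReal.ofReal_mul (by positivity),
            ← ENNReal.ofReal_add (by positivity) (by positivity)]
      _ ≤ ENNReal.ofReal (2 ^ n) * (ENNReal.ofReal C₁ * I +
          ENNReal.ofReal (C₂ / ρ ^ 2) * (ENNReal.ofReal (4 * (D * ρ) ^ 2) *
            (ENNReal.ofReal (n ^ 2) * I))) := by
          gcongr
          exact h3.trans (by gcongr)
      -- The ρ² from Friedrichs' inequality cancels ρ⁻², so the size of Ω enters only through D.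
      _ = ENNReal.ofReal (2 ^ n * (C₁ + C₂ * (4 * D ^ 2) * n ^ 2)) * I := by
          rw [← mul_assoc (ENNReal.ofReal (4 * (D * ρ) ^ 2)),
            ← ENNReal.ofReal_mul (by positivity), ← mul_assoc (ENNReal.ofReal (C₂ / ρ ^ 2)),
            ← ENNReal.ofReal_mul (by positivity), ← add_mul,
            ← ENNReal.ofReal_add (by positivity) (by positivity), ← mul_assoc,
            ← ENNReal.ofReal_mul (by positivity)]
          congr 3
          field_simp
      _ ≤ _ := by
          gcongr
          have : 0 ≤ 4 * (1 + (L : ℝ)) ^ 2 * n ^ 2 := by positivity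
          linarith

lemma lintegral_ofReal_norm_sq {α E : Type*} [MeasurableSpace α] {μ : Measure α}
    [NormedAddCommGroup E] (f : α → E) :
    ∫⁻ y, ENNReal.ofReal (‖f y‖ ^ 2) ∂μ = eLpNorm f 2 μ ^ 2 := by
  rw [eLpNorm_eq_lintegral_rpow_enorm_toReal (by simp) (by simp), ← ENNReal.rpow_natCast,
    ← ENNReal.rpow_mul]
  simp [ENNReal.ofReal_pow]

lemma integral_norm_sq_eq {α E : Type*} [MeasurableSpace α] {μ : Measure α}
    [NormedAddCommGroup E] {f : α → E} (hf : AEStronglyMeasurable f μ) :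
    ∫ y, ‖f y‖ ^ 2 ∂μ = (eLpNorm f 2 μ).toReal ^ 2 := by
  rw [integral_eq_lintegral_of_nonneg_ae (Eventually.of_forall fun _ => sq_nonneg _)
    (hf.norm.pow 2), lintegral_ofReal_norm_sq, ENNReal.toReal_pow]

/-- Hardy's inequality passes from test functions to their limits. -/
lemma W0On.eLpNorm_hardy {C : ℝ} {Ω V : Set (Pt n)} {v : Pt n → Val m} {G : Pt n → Tens n m}
    (hv : W0On Ω V v G) (hV : V ⊆ Ω)
    (hC : 0 ≤ C) (hardy : ∀ v : Pt n → Val m, IsTest Ω v →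
    ∫⁻ y, ENNReal.ofReal ((‖v y‖ / Metric.infDist y (frontier Ω)) ^ 2) ≤
      ENNReal.ofReal C * ∫⁻ y, ENNReal.ofReal (‖grad v y‖ ^ 2)) :
    AEStronglyMeasurable (fun y => ‖v y‖ / Metric.infDist y (frontier Ω)) (volume.restrict Ω) ∧
    eLpNorm (fun y => ‖v y‖ / Metric.infDist y (frontier Ω)) 2 (volume.restrict Ω) ≤
      ENNReal.ofReal (Real.sqrt C) * eLpNorm G 2 (volume.restrict Ω) := by
  obtain ⟨hv2, hG, φ, hφ, h1, h2, h3⟩ := hv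
  have mδ : Measurable fun y : Pt n => Metric.infDist y (frontier Ω) :=
    (Metric.continuous_infDist_pt (frontier Ω)).measurable
  have hm : ∀ {w : Pt n → Val m}, AEStronglyMeasurable w (volume.restrict Ω) →
      AEStronglyMeasurable (fun y => ‖w y‖ / Metric.infDist y (frontier Ω)) (volume.restrict Ω) :=
    fun hw => (hw.norm.aemeasurable.div mδ.aemeasurable).aestronglyMeasurable
  have sup : ∀ {f : Pt n → ℝ≥0∞}, (∀ y, y ∉ Ω → f y = 0) → ∫⁻ y in Ω, f y = ∫⁻ y, f y :=
    fun hf => setLIntegral_eq_of_support_subset fun y hy => by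
      by_contra h
      exact hy (hf y h)
  have hk : ∀ k, eLpNorm (fun y => ‖φ k y‖ / Metric.infDist y (frontier Ω)) 2 (volume.restrict Ω) ≤
      ENNReal.ofReal (Real.sqrt C) * eLpNorm (grad (φ k)) 2 (volume.restrict Ω) := by
    intro k
    have h4 := hardy (φ k) ((hφ k).mono hV)
    rw [← sup (fun y hy => by simp [((hφ k).mono hV).eq_zero hy]),
      ← sup (fun y hy => by simp [((hφ k).mono hV).grad_eq_zero hy]),
      lintegral_ofReal_norm_sq (grad (φ k))] at h4
    have h5 := lintegral_ofReal_norm_sq (μ := volume.restrict Ω)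
      (fun y => ‖φ k y‖ / Metric.infDist y (frontier Ω))
    simp only [Real.norm_eq_abs, sq_abs] at h5
    rw [h5, ← Real.sq_sqrt hC, ENNReal.ofReal_pow (Real.sqrt_nonneg _), ← mul_pow] at h4
    exact (ENNReal.pow_le_pow_left_iff two_ne_zero).1 h4
  refine ⟨hm hv2.1, ?_⟩
  -- Lower semicontinuity of the norm requires only almost everywhere convergence, so no prior
  -- control of v/δ is necessary.
  refine (Lp.eLpNorm_lim_le_liminf_eLpNorm (fun k => hm ((hφ k).memLp 2 Ω).1) _ (by
    filter_upwards [h3] with y hy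
    exact hy.norm.div_const _)).trans ?_
  have t : Tendsto (fun k => ENNReal.ofReal (Real.sqrt C) * (eLpNorm G 2 (volume.restrict Ω) +
      eLpNorm (fun y => G y - grad (φ k) y) 2 (volume.restrict Ω))) atTop
      (𝓝 (ENNReal.ofReal (Real.sqrt C) * (eLpNorm G 2 (volume.restrict Ω) + 0))) :=
    ENNReal.Tendsto.const_mul (tendsto_const_nhds.add h2) (Or.inr ENNReal.ofReal_ne_top)
  rw [add_zero] at t
  rw [← t.liminf_eq]
  refine liminf_le_liminf (Eventually.of_forall fun k => (hk k).trans ?_)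
  gcongr
  have e : grad (φ k) = G - fun y => G y - grad (φ k) y := by ext1 y; simp
  conv_lhs => rw [e]
  exact eLpNorm_sub_le hG.1 (hG.1.sub ((hφ k).memLp_grad 2 Ω).1) (by norm_num)

lemma W0On.hardy {C : ℝ} {Ω V : Set (Pt n)} {v : Pt n → Val m} {G : Pt n → Tens n m}
    (hv : W0On Ω V v G) (hV : V ⊆ Ω)
    (hC : 0 ≤ C) (hardy : ∀ v : Pt n → Val m, IsTest Ω v →
    ∫⁻ y, ENNReal.ofReal ((‖v y‖ / Metric.infDist y (frontier Ω)) ^ 2) ≤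
      ENNReal.ofReal C * ∫⁻ y, ENNReal.ofReal (‖grad v y‖ ^ 2)) :
    MemLp (fun y => ‖v y‖ / Metric.infDist y (frontier Ω)) 2 (volume.restrict Ω) ∧
    ∫ y in Ω, (‖v y‖ / Metric.infDist y (frontier Ω)) ^ 2 ≤ C * ∫ y in Ω, ‖G y‖ ^ 2 := by
  obtain ⟨hm, hlim⟩ := hv.eLpNorm_hardy hV hC hardy
  have hG := hv.2.1
  have hfin : ENNReal.ofReal (Real.sqrt C) * eLpNorm G 2 (volume.restrict Ω) < ⊤ :=
    ENNReal.mul_lt_top ENNReal.ofReal_lt_top hG.2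
  refine ⟨⟨hm, hlim.trans_lt hfin⟩, ?_⟩
  have e1 := integral_norm_sq_eq hm
  simp only [Real.norm_eq_abs, sq_abs] at e1
  rw [e1, integral_norm_sq_eq hG.1]
  have e2 := ENNReal.toReal_mono hfin.ne hlim
  rw [ENNReal.toReal_mul, ENNReal.toReal_ofReal (Real.sqrt_nonneg _)] at e2
  calc _ ≤ (Real.sqrt C * (eLpNorm G 2 (volume.restrict Ω)).toReal) ^ 2 := by gcongr
    _ = _ := by rw [mul_pow, Real.sq_sqrt hC]

end PEllipticSystem

namespace PEllipticSystem
open Filter Topology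

/-! ### Slowly varying truncations of powers -/

/-- The descent from 1 to 0 is spread over a length 1/ε, which makes the slope of order ε whatever
the length M of the plateau. -/
lemma exists_plateau : ∃ C : ℝ, 0 < C ∧ ∀ ε M : ℝ, 0 < ε → 0 < M → ∃ a : ℝ, M ≤ a ∧ ∃ b : ℝ → ℝ,
    IsProfile a b ∧ (∀ τ, 0 ≤ b τ) ∧ (∀ τ, b τ ≤ 1) ∧ (∀ τ, |τ| ≤ M → b τ = 1) ∧
    (∀ τ, a ≤ |τ| → b τ = 0) ∧ ∀ τ, |deriv b τ| ≤ C * ε := by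
  obtain ⟨C, hC, hC1, hC'⟩ := isProfile_smoothTransition.exists_bound
  refine ⟨2 * (C + 1), by positivity, fun ε M hε hM => ⟨M + 1 / ε, by
    have : 0 < 1 / ε := by positivity
    linarith, fun τ =>
    Real.smoothTransition (ε * M + 1 - ε * τ) * Real.smoothTransition (ε * M + 1 + ε * τ), ?_⟩⟩
  have ha : ε * (M + 1 / ε) = ε * M + 1 := by field_simp
  have hzero : ∀ τ, M + 1 / ε ≤ |τ| → Real.smoothTransition (ε * M + 1 - ε * τ) *
      Real.smoothTransition (ε * M + 1 + ε * τ) = 0 := by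
    intro τ hτ
    have h1 := mul_le_mul_of_nonneg_left hτ hε.le
    rw [ha] at h1
    rcases abs_cases τ with ⟨h, -⟩ | ⟨h, -⟩ <;> rw [h] at h1
    · rw [Real.smoothTransition.zero_of_nonpos (by linarith), zero_mul]
    · rw [Real.smoothTransition.zero_of_nonpos (x := ε * M + 1 + ε * τ) (by linarith), mul_zero]
  have hpos : 0 < M + 1 / ε := by positivity
  refine ⟨⟨?_, fun τ hτ => ?_, fun τ hτ => ?_⟩, fun τ => ?_, fun τ => ?_, fun τ hτ => ?_, hzero,
    fun τ => ?_⟩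
  · exact (Real.smoothTransition.contDiff.comp (by fun_prop)).mul
      (Real.smoothTransition.contDiff.comp (by fun_prop))
  · rw [hzero τ (by rw [abs_of_nonpos (by linarith)]; linarith),
      hzero _ (by rw [abs_neg, abs_of_pos hpos])]
  · rw [hzero τ (by rw [abs_of_nonneg (by linarith)]; linarith),
      hzero _ (by rw [abs_of_pos hpos])]
  · exact mul_nonneg (Real.smoothTransition.nonneg _) (Real.smoothTransition.nonneg _)
  · exact mul_le_one₀ (Real.smoothTransition.le_one _) (Real.smoothTransition.nonneg _)
      (Real.smoothTransition.le_one _)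
  · have h1 := abs_le.1 hτ
    change Real.smoothTransition (ε * M + 1 - ε * τ) *
      Real.smoothTransition (ε * M + 1 + ε * τ) = 1
    have h2 : 1 ≤ ε * M + 1 - ε * τ := by nlinarith
    have h3 : 1 ≤ ε * M + 1 + ε * τ := by nlinarith
    rw [Real.smoothTransition.one_of_one_le h2, Real.smoothTransition.one_of_one_le h3, one_mul]
  · have h1 : HasDerivAt (fun τ => ε * M + 1 - ε * τ) (-ε) τ := by
      simpa using ((hasDerivAt_id τ).const_mul ε).const_sub (ε * M + 1)
    have h2 : HasDerivAt (fun τ => ε * M + 1 + ε * τ) ε τ := by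
      simpa using ((hasDerivAt_id τ).const_mul ε).const_add (ε * M + 1)
    have h3 := (isProfile_smoothTransition.hasDerivAt _).comp τ h1
    have h4 := (isProfile_smoothTransition.hasDerivAt _).comp τ h2
    have h5 := (h3.mul h4).deriv
    have h6 : deriv (fun τ => Real.smoothTransition (ε * M + 1 - ε * τ) *
      Real.smoothTransition (ε * M + 1 + ε * τ)) τ = _ := h5
    rw [h6]
    simp only [Function.comp_apply]
    set A := deriv Real.smoothTransition (ε * M + 1 - ε * τ)
    set B := deriv Real.smoothTransition (ε * M + 1 + ε * τ)
    have hA : |A| ≤ C := hC' _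
    have hB : |B| ≤ C := hC' _
    have n1 := Real.smoothTransition.nonneg (ε * M + 1 + ε * τ)
    have n2 := Real.smoothTransition.nonneg (ε * M + 1 - ε * τ)
    have l1 := Real.smoothTransition.le_one (ε * M + 1 + ε * τ)
    have l2 := Real.smoothTransition.le_one (ε * M + 1 - ε * τ)
    refine (abs_add_le _ _).trans ?_
    rw [abs_mul, abs_mul, abs_mul, abs_mul, abs_neg, abs_of_pos hε, abs_of_nonneg n1,
      abs_of_nonneg n2]
    calc _ ≤ C * ε * 1 + 1 * (C * ε) := by gcongr
      _ ≤ _ := by nlinarith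

/-- The data of a truncated power `f ∼ e^{β τ / 2}` with slowly varying exponent. -/
structure SlowPower (mup S ε β M : ℝ) (a : ℝ) (f c1 c0 σ : ℝ → ℝ) : Prop where
  prof_f : IsProfile a f
  prof_c1 : IsProfile a c1
  prof_c0 : IsProfile a c0
  prof_σ : IsProfile a σ
  f_pos : ∀ τ, 0 < f τ
  deriv_f : ∀ τ, deriv f τ = σ τ * f τ
  c1_nonneg : ∀ τ, 0 ≤ c1 τ
  partition : ∀ τ, c1 τ ^ 2 + c0 τ ^ 2 = 1
  deriv_c1 : ∀ τ, |deriv c1 τ| ≤ ε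
  deriv_c0 : ∀ τ, |deriv c0 τ| ≤ ε
  σ_eq : ∀ τ, σ τ = mup * c1 τ ^ 2 * (1 + σ τ)
  σ_le : ∀ τ, |σ τ| ≤ S
  c1_far : ∀ τ, a ≤ |τ| → c1 τ = 0
  le_a : M ≤ a
  f_sq_eq : ∀ τ, |τ| ≤ M → f τ ^ 2 = Real.exp (β * τ)
  f_sq_le : ∀ τ, f τ ^ 2 ≤ Real.exp (β * τ) + Real.exp (-(|β| * M))

lemma div_one_sub_le {x y : ℝ} (hxy : x ≤ y) (hy : y < 1) : x / (1 - x) ≤ y / (1 - y) := by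
  rw [div_le_div_iff₀ (by linarith) (by linarith)]
  nlinarith

/-- A primitive of a slowly varying exponent. -/
lemma exists_primitive {σ : ℝ → ℝ} {a M s : ℝ} (hσ : IsProfile a σ) (ha : M ≤ a) (hM : 0 < M)
    (hfar : ∀ τ, a ≤ |τ| → σ τ = 0) (hnear : ∀ τ, |τ| ≤ M → σ τ = s)
    (hs : (0 ≤ s ∧ ∀ τ, 0 ≤ σ τ ∧ σ τ ≤ s) ∨ (s ≤ 0 ∧ ∀ τ, s ≤ σ τ ∧ σ τ ≤ 0)) :
    ∃ g : ℝ → ℝ, IsProfile a g ∧ (∀ τ, HasDerivAt g (σ τ) τ) ∧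
      (∀ τ, |τ| ≤ M → g τ = s * τ) ∧ ∀ τ, g τ ≤ s * τ ∨ g τ ≤ -(|s| * M) := by
  have cσ : Continuous σ := hσ.contDiff.continuous
  set g : ℝ → ℝ := fun τ => ∫ x in (0 : ℝ)..τ, σ x with hg
  have hd : ∀ τ, HasDerivAt g (σ τ) τ := fun τ => cσ.integral_hasStrictDerivAt 0 τ |>.hasDerivAt
  have hdiff : Differentiable ℝ g := fun τ => (hd τ).differentiableAt
  have hderiv : deriv g = σ := funext fun τ => (hd τ).deriv
  have hnear' : ∀ τ, |τ| ≤ M → g τ = s * τ := by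
    intro τ hτ
    have : g τ = ∫ _x in (0 : ℝ)..τ, s := by
      refine intervalIntegral.integral_congr fun x hx => hnear x ?_
      rw [Set.mem_uIcc] at hx
      have := abs_le.1 hτ
      rw [abs_le]
      rcases hx with hx | hx <;> constructor <;> linarith
    rw [this, intervalIntegral.integral_const]
    simp [mul_comm]
  have ha0 : 0 < a := hM.trans_le ha
  have hM1 := hnear' M (by rw [abs_of_pos hM])
  have hM2 := hnear' (-M) (by rw [abs_neg, abs_of_pos hM])
  have h0 := hnear' 0 (by rw [abs_zero]; exact hM.le)
  refine ⟨g, ⟨?_, fun τ hτ => ?_, fun τ hτ => ?_⟩, hd, hnear', fun τ => ?_⟩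
  · rw [contDiff_infty_iff_deriv, hderiv]
    exact ⟨hdiff, hσ.contDiff⟩
  · have h1 : ∫ x in τ..(-a), σ x = 0 := by
      rw [intervalIntegral.integral_congr (g := fun _ => 0)]
      · simp
      · intro x hx
        rw [Set.uIcc_of_le hτ] at hx
        exact hfar x (by rw [abs_of_nonpos (by linarith [hx.2])]; linarith [hx.2])
    have h2 := intervalIntegral.integral_add_adjacent_intervals (μ := volume)
      (cσ.intervalIntegrable 0 τ) (cσ.intervalIntegrable τ (-a))
    simp only [hg]
    linarith
  · have h1 : ∫ x in a..τ, σ x = 0 := by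
      rw [intervalIntegral.integral_congr (g := fun _ => 0)]
      · simp
      · intro x hx
        rw [Set.uIcc_of_le hτ] at hx
        exact hfar x (by rw [abs_of_nonneg (by linarith [hx.1])]; exact hx.1)
    have h2 := intervalIntegral.integral_add_adjacent_intervals (μ := volume)
      (cσ.intervalIntegrable 0 a) (cσ.intervalIntegrable a τ)
    simp only [hg]
    linarith
  · have hh : ∀ τ, HasDerivAt (fun τ => g τ - s * τ) (σ τ - s) τ := fun τ => by
      simpa using! (hd τ).sub ((hasDerivAt_id τ).const_mul s)
    have hhd : Differentiable ℝ fun τ => g τ - s * τ := fun τ => (hh τ).differentiableAt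
    -- As σ lies between 0 and s, the functions g and g - sτ are monotone in opposite senses. On the
    -- half-line where sτ ≥ 0 this gives g ≤ sτ; beyond distance M on the other half-line g is at
    -- most its value -|s|M at distance M.
    rcases hs with ⟨hs0, hs⟩ | ⟨hs0, hs⟩
    · have m1 : Monotone g := monotone_of_deriv_nonneg hdiff fun τ => by
        rw [hderiv]; exact (hs τ).1
      have m2 : Antitone fun τ => g τ - s * τ := antitone_of_deriv_nonpos hhd fun τ => by
        rw [(hh τ).deriv]; linarith [(hs τ).2]
      rw [abs_of_nonneg hs0]
      rcases le_total 0 τ with h | h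
      · left; have := m2 h; simp only at this; linarith
      rcases le_total τ (-M) with h' | h'
      · right; have := m1 h'; linarith
      · left; exact (hnear' τ (by rw [abs_of_nonpos h]; linarith)).le
    · have m1 : Antitone g := antitone_of_deriv_nonpos hdiff fun τ => by
        rw [hderiv]; exact (hs τ).2
      have m2 : Monotone fun τ => g τ - s * τ := monotone_of_deriv_nonneg hhd fun τ => by
        rw [(hh τ).deriv]; linarith [(hs τ).1]
      rw [abs_of_nonpos hs0]
      rcases le_total τ 0 with h | h
      · left; have := m2 h; simp only at this; linarith
      rcases le_total M τ with h' | h'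
      · right; have := m1 h'; linarith
      · left; exact (hnear' τ (by rw [abs_of_nonneg h]; linarith)).le

/-- The partition is c1 = sin(ψb), c0 = cos(ψb) with a plateau function b and sin²ψ = θ, so c1² = θ
on the plateau and c1 = 0 far out. The exponent σ is then determined by c1, and f is the exponential
of its primitive. The bound 1/(1 - |μ|) for σ depends neither on ε nor on M. -/
lemma exists_slowPower {mup θ ε M : ℝ} (hmup : |mup| < 1) (hθ0 : 0 ≤ θ) (hθ1 : θ ≤ 1)
    (hε : 0 < ε) (hM : 0 < M) :
    ∃ (a : ℝ) (f c1 c0 σ : ℝ → ℝ),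
      SlowPower mup (1 / (1 - |mup|)) ε (2 * (mup * θ / (1 - mup * θ))) M a f c1 c0 σ := by
  obtain ⟨C, hC, hplat⟩ := exists_plateau
  -- The slope of b is at most ε/2, and ψ ≤ π/2 ≤ 2, so the derivative of the angle ψb is at most ε.
  obtain ⟨a, hMa, b, hb, hb0, hb1, hbM, hbfar, hbd⟩ := hplat (ε / (2 * C)) M (by positivity) hM
  set ψ := Real.arcsin (Real.sqrt θ) with hψ
  have hψ0 : 0 ≤ ψ := Real.arcsin_nonneg.2 (Real.sqrt_nonneg _)
  have hψ1 : ψ ≤ Real.pi / 2 := Real.arcsin_le_pi_div_two _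
  have hψ2 : ψ ≤ 2 := hψ1.trans (by linarith [Real.pi_le_four])
  have hsin : Real.sin ψ = Real.sqrt θ :=
    Real.sin_arcsin (by linarith [Real.sqrt_nonneg θ]) (Real.sqrt_le_one.2 hθ1)
  have hsin2 : Real.sin ψ ^ 2 = θ := by rw [hsin, Real.sq_sqrt hθ0]
  have hΨ0 : ∀ τ, 0 ≤ ψ * b τ := fun τ => mul_nonneg hψ0 (hb0 τ)
  have hΨ1 : ∀ τ, ψ * b τ ≤ ψ := fun τ => mul_le_of_le_one_right hψ0 (hb1 τ)
  have hΨd : ∀ τ, HasDerivAt (fun τ => ψ * b τ) (ψ * deriv b τ) τ :=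
    fun τ => (hb.hasDerivAt τ).const_mul ψ
  have hΨd' : ∀ τ, |ψ * deriv b τ| ≤ ε := fun τ => by
    rw [abs_mul, abs_of_nonneg hψ0]
    calc ψ * |deriv b τ| ≤ 2 * (C * (ε / (2 * C))) := by gcongr; exact hbd τ
      _ = ε := by field_simp
  set c1 : ℝ → ℝ := fun τ => Real.sin (ψ * b τ) with hc1
  set c0 : ℝ → ℝ := fun τ => Real.cos (ψ * b τ) with hc0
  set x : ℝ → ℝ := fun τ => mup * c1 τ ^ 2 with hx
  -- The solution of σ = x(1 + σ) with x = μc1².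
  set σ : ℝ → ℝ := fun τ => x τ / (1 - x τ) with hσ
  have c1n : ∀ τ, 0 ≤ c1 τ := fun τ => Real.sin_nonneg_of_nonneg_of_le_pi (hΨ0 τ)
    ((hΨ1 τ).trans (by linarith [Real.pi_pos]))
  have c1le : ∀ τ, c1 τ ^ 2 ≤ θ := fun τ => by
    rw [← hsin2]
    have : c1 τ ≤ Real.sin ψ := Real.sin_le_sin_of_le_of_le_pi_div_two
      (by linarith [hΨ0 τ, Real.pi_pos]) hψ1 (hΨ1 τ)
    have := c1n τ
    gcongr
  have p1 : IsProfile a c1 := ⟨Real.contDiff_sin.comp (contDiff_const.mul hb.contDiff),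
    fun τ h => by simp only [hc1, hb.left τ h], fun τ h => by simp only [hc1, hb.right τ h]⟩
  have p0 : IsProfile a c0 := ⟨Real.contDiff_cos.comp (contDiff_const.mul hb.contDiff),
    fun τ h => by simp only [hc0, hb.left τ h], fun τ h => by simp only [hc0, hb.right τ h]⟩
  have hx1 : ∀ τ, |x τ| ≤ |mup| := fun τ => by
    simp only [hx, abs_mul, abs_of_nonneg (sq_nonneg (c1 τ))]
    exact mul_le_of_le_one_right (abs_nonneg _) ((c1le τ).trans hθ1)
  have hx2 : ∀ τ, x τ < 1 := fun τ => (le_abs_self _).trans_lt ((hx1 τ).trans_lt hmup)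
  have hx3 : ∀ τ, 1 - x τ ≠ 0 := fun τ => by linarith [hx2 τ]
  have cx : ContDiff ℝ ∞ x := contDiff_const.mul (p1.contDiff.pow 2)
  have pσ : IsProfile a σ := ⟨cx.div (contDiff_const.sub cx) hx3,
    fun τ h => by simp only [hσ, hx, p1.left τ h], fun τ h => by simp only [hσ, hx, p1.right τ h]⟩
  have hfar1 : ∀ τ, a ≤ |τ| → c1 τ = 0 := fun τ h => by simp [hc1, hbfar τ h]
  have hmθ : mup * θ < 1 := by
    calc mup * θ ≤ |mup| * θ := by gcongr; exact le_abs_self _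
      _ ≤ |mup| := mul_le_of_le_one_right (abs_nonneg _) hθ1
      _ < 1 := hmup
  obtain ⟨g, pg, hgd, hgM, hgle⟩ := exists_primitive (s := mup * θ / (1 - mup * θ)) pσ hMa hM
    (fun τ h => by simp [hσ, hx, hfar1 τ h])
    (fun τ h => by simp [hσ, hx, hc1, hbM τ h, hsin2]) (by
      rcases le_total 0 mup with h | h
      · left
        refine ⟨div_nonneg (by positivity) (by linarith), fun τ => ⟨div_nonneg (by positivity)
          (by linarith [hx2 τ]), div_one_sub_le ?_ hmθ⟩⟩
        exact mul_le_mul_of_nonneg_left (c1le τ) h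
      · right
        refine ⟨div_nonpos_of_nonpos_of_nonneg (mul_nonpos_of_nonpos_of_nonneg h hθ0)
          (by linarith), fun τ => ⟨div_one_sub_le ?_ (hx2 τ), div_nonpos_of_nonpos_of_nonneg
            (mul_nonpos_of_nonpos_of_nonneg h (sq_nonneg _)) (by linarith [hx2 τ])⟩⟩
        exact mul_le_mul_of_nonpos_left (c1le τ) h)
  set s := mup * θ / (1 - mup * θ) with hs
  have hfd : ∀ τ, HasDerivAt (fun τ => Real.exp (g τ)) (Real.exp (g τ) * σ τ) τ :=
    fun τ => (hgd τ).exp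
  have hsq : ∀ τ, Real.exp (g τ) ^ 2 = Real.exp (2 * g τ) := fun τ => by
    rw [← Real.exp_nat_mul]; norm_num
  refine ⟨a, fun τ => Real.exp (g τ), c1, c0, σ, ?_⟩
  exact
  { prof_f := ⟨Real.contDiff_exp.comp pg.contDiff, fun τ h => by simp only [pg.left τ h],
      fun τ h => by simp only [pg.right τ h]⟩
    prof_c1 := p1
    prof_c0 := p0
    prof_σ := pσ
    f_pos := fun τ => Real.exp_pos _
    deriv_f := fun τ => by rw [(hfd τ).deriv, mul_comm]
    c1_nonneg := c1n
    partition := fun τ => Real.sin_sq_add_cos_sq _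
    deriv_c1 := fun τ => by
      rw [(hΨd τ).sin.deriv, abs_mul]
      exact (mul_le_of_le_one_left (abs_nonneg _) (Real.abs_cos_le_one _)).trans (hΨd' τ)
    deriv_c0 := fun τ => by
      rw [(hΨd τ).cos.deriv, abs_mul, abs_neg]
      exact (mul_le_of_le_one_left (abs_nonneg _) (Real.abs_sin_le_one _)).trans (hΨd' τ)
    σ_eq := fun τ => by
      change x τ / (1 - x τ) = x τ * (1 + x τ / (1 - x τ))
      have := hx3 τ
      field_simp
      ring
    σ_le := fun τ => by
      have h1 : 1 - |mup| ≤ 1 - x τ := by linarith [le_abs_self (x τ), hx1 τ]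
      have h2 : 0 < 1 - |mup| := by linarith
      simp only [hσ]
      rw [abs_div, abs_of_pos (h2.trans_le h1)]
      exact div_le_div₀ zero_le_one ((hx1 τ).trans hmup.le) h2 h1
    c1_far := hfar1
    le_a := hMa
    f_sq_eq := fun τ h => by rw [hsq, hgM τ h]; ring_nf
    f_sq_le := fun τ => by
      rw [hsq]
      rcases hgle τ with h | h
      · refine (Real.exp_le_exp.2 (?_ : 2 * g τ ≤ 2 * s * τ)).trans
          (le_add_of_nonneg_right (Real.exp_nonneg _))
        linarith
      · refine (Real.exp_le_exp.2 (?_ : 2 * g τ ≤ -(|2 * s| * M))).trans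
          (le_add_of_nonneg_left (Real.exp_nonneg _))
        rw [abs_mul, abs_two]
        linarith }

end PEllipticSystem

namespace PEllipticSystem
open Filter Topology

variable {n m : ℕ} {Ω : Set (Pt n)} {A : Pt n → Coeff2 n m} {B : Pt n → Coeff1 n m} {Λ : ℝ}

/-! ### Integrability of the forms -/

/-- The bound for the second order form. -/
noncomputable def formBound (n m : ℕ) (Λ : ℝ) : ℝ := n ^ 2 * m ^ 2 * |Λ|

lemma formBound_nonneg (n m : ℕ) (Λ : ℝ) : 0 ≤ formBound n m Λ := by unfold formBound; positivity

lemma IsBoundedCoeff.ae_norm_form2_le (hA : IsBoundedCoeff Ω A Λ) :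
    ∀ᵐ y ∂(volume.restrict Ω), ∀ ξ ζ, ‖form2 (A y) ξ ζ‖ ≤ formBound n m Λ * ‖ξ‖ * ‖ζ‖ := by
  have h : ∀ᵐ y ∂(volume.restrict Ω), ∀ h k α β, ‖A y h k α β‖ ≤ |Λ| := by
    simp only [ae_all_iff]
    intro h k α β
    filter_upwards [(hA h k α β).2] with y hy
    exact hy.trans (le_abs_self _)
  filter_upwards [h] with y hy ξ ζ
  exact norm_form2_le _ (abs_nonneg _) hy ξ ζ

lemma aestronglyMeasurable_coord {μ : Measure (Pt n)} {ι : Type*} [Fintype ι]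
    {ξ : Pt n → EuclideanSpace ℂ ι} (hξ : AEStronglyMeasurable ξ μ) (i : ι) :
    AEStronglyMeasurable (fun y => ξ y i) μ :=
  (EuclideanSpace.proj (𝕜 := ℂ) i).continuous.comp_aestronglyMeasurable hξ

lemma IsBoundedCoeff.integrable_form2 (hA : IsBoundedCoeff Ω A Λ) {ξ ζ : Pt n → Tens n m}
    (hξ : MemLp ξ 2 (volume.restrict Ω)) (hζ : MemLp ζ 2 (volume.restrict Ω)) :
    Integrable (fun y => form2 (A y) (ξ y) (ζ y)) (volume.restrict Ω) := by
  have hm : AEStronglyMeasurable (fun y => form2 (A y) (ξ y) (ζ y)) (volume.restrict Ω) := by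
    unfold form2
    refine Finset.aestronglyMeasurable_fun_sum _ fun h _ =>
      Finset.aestronglyMeasurable_fun_sum _ fun k _ =>
      Finset.aestronglyMeasurable_fun_sum _ fun α _ =>
      Finset.aestronglyMeasurable_fun_sum _ fun β _ => ?_
    exact ((hA h k α β).1.mul (aestronglyMeasurable_coord hξ.1 _)).mul
      (Complex.continuous_conj.comp_aestronglyMeasurable (aestronglyMeasurable_coord hζ.1 _))
  refine Integrable.mono' ((hξ.norm.integrable_mul hζ.norm).const_mul (formBound n m Λ)) hm ?_
  filter_upwards [hA.ae_norm_form2_le] with y hy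
  simpa [mul_assoc] using hy (ξ y) (ζ y)

lemma IsBoundedCoeff.integrable_form2Re (hA : IsBoundedCoeff Ω A Λ) {ξ ζ : Pt n → Tens n m}
    (hξ : MemLp ξ 2 (volume.restrict Ω)) (hζ : MemLp ζ 2 (volume.restrict Ω)) :
    Integrable (fun y => form2Re (A y) (ξ y) (ζ y)) (volume.restrict Ω) :=
  (hA.integrable_form2 hξ hζ).re

lemma IsBoundedCoeff.re_integral_form2 (hA : IsBoundedCoeff Ω A Λ) {ξ ζ : Pt n → Tens n m}
    (hξ : MemLp ξ 2 (volume.restrict Ω)) (hζ : MemLp ζ 2 (volume.restrict Ω)) :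
    (∫ y in Ω, form2 (A y) (ξ y) (ζ y)).re = ∫ y in Ω, form2Re (A y) (ξ y) (ζ y) :=
  (integral_re (hA.integrable_form2 hξ hζ)).symm

lemma aestronglyMeasurable_radialPart {μ : Measure (Pt n)} {v : Pt n → Val m}
    {G : Pt n → Tens n m} (hv : AEStronglyMeasurable v μ) (hG : AEStronglyMeasurable G μ) :
    AEStronglyMeasurable (fun y => radialPart (v y) (G y)) μ := by
  simp only [radialPart_eq_tensor]
  refine continuous_tensor.comp_aestronglyMeasurable (AEStronglyMeasurable.prodMk ?_ hv)
  refine (aemeasurable_pi_lambda _ fun h => ?_).aestronglyMeasurable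
  have h1 : AEStronglyMeasurable (fun y => inner ℝ (v y) (row h (G y))) μ :=
    hv.inner ((continuous_row h).comp_aestronglyMeasurable hG)
  exact h1.aemeasurable.div (hv.norm.aemeasurable.pow_const 2)

lemma memLp_radialPart {μ : Measure (Pt n)} {v : Pt n → Val m} {G : Pt n → Tens n m}
    (hv : AEStronglyMeasurable v μ) (hG : MemLp G 2 μ) :
    MemLp (fun y => radialPart (v y) (G y)) 2 μ :=
  hG.of_le (aestronglyMeasurable_radialPart hv hG.1)
    (Eventually.of_forall fun y => norm_radialPart_le (v y) (G y))

/-! ### Consequences of ellipticity -/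

lemma IsPEllipticWith.le_integral_of_two {lam : ℝ} (hA : IsBoundedCoeff Ω A Λ)
    (hell : IsPEllipticWith Ω A 2 lam) {v : Pt n → Val m} {G : Pt n → Tens n m}
    (hv : MemW12Zero Ω v G) :
    lam * ∫ y in Ω, ‖G y‖ ^ 2 ≤ ∫ y in Ω, form2Re (A y) (G y) (G y) := by
  have h := hell v G hv
  simp only [ne_eq, OfNat.ofNat_ne_zero, not_false_eq_true, div_self, sub_self, zero_smul,
    sub_zero, add_zero] at h
  rwa [hA.re_integral_form2 hv.2.1 hv.2.1] at h

lemma IsPEllipticWith.le_integral {p c : ℝ} (hA : IsBoundedCoeff Ω A Λ)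
    (hell : IsPEllipticWith Ω A p c) {v : Pt n → Val m} {G : Pt n → Tens n m}
    (hv : MemW12Zero Ω v G) :
    c * ∫ y in Ω, ‖G y‖ ^ 2 ≤ ∫ y in Ω, form2Re (A y)
      (G y - (1 - 2 / p : ℝ) • radialPart (v y) (G y))
      (G y + (1 - 2 / p : ℝ) • radialPart (v y) (G y)) := by
  have h := hell v G hv
  have hR := (memLp_radialPart hv.1.1 hv.2.1).const_smul (1 - 2 / p : ℝ)
  rwa [hA.re_integral_form2 (ξ := fun y => G y - (1 - 2 / p : ℝ) • radialPart (v y) (G y))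
    (ζ := fun y => G y + (1 - 2 / p : ℝ) • radialPart (v y) (G y))
    (hv.2.1.sub hR) (hv.2.1.add hR)] at h

lemma nonneg_of_forall_quadratic {a b c : ℝ} (h : ∀ t : ℝ, 0 ≤ a + t * b + t ^ 2 * c) : 0 ≤ c := by
  by_contra hc
  push Not at hc
  have h1 := h ((|a| + |b| + 1) / -c + 1)
  set t := (|a| + |b| + 1) / -c + 1 with ht
  have ht1 : 1 ≤ t := by
    rw [ht]
    have : 0 ≤ (|a| + |b| + 1) / -c := div_nonneg (by positivity) (by linarith)
    linarith
  have h2 : t * -c = (|a| + |b| + 1) + -c := by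
    rw [ht, add_mul, div_mul_cancel₀ _ (by linarith), one_mul]
  have h3 : t * b ≤ t * |b| := mul_le_mul_of_nonneg_left (le_abs_self b) (by linarith)
  have h4 : t ^ 2 * c = -(t * (t * -c)) := by ring
  rw [h4, h2] at h1
  nlinarith [le_abs_self a, abs_nonneg a, abs_nonneg b]

/-- The form is nonnegative on radial gradients: the coefficient of `t²` in the ellipticity
inequality for `η k(U) e^{i t log |U|} U`. -/
lemma integral_form2Re_radial_nonneg {lam a : ℝ} (hA : IsBoundedCoeff Ω A Λ) (hlam : 0 ≤ lam)
    (hell : IsPEllipticWith Ω A 2 lam) {U : Pt n → Val m} {GU : Pt n → Tens n m}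
    (hU : W0On Ω Ω U GU) {O : Set (Pt n)} {η : Pt n → ℝ} (hη : IsTest O η) {k : ℝ → ℝ}
    (hk : IsProfile a k) (hk0 : ∀ τ, a ≤ |τ| → k τ = 0) (ha : 0 ≤ a) :
    0 ≤ ∫ y in Ω, (η y * k (logNorm a (U y))) ^ 2 *
      form2Re (A y) (radialPart (U y) (GU y)) (radialPart (U y) (GU y)) := by
  obtain ⟨Cη, hCη0, hCη, -⟩ := hη.exists_bound
  obtain ⟨Ck, hCk0, hCk, -⟩ := hk.exists_bound
  have mk : Continuous k := hk.contDiff.continuous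
  have mℓ : AEStronglyMeasurable (fun y => logNorm a (U y)) (volume.restrict Ω) :=
    (continuous_logNorm a).comp_aestronglyMeasurable hU.1.1
  set P : Pt n → Tens n m := fun y => (η y * k (logNorm a (U y))) • GU y +
        (η y * deriv k (logNorm a (U y))) • radialPart (U y) (GU y) +
        tensor (fun h => k (logNorm a (U y)) * pderiv h η y) (U y) with hP
  set W : Pt n → Tens n m := fun y => (η y * k (logNorm a (U y))) • radialPart (U y) (GU y) with hW
  have mP : MemLp P 2 (volume.restrict Ω) := (hU.radial_real hk hη).2.1
  have mW : MemLp W 2 (volume.restrict Ω) := by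
    refine (memLp_radialPart hU.1.1 hU.2.1).of_le_mul (c := Cη * Ck)
      ((hη.1.continuous.aestronglyMeasurable.mul (mk.comp_aestronglyMeasurable mℓ)).smul
        (aestronglyMeasurable_radialPart hU.1.1 hU.2.1.1)) (Eventually.of_forall fun y => ?_)
    rw [norm_smul, norm_mul]
    gcongr
    · exact hCη y
    · exact hCk _
  have mIW : MemLp (fun y => Complex.I • W y) 2 (volume.restrict Ω) :=
    MemLp.const_smul mW Complex.I
  have hIW : ∀ y, form2Re (A y) (Complex.I • W y) (Complex.I • W y) = form2Re (A y) (W y) (W y) := by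
    intro y
    simp only [form2Re_apply, form2_smul_smul]
    simp
  -- Differentiating the phase adds t·iW to the gradient P, and the phase itself has modulus one.
  -- Ellipticity thus says that this quadratic polynomial in t is nonnegative, so its leading
  -- coefficient is.
  have key : ∀ t : ℝ, 0 ≤ (∫ y in Ω, form2Re (A y) (P y) (P y)) +
      t * (∫ y in Ω, (form2Re (A y) (P y) (Complex.I • W y) +
        form2Re (A y) (Complex.I • W y) (P y))) +
      t ^ 2 * ∫ y in Ω, form2Re (A y) (W y) (W y) := by
    intro t
    -- The oscillating factor is not constant outside [-a, a]; the product is an admissible profile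
    -- only because k vanishes there.
    have hprof : IsProfile a fun τ => (k τ : ℂ) * Complex.exp (Complex.I * t * τ) :=
      { contDiff := hk.ofReal.contDiff.mul (by
          have h1 : ContDiff ℝ ∞ fun τ : ℝ => Complex.I * t * (τ : ℂ) :=
            contDiff_const.mul Complex.ofRealCLM.contDiff
          exact h1.cexp)
        left := fun τ h => by
          rw [hk0 τ (by rw [abs_of_nonpos (by linarith)]; linarith),
            hk0 (-a) (by rw [abs_neg, abs_of_nonneg ha])]
          simp
        right := fun τ h => by
          rw [hk0 τ (by rw [abs_of_nonneg (by linarith)]; linarith),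
            hk0 a (by rw [abs_of_nonneg ha])]
          simp }
    have hd : ∀ τ, deriv (fun τ : ℝ => (k τ : ℂ) * Complex.exp (Complex.I * t * τ)) τ =
        Complex.exp (Complex.I * t * τ) * (((deriv k τ : ℝ) : ℂ) + Complex.I * t * k τ) := by
      intro τ
      have h1 : HasDerivAt (fun τ : ℝ => Complex.I * t * (τ : ℂ)) (Complex.I * t) τ := by
        simpa using (Complex.ofRealCLM.hasDerivAt (x := τ)).const_mul (Complex.I * t)
      have h2 : HasDerivAt (fun τ : ℝ => (k τ : ℂ) * Complex.exp (Complex.I * t * τ)) _ τ :=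
        (hk.hasDerivAt τ).ofReal_comp.mul h1.cexp
      rw [h2.deriv]
      ring
    have hw := (hU.radial hprof hη)
    have hell' := hell.le_integral_of_two hA (hw.memW12Zero Set.inter_subset_left)
    have hG : ∀ y, ((η y : ℂ) * ((k (logNorm a (U y)) : ℂ) *
          Complex.exp (Complex.I * t * (logNorm a (U y) : ℝ)))) • GU y +
        ((η y : ℂ) * deriv (fun τ : ℝ => (k τ : ℂ) * Complex.exp (Complex.I * t * τ))
          (logNorm a (U y))) • radialPart (U y) (GU y) +
        ((k (logNorm a (U y)) : ℂ) * Complex.exp (Complex.I * t * (logNorm a (U y) : ℝ))) •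
          tensor (fun h => pderiv h η y) (U y) =
        Complex.exp (Complex.I * t * (logNorm a (U y) : ℝ)) • (P y + t • (Complex.I • W y)) := by
      intro y
      rw [hd]
      ext i
      simp only [hP, hW, PiLp.add_apply, PiLp.smul_apply, smul_eq_mul, Complex.real_smul,
        tensor_apply]
      push_cast
      ring
    simp only [hG] at hell'
    have hexp : ∀ τ : ℝ, ‖Complex.exp (Complex.I * t * τ)‖ = 1 := fun τ => by
      have : Complex.I * t * τ = ((t * τ : ℝ) : ℂ) * Complex.I := by push_cast; ring
      rw [this, Complex.norm_exp_ofReal_mul_I]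
    have hform : ∀ y, form2Re (A y)
        (Complex.exp (Complex.I * t * (logNorm a (U y) : ℝ)) • (P y + t • (Complex.I • W y)))
        (Complex.exp (Complex.I * t * (logNorm a (U y) : ℝ)) • (P y + t • (Complex.I • W y))) =
        form2Re (A y) (P y) (P y) + t * (form2Re (A y) (P y) (Complex.I • W y) +
        form2Re (A y) (Complex.I • W y) (P y)) + t ^ 2 * form2Re (A y) (W y) (W y) := by
      intro y
      have h1 : form2Re (A y)
        (Complex.exp (Complex.I * t * (logNorm a (U y) : ℝ)) • (P y + t • (Complex.I • W y)))
        (Complex.exp (Complex.I * t * (logNorm a (U y) : ℝ)) • (P y + t • (Complex.I • W y))) =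
        form2Re (A y) (P y + t • (Complex.I • W y)) (P y + t • (Complex.I • W y)) := by
        simp only [form2Re_apply, form2_smul_smul, hexp]
        simp
      rw [h1, ← hIW]
      simp only [map_add, LinearMap.add_apply, map_smul, LinearMap.smul_apply, smul_eq_mul]
      ring
    simp only [hform] at hell'
    have i1 := hA.integrable_form2Re mP mP
    have i2 : Integrable (fun y => form2Re (A y) (P y) (Complex.I • W y) +
        form2Re (A y) (Complex.I • W y) (P y)) (volume.restrict Ω) :=
      (hA.integrable_form2Re mP mIW).add (hA.integrable_form2Re mIW mP)
    have i3 := hA.integrable_form2Re mW mW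
    have i12 : Integrable (fun y => form2Re (A y) (P y) (P y) +
        t * (form2Re (A y) (P y) (Complex.I • W y) + form2Re (A y) (Complex.I • W y) (P y)))
        (volume.restrict Ω) := i1.add (i2.const_mul t)
    rw [integral_add i12 (i3.const_mul _), integral_add i1 (i2.const_mul t),
      integral_const_mul, integral_const_mul] at hell'
    exact (mul_nonneg hlam (integral_nonneg fun y => sq_nonneg _)).trans hell'
  have := nonneg_of_forall_quadratic key
  refine this.trans_eq (integral_congr_ae (Eventually.of_forall fun y => ?_))
  simp only [hW, map_smul, LinearMap.smul_apply, smul_eq_mul]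
  ring

/-! ### Testing the equation with functions in `W^{1,2}_0` -/

lemma form2_sub_right (a : Coeff2 n m) (ξ ζ ζ' : Tens n m) :
    form2 a ξ (ζ - ζ') = form2 a ξ ζ - form2 a ξ ζ' := by
  simp only [form2, ← Finset.sum_sub_distrib, PiLp.sub_apply, map_sub, mul_sub]

lemma form1_sub_right (b : Coeff1 n m) (ξ : Tens n m) (w w' : Val m) :
    form1 b ξ (w - w') = form1 b ξ w - form1 b ξ w' := by
  simp only [form1, ← Finset.sum_sub_distrib, PiLp.sub_apply, map_sub, mul_sub]

lemma IsDriftBound.ae_norm_form1_le {K : ℝ} (hB : IsDriftBound Ω B K) :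
    ∀ᵐ y ∂(volume.restrict Ω), ∀ (ξ : Tens n m) (w : Val m), ‖form1 (B y) ξ w‖ ≤
      n * m ^ 2 * K * ‖ξ‖ * (‖w‖ / Metric.infDist y (frontier Ω)) := by
  have h : ∀ᵐ y ∂(volume.restrict Ω), ∀ h α β, ‖B y h α β‖ ≤ K / Metric.infDist y (frontier Ω) := by
    simp only [ae_all_iff]
    exact fun h α β => (hB h α β).2
  filter_upwards [h] with y hy ξ w
  refine (norm_form1_le _ hy ξ w).trans_eq ?_
  ring

lemma IsDriftBound.integrable_form1 {K : ℝ} (hB : IsDriftBound Ω B K) {ξ : Pt n → Tens n m}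
    {w : Pt n → Val m} (hξ : MemLp ξ 2 (volume.restrict Ω))
    (hw : AEStronglyMeasurable w (volume.restrict Ω))
    (hw' : MemLp (fun y => ‖w y‖ / Metric.infDist y (frontier Ω)) 2 (volume.restrict Ω)) :
    Integrable (fun y => form1 (B y) (ξ y) (w y)) (volume.restrict Ω) := by
  have hm : AEStronglyMeasurable (fun y => form1 (B y) (ξ y) (w y)) (volume.restrict Ω) := by
    unfold form1
    refine Finset.aestronglyMeasurable_fun_sum _ fun h _ =>
      Finset.aestronglyMeasurable_fun_sum _ fun α _ =>
      Finset.aestronglyMeasurable_fun_sum _ fun β _ => ?_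
    exact ((hB h α β).1.mul (aestronglyMeasurable_coord hξ.1 _)).mul
      (Complex.continuous_conj.comp_aestronglyMeasurable (aestronglyMeasurable_coord hw _))
  refine Integrable.mono' ((hξ.norm.integrable_mul hw').const_mul (n * m ^ 2 * K)) hm ?_
  filter_upwards [hB.ae_norm_form1_le] with y hy
  simpa [mul_assoc] using hy (ξ y) (w y)

/-- The weak formulation extends from test functions to limits of test functions. -/
lemma integral_form_eq_zero_of_w0On {K CH : ℝ} (hA : IsBoundedCoeff Ω A Λ)
    (hB : IsDriftBound Ω B K) (hK : 0 ≤ K) (hCH : 0 ≤ CH)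
    (hardy : ∀ v : Pt n → Val m, IsTest Ω v →
      ∫⁻ y, ENNReal.ofReal ((‖v y‖ / Metric.infDist y (frontier Ω)) ^ 2) ≤
        ENNReal.ofReal CH * ∫⁻ y, ENNReal.ofReal (‖grad v y‖ ^ 2))
    {GU : Pt n → Tens n m} (hGU : MemLp GU 2 (volume.restrict Ω)) {O : Set (Pt n)}
    (heq : ∀ v : Pt n → Val m, IsTest (Ω ∩ O) v →
      ∫ y in Ω, (form2 (A y) (GU y) (grad v y) - form1 (B y) (GU y) (v y)) = 0)
    {w : Pt n → Val m} {Γ : Pt n → Tens n m} (hw : W0On Ω (Ω ∩ O) w Γ) :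
    ∫ y in Ω, (form2 (A y) (GU y) (Γ y) - form1 (B y) (GU y) (w y)) = 0 := by
  have hsub : Ω ∩ O ⊆ Ω := Set.inter_subset_left
  obtain ⟨-, -, φ, hφ, h1, h2, -⟩ := id hw
  -- Hardy's inequality for w - φ k controls (w - φ k)/δ in L² by the difference of gradients; hence
  -- the drift term converges although B is unbounded near the boundary.
  have hd := fun k => (hw.sub_test (hφ k)).eLpNorm_hardy hsub hCH hardy
  have hwδ := (hw.hardy hsub hCH hardy).1
  have test_w0 : ∀ k, MemLp (fun y => ‖φ k y‖ / Metric.infDist y (frontier Ω)) 2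
      (volume.restrict Ω) := by
    intro k
    have hz : W0On Ω (Ω ∩ O) (φ k) (grad (φ k)) := by
      refine ⟨(hφ k).memLp 2 Ω, (hφ k).memLp_grad 2 Ω, fun _ => φ k, fun _ => hφ k, ?_, ?_, ?_⟩
      · simp
      · simp
      · exact Eventually.of_forall fun y => tendsto_const_nhds
    exact (hz.hardy hsub hCH hardy).1
  set c : ℝ := formBound n m Λ + n * m ^ 2 * K with hc
  have hfb := formBound_nonneg n m Λ
  have hlim := tendsto_integral_of_eLpNorm_two (μ := volume.restrict Ω)
    (f := fun k y => ‖Γ y - grad (φ k) y‖ + ‖w y - φ k y‖ / Metric.infDist y (frontier Ω))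
    (g := fun y => c * ‖GU y‖)
    (H := fun k y => form2 (A y) (GU y) (grad (φ k) y) - form1 (B y) (GU y) (φ k y))
    (H₀ := fun y => form2 (A y) (GU y) (Γ y) - form1 (B y) (GU y) (w y))
    (fun k => (hw.2.1.1.sub ((hφ k).memLp_grad 2 Ω).1).norm.add (hd k).1)
    (hGU.norm.const_mul c)
    (fun k => (hA.integrable_form2 hGU ((hφ k).memLp_grad 2 Ω)).sub
      (hB.integrable_form1 hGU ((hφ k).memLp 2 Ω).1 (test_w0 k)))
    ((hA.integrable_form2 hGU hw.2.1).sub (hB.integrable_form1 hGU hw.1.1 hwδ))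
    (fun k => by
      filter_upwards [hA.ae_norm_form2_le, hB.ae_norm_form1_le] with y hy1 hy2
      have e : form2 (A y) (GU y) (grad (φ k) y) - form1 (B y) (GU y) (φ k y) -
          (form2 (A y) (GU y) (Γ y) - form1 (B y) (GU y) (w y)) =
          form1 (B y) (GU y) (w y - φ k y) - form2 (A y) (GU y) (Γ y - grad (φ k) y) := by
        rw [form1_sub_right, form2_sub_right]; ring
      rw [e]
      have b1 := hy1 (GU y) (Γ y - grad (φ k) y)
      have b2 := hy2 (GU y) (w y - φ k y)
      have n1 : 0 ≤ ‖w y - φ k y‖ / Metric.infDist y (frontier Ω) :=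
        div_nonneg (norm_nonneg _) Metric.infDist_nonneg
      rw [Real.norm_of_nonneg (by positivity)]
      refine (norm_sub_le _ _).trans ((add_le_add b2 b1).trans ?_)
      have p1 : 0 ≤ formBound n m Λ * ‖GU y‖ *
          (‖w y - φ k y‖ / Metric.infDist y (frontier Ω)) := by positivity
      have p2 : 0 ≤ n * m ^ 2 * K * ‖GU y‖ * ‖Γ y - grad (φ k) y‖ := by positivity
      rw [hc]
      nlinarith)
    (by
      have t1 : Tendsto (fun k => eLpNorm (fun y => Γ y - grad (φ k) y) 2 (volume.restrict Ω) +
          ENNReal.ofReal (Real.sqrt CH) *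
            eLpNorm (fun y => Γ y - grad (φ k) y) 2 (volume.restrict Ω)) atTop
          (𝓝 (0 + ENNReal.ofReal (Real.sqrt CH) * 0)) :=
        h2.add (ENNReal.Tendsto.const_mul h2 (Or.inr ENNReal.ofReal_ne_top))
      rw [mul_zero, add_zero] at t1
      refine tendsto_of_tendsto_of_tendsto_of_le_of_le tendsto_const_nhds t1 (fun _ => zero_le)
        fun k => ?_
      refine (eLpNorm_add_le (hw.2.1.1.sub ((hφ k).memLp_grad 2 Ω).1).norm (hd k).1
        (by norm_num)).trans ?_
      rw [eLpNorm_norm]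
      exact add_le_add le_rfl (hd k).2)
  refine tendsto_nhds_unique hlim ?_
  have : (fun k => ∫ y in Ω, (form2 (A y) (GU y) (grad (φ k) y) - form1 (B y) (GU y) (φ k y))) =
      fun _ => 0 := funext fun k => heq _ (hφ k)
  rw [this]
  exact tendsto_const_nhds

end PEllipticSystem

/-! ### The Caccioppoli inequality for truncated powers -/

namespace PEllipticSystem
open Filter Topology

variable {n m : ℕ} {Ω : Set (Pt n)} {A : Pt n → Coeff2 n m} {B : Pt n → Coeff1 n m} {Λ : ℝ}

/-- (1 + σ) times the radial part of ξ is the radial part of ξ + σ·radialPart, hence no longer than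
that tensor. Subtracting μ times it, with |μ| ≤ 1, recovers ξ. -/
lemma norm_le_two_mul_norm_add_radialPart (w : Val m) (ξ : Tens n m) {σ μ : ℝ}
    (hμ : |μ| ≤ 1) (hσ : σ = μ * (1 + σ)) : ‖ξ‖ ≤ 2 * ‖ξ + σ • radialPart w ξ‖ := by
  have h := radialPart_combination w ξ 1 σ 0 (fun h => absurd h one_ne_zero)
  have h0 : tensor (0 : Fin n → ℝ) w = 0 := by ext i; simp
  rw [h0, add_zero, add_zero, one_smul, one_smul] at h
  have h1 := norm_radialPart_le w (ξ + σ • radialPart w ξ)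
  rw [h] at h1
  have h2 : ξ = (ξ + σ • radialPart w ξ) - μ • ((1 + σ) • radialPart w ξ) := by
    rw [smul_smul, ← hσ]; abel
  calc ‖ξ‖ = ‖(ξ + σ • radialPart w ξ) - μ • ((1 + σ) • radialPart w ξ)‖ := by rw [← h2]
    _ ≤ ‖ξ + σ • radialPart w ξ‖ + |μ| * ‖(1 + σ) • radialPart w ξ‖ := by
        refine (norm_sub_le _ _).trans ?_
        rw [norm_smul μ, Real.norm_eq_abs]
    _ ≤ ‖ξ + σ • radialPart w ξ‖ + 1 * ‖ξ + σ • radialPart w ξ‖ := by gcongr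
    _ = _ := by ring

/-- A zero of a nonnegative function is a minimum. This and its analogue for η provide the
compatibility condition of `radialPart_combination` at the zeros of c1 and η. -/
lemma deriv_eq_zero_of_nonneg {c : ℝ → ℝ} (h : ∀ τ, 0 ≤ c τ) {τ : ℝ} (hτ : c τ = 0) :
    deriv c τ = 0 :=
  IsLocalMin.deriv_eq_zero (Eventually.of_forall fun s => hτ ▸ h s)

lemma pderiv_eq_zero_of_nonneg {η : Pt n → ℝ} (h : ∀ y, 0 ≤ η y) {y : Pt n} (hy : η y = 0)
    (i : Fin n) : pderiv i η y = 0 := by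
  have : fderiv ℝ η y = 0 :=
    IsLocalMin.fderiv_eq_zero (Eventually.of_forall fun s => hy ▸ h s)
  simp [pderiv, this]

lemma form1_smul_left_right (b : Coeff1 n m) (c : ℝ) (ξ : Tens n m) (w : Val m) :
    form1 b ξ ((c * c) • w) = form1 b (c • ξ) (c • w) := by
  simp only [form1]
  refine Finset.sum_congr rfl fun _ _ => Finset.sum_congr rfl fun _ _ =>
    Finset.sum_congr rfl fun _ _ => ?_
  simp only [PiLp.smul_apply, Complex.real_smul, map_mul, Complex.conj_ofReal]
  push_cast; ring

set_option maxHeartbeats 1000000 in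
/-- The Caccioppoli inequality for truncated powers, for a solution with zero boundary values. -/
lemma caccioppoli_slowPower {p lam lamp l S ε β M K CH a : ℝ} {f c1 c0 σ : ℝ → ℝ}
    (hA : IsBoundedCoeff Ω A Λ) (hB : IsDriftBound Ω B K) (hK : 0 ≤ K) (hCH : 0 ≤ CH)
    (hardy : ∀ v : Pt n → Val m, IsTest Ω v →
      ∫⁻ y, ENNReal.ofReal ((‖v y‖ / Metric.infDist y (frontier Ω)) ^ 2) ≤
        ENNReal.ofReal CH * ∫⁻ y, ENNReal.ofReal (‖grad v y‖ ^ 2))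
    (hell2 : IsPEllipticWith Ω A 2 lam) (hellp : IsPEllipticWith Ω A p lamp)
    (hl : 0 < l) (hl0 : l ≤ lam) (hl1 : l ≤ lamp) (hmup : |1 - 2 / p| ≤ 1) (hS : 1 ≤ S)
    (hε1 : ε ≤ 1)
    (hε : ε * (64 * formBound n m Λ * S + 32 * formBound n m Λ + 4 * l) ≤ l / 32)
    (hKs : n * m ^ 2 * K * (1 + 2 * CH * (1 + S) ^ 2) ≤ l / 32)
    (hP : SlowPower (1 - 2 / p) S ε β M a f c1 c0 σ) (ha : 0 ≤ a)
    {U : Pt n → Val m} {GU : Pt n → Tens n m} (hU : W0On Ω Ω U GU) {O : Set (Pt n)}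
    (heq : ∀ v : Pt n → Val m, IsTest (Ω ∩ O) v →
      ∫ y in Ω, (form2 (A y) (GU y) (grad v y) - form1 (B y) (GU y) (v y)) = 0)
    {η : Pt n → ℝ} (hη : IsTest O η) (hη0 : ∀ y, 0 ≤ η y) :
    ∃ Γ, W0On Ω (Ω ∩ O) (fun y => (η y * f (logNorm a (U y))) • U y) Γ ∧
      (∀ y, ‖Γ y‖ ≤ (1 + S) * ‖(η y * f (logNorm a (U y))) • GU y‖ +
        ‖tensor (fun h => f (logNorm a (U y)) * pderiv h η y) (U y)‖) ∧
      MemLp (fun y => (η y * f (logNorm a (U y))) • GU y) 2 (volume.restrict Ω) ∧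
      MemLp (fun y => tensor (fun h => f (logNorm a (U y)) * pderiv h η y) (U y)) 2
        (volume.restrict Ω) ∧
      ∫ y in Ω, ‖(η y * f (logNorm a (U y))) • GU y‖ ^ 2 ≤
        32 / l * (8 * (64 * formBound n m Λ * S) ^ 2 / l + 32 * formBound n m Λ + 4 * l +
          64 * formBound n m Λ ^ 2 / l + l / 32) *
        ∫ y in Ω, ‖tensor (fun h => f (logNorm a (U y)) * pderiv h η y) (U y)‖ ^ 2 := by
  set mup := 1 - 2 / p with hmupdef
  set Fb := formBound n m Λ with hFb
  have hFb0 : 0 ≤ Fb := formBound_nonneg n m Λ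
  set ℓ : Pt n → ℝ := fun y => logNorm a (U y) with hℓ
  have mℓ : AEStronglyMeasurable ℓ (volume.restrict Ω) :=
    (continuous_logNorm a).comp_aestronglyMeasurable hU.1.1
  set g : Pt n → ℝ := fun y => η y * f (ℓ y) with hg
  set R : Pt n → Tens n m := fun y => radialPart (U y) (GU y) with hR
  set X : Pt n → Tens n m := fun y => g y • GU y with hX
  set Y : Pt n → Tens n m := fun y => g y • R y with hY
  set Z : Pt n → Tens n m := fun y => tensor (fun h => f (ℓ y) * pderiv h η y) (U y) with hZ
  set s : Pt n → ℝ := fun y => σ (ℓ y) with hs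
  set N1 : Pt n → Tens n m := fun y =>
    c1 (ℓ y) • (X y + s y • Y y + Z y) + deriv c1 (ℓ y) • Y y with hN1
  set N0 : Pt n → Tens n m := fun y =>
    c0 (ℓ y) • (X y + s y • Y y + Z y) + deriv c0 (ℓ y) • Y y with hN0
  set Q1 : Pt n → Tens n m := fun y =>
    c1 (ℓ y) • ((1 + s y) • Y y + Z y) + deriv c1 (ℓ y) • Y y with hQ1
  -- measurability and integrability
  obtain ⟨Cη, hCη0, hCη, -⟩ := hη.exists_bound
  obtain ⟨Cf, hCf0, hCf, -⟩ := hP.prof_f.exists_bound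
  have mg : AEStronglyMeasurable g (volume.restrict Ω) :=
    hη.1.continuous.aestronglyMeasurable.mul
      (hP.prof_f.contDiff.continuous.comp_aestronglyMeasurable mℓ)
  have bg : ∀ y, ‖g y‖ ≤ Cη * Cf := fun y => by
    rw [hg, norm_mul]
    exact mul_le_mul (hCη y) (hCf _) (norm_nonneg _) hCη0
  have ms : AEStronglyMeasurable s (volume.restrict Ω) :=
    hP.prof_σ.contDiff.continuous.comp_aestronglyMeasurable mℓ
  have LR : MemLp R 2 (volume.restrict Ω) := memLp_radialPart hU.1.1 hU.2.1
  have LX : MemLp X 2 (volume.restrict Ω) :=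
    hU.2.1.of_le_mul (c := Cη * Cf) (mg.smul hU.2.1.1) (Eventually.of_forall fun y => by
      rw [hX, norm_smul]; gcongr; exact bg y)
  have LY : MemLp Y 2 (volume.restrict Ω) :=
    LR.of_le_mul (c := Cη * Cf) (mg.smul LR.1) (Eventually.of_forall fun y => by
      rw [hY, norm_smul]; gcongr; exact bg y)
  have LsY : MemLp (fun y => s y • Y y) 2 (volume.restrict Ω) :=
    LY.of_le_mul (c := S) (ms.smul LY.1) (Eventually.of_forall fun y => by
      rw [norm_smul]; gcongr; exact hP.σ_le _)
  -- the truncated power and its cut-offs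
  have W : W0On Ω (Ω ∩ O) (fun y => g y • U y) (fun y => X y + s y • Y y + Z y) := by
    have := hU.radial_real hP.prof_f hη
    convert! this using 1
    ext1 y
    simp only [hX, hY, hZ, hs, hg, hR, hP.deriv_f, smul_smul]
    congr 3
    ring
  have LΓ := W.2.1
  have LZ : MemLp Z 2 (volume.restrict Ω) := by
    have := (LΓ.sub LX).sub LsY
    refine this.ae_eq (Eventually.of_forall fun y => ?_)
    simp only [Pi.sub_apply]; abel
  have W1 : W0On Ω (Ω ∩ O) (fun y => (g y * c1 (ℓ y)) • U y) N1 := by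
    have := hU.radial_real (hP.prof_f.mul hP.prof_c1) hη
    have hd : ∀ τ, deriv (fun τ => f τ * c1 τ) τ = σ τ * f τ * c1 τ + f τ * deriv c1 τ := fun τ => by
      rw [← hP.deriv_f]; exact ((hP.prof_f.hasDerivAt τ).mul (hP.prof_c1.hasDerivAt τ)).deriv
    convert! this using 1
    · ext1 y; simp only [hg, mul_assoc]
      rfl
    · ext1 y
      ext i
      simp only [hN1, hX, hY, hZ, hs, hg, hR, hd, PiLp.add_apply, PiLp.smul_apply, tensor_apply,
        Complex.real_smul, hℓ]
      push_cast; ring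
  have W0 : W0On Ω (Ω ∩ O) (fun y => (g y * c0 (ℓ y)) • U y) N0 := by
    have := hU.radial_real (hP.prof_f.mul hP.prof_c0) hη
    have hd : ∀ τ, deriv (fun τ => f τ * c0 τ) τ = σ τ * f τ * c0 τ + f τ * deriv c0 τ := fun τ => by
      rw [← hP.deriv_f]; exact ((hP.prof_f.hasDerivAt τ).mul (hP.prof_c0.hasDerivAt τ)).deriv
    convert! this using 1
    · ext1 y; simp only [hg, mul_assoc]
      rfl
    · ext1 y
      ext i
      simp only [hN0, hX, hY, hZ, hs, hg, hR, hd, PiLp.add_apply, PiLp.smul_apply, tensor_apply,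
        Complex.real_smul, hℓ]
      push_cast; ring
  have rad1 : ∀ y, radialPart ((g y * c1 (ℓ y)) • U y) (N1 y) = Q1 y := by
    intro y
    have hN : N1 y = (g y * c1 (ℓ y)) • GU y +
        (g y * (s y * c1 (ℓ y) + deriv c1 (ℓ y))) • radialPart (U y) (GU y) +
        tensor (fun h => c1 (ℓ y) * (f (ℓ y) * pderiv h η y)) (U y) := by
      ext i
      simp only [hN1, hX, hY, hZ, hR, PiLp.add_apply, PiLp.smul_apply, tensor_apply,
        Complex.real_smul]
      push_cast; ring
    rw [hN, radialPart_combination]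
    · ext i
      simp only [hQ1, hY, hZ, hR, PiLp.add_apply, PiLp.smul_apply, tensor_apply,
        Complex.real_smul]
      push_cast; ring
    · intro h0
      rcases mul_eq_zero.1 h0 with h1 | h1
      · have h2 : η y = 0 := by
          rcases mul_eq_zero.1 h1 with h | h
          · exact h
          · exact absurd h (hP.f_pos _).ne'
        refine ⟨by rw [h1, zero_mul], funext fun i => ?_⟩
        rw [pderiv_eq_zero_of_nonneg hη0 h2]; simp
      · have h2 := deriv_eq_zero_of_nonneg hP.c1_nonneg h1
        refine ⟨by rw [h1, h2]; ring, funext fun i => ?_⟩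
        rw [h1]; simp
  -- ellipticity
  have LN1 := W1.2.1
  have LN0 := W0.2.1
  have LQ1 : MemLp Q1 2 (volume.restrict Ω) := by
    have := memLp_radialPart W1.1.1 W1.2.1
    simpa only [rad1] using this
  have hsub : Ω ∩ O ⊆ Ω := Set.inter_subset_left
  have e1 := hellp.le_integral hA (W1.memW12Zero hsub)
  simp only [rad1] at e1
  have e0 := hell2.le_integral_of_two hA (W0.memW12Zero hsub)
  have hone : IsProfile a (fun τ => 1 + σ τ) :=
    { contDiff := contDiff_const.add hP.prof_σ.contDiff
      left := fun τ h => by rw [hP.prof_σ.left τ h]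
      right := fun τ h => by rw [hP.prof_σ.right τ h] }
  have hcst : IsProfile a (fun _ : ℝ => mup) :=
    { contDiff := contDiff_const
      left := fun τ h => rfl
      right := fun τ h => rfl }
  -- The sign of the term with ⟨AY,Y⟩ that is left over when the two ellipticity inequalities are
  -- added. The profile vanishes far out because c1 does.
  have eJ := integral_form2Re_radial_nonneg hA (hl.le.trans hl0) hell2 hU hη
    (k := fun τ => mup * c0 τ * c1 τ * (1 + σ τ) * f τ)
    ((((hcst.mul hP.prof_c0).mul hP.prof_c1).mul hone).mul hP.prof_f)
    (fun τ hτ => by simp [hP.c1_far τ hτ]) ha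
  have eJ' : 0 ≤ ∫ y in Ω, (mup * c0 (ℓ y) * c1 (ℓ y) * (1 + s y)) ^ 2 *
      form2Re (A y) (Y y) (Y y) := by
    refine eJ.trans_eq (integral_congr_ae (Eventually.of_forall fun y => ?_))
    simp only [hY, hg, hs, hR, hℓ, map_smul, LinearMap.smul_apply, smul_eq_mul]
    ring
  -- pointwise inequality
  have hYX : ∀ y, ‖Y y‖ ≤ ‖X y‖ := fun y => by
    simp only [hY, hX, norm_smul]
    gcongr
    exact norm_radialPart_le _ _
  have hX2 : ∀ y, ‖X y‖ ≤ 2 * ‖X y + s y • Y y‖ := fun y => by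
    have h1 := norm_le_two_mul_norm_add_radialPart (U y) (GU y) (σ := s y)
      (μ := mup * c1 (ℓ y) ^ 2) (by
        rw [abs_mul, abs_of_nonneg (sq_nonneg (c1 (ℓ y)))]
        have h2 := hP.partition (ℓ y)
        calc |mup| * c1 (ℓ y) ^ 2 ≤ 1 * 1 := by
              gcongr; linarith [sq_nonneg (c0 (ℓ y))]
          _ = 1 := by ring) (hP.σ_eq _)
    have h3 : X y + s y • Y y = g y • (GU y + s y • radialPart (U y) (GU y)) := by
      simp only [hX, hY, hR, smul_add, smul_smul, mul_comm]
    rw [h3, norm_smul, norm_smul]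
    linarith [mul_le_mul_of_nonneg_left h1 (norm_nonneg (g y))]
  have pw : ∀ᵐ y ∂(volume.restrict Ω),
      form2Re (A y) (N1 y - mup • Q1 y) (N1 y + mup • Q1 y) + form2Re (A y) (N0 y) (N0 y) +
        (mup * c0 (ℓ y) * c1 (ℓ y) * (1 + s y)) ^ 2 * form2Re (A y) (Y y) (Y y) -
        lamp * ‖N1 y‖ ^ 2 - lam * ‖N0 y‖ ^ 2 ≤
      form2Re (A y) (X y) (X y + (2 * s y) • Y y) - l / 16 * ‖X y‖ ^ 2 +
        (8 * (64 * Fb * S) ^ 2 / l + 32 * Fb + 4 * l) * ‖Z y‖ ^ 2 := by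
    filter_upwards [hA.ae_norm_form2_le] with y hy
    exact pointwise_form_inequality (form2Re (A y))
      (fun x z => by
        rw [form2Re_apply]; exact (Complex.abs_re_le_norm _).trans (hy x z))
      hFb0 hl hmup hS (hP.σ_le _) (hP.σ_eq _) (hP.partition _) (hP.deriv_c1 _)
      (hP.deriv_c0 _) hε1 hε hl1 hl0 (X y) (Y y) (Z y) (hYX y) (hX2 y)
  have sqint : ∀ {H : Pt n → Tens n m}, MemLp H 2 (volume.restrict Ω) →
      Integrable (fun y => ‖H y‖ ^ 2) (volume.restrict Ω) := fun h => h.integrable_norm_pow (by norm_num)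
  have LXY : MemLp (fun y => X y + (2 * s y) • Y y) 2 (volume.restrict Ω) := by
    have := LX.add (LsY.const_smul (2 : ℝ))
    refine this.ae_eq (Eventually.of_forall fun y => ?_)
    simp [smul_smul]
  have iE1 : Integrable (fun y => form2Re (A y) (N1 y - mup • Q1 y) (N1 y + mup • Q1 y))
      (volume.restrict Ω) :=
    hA.integrable_form2Re (LN1.sub (LQ1.const_smul mup)) (LN1.add (LQ1.const_smul mup))
  have iE0 := hA.integrable_form2Re LN0 LN0
  have iJ : Integrable (fun y => (mup * c0 (ℓ y) * c1 (ℓ y) * (1 + s y)) ^ 2 *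
      form2Re (A y) (Y y) (Y y)) (volume.restrict Ω) := by
    obtain ⟨C, hC0, hC, -⟩ := (((hcst.mul hP.prof_c0).mul hP.prof_c1).mul hone).exists_bound
    refine (hA.integrable_form2Re LY LY).bdd_mul (c := C ^ 2) ?_
      (Eventually.of_forall fun y => ?_)
    · exact (((((hcst.mul hP.prof_c0).mul hP.prof_c1).mul
        hone).contDiff.continuous.comp_aestronglyMeasurable mℓ).pow 2)
    · rw [norm_pow]
      exact pow_le_pow_left₀ (norm_nonneg _) (hC _) 2
  have iF := hA.integrable_form2Re LX LXY
  have main := integral_mono_ae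
    ((((iE1.add iE0).add iJ).sub ((sqint LN1).const_mul lamp)).sub ((sqint LN0).const_mul lam))
    ((iF.sub ((sqint LX).const_mul (l / 16))).add
      ((sqint LZ).const_mul (8 * (64 * Fb * S) ^ 2 / l + 32 * Fb + 4 * l))) pw
  rw [integral_sub' (((iE1.add iE0).add iJ).sub ((sqint LN1).const_mul lamp))
    ((sqint LN0).const_mul lam), integral_sub' ((iE1.add iE0).add iJ)
    ((sqint LN1).const_mul lamp), integral_add' (iE1.add iE0) iJ, integral_add' iE1 iE0,
    integral_const_mul, integral_const_mul,
    integral_add' (iF.sub ((sqint LX).const_mul (l / 16))) ((sqint LZ).const_mul _),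
    integral_sub' iF ((sqint LX).const_mul _), integral_const_mul, integral_const_mul] at main
  -- the equation
  obtain ⟨LV, hV⟩ := W.hardy hsub hCH hardy
  have hη2 : IsTest O (fun y => η y * η y) :=
    ⟨hη.1.mul hη.1, hη.2.1.mul_right, (tsupport_mul_subset_left).trans hη.2.2⟩
  -- The equation is tested with η²f²U. Its gradient is g(X + 2σY + 2Z) with g = ηf, and shifting
  -- the real factor g to the other argument gives the form in X that appears in the pointwise
  -- inequality.
  have W2 := hU.radial_real (hP.prof_f.mul hP.prof_f) hη2
  have heq2 := integral_form_eq_zero_of_w0On hA hB hK hCH hardy hU.2.1 heq W2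
  have hd : ∀ τ, deriv (fun τ => f τ * f τ) τ = 2 * σ τ * f τ * f τ := fun τ => by
    have : deriv (fun τ => f τ * f τ) τ = _ :=
      ((hP.prof_f.hasDerivAt τ).mul (hP.prof_f.hasDerivAt τ)).deriv
    rw [this, hP.deriv_f]; ring
  have hpd : ∀ i y, pderiv i (fun y => η y * η y) y = 2 * η y * pderiv i η y := fun i y => by
    have h1 := (hη.1.differentiable (by simp) y).hasFDerivAt
    have h2 : fderiv ℝ (fun y => η y * η y) y = _ := (h1.mul h1).fderiv
    simp only [pderiv, h2, add_apply, smul_apply, smul_eq_mul]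
    ring
  have hgr : ∀ y, (η y * η y * (f (logNorm a (U y)) * f (logNorm a (U y)))) • GU y +
      (η y * η y * deriv (fun τ => f τ * f τ) (logNorm a (U y))) • radialPart (U y) (GU y) +
      tensor (fun h => f (logNorm a (U y)) * f (logNorm a (U y)) *
        pderiv h (fun y => η y * η y) y) (U y) =
      g y • (X y + (2 * s y) • Y y + (2 : ℝ) • Z y) := by
    intro y
    ext i
    simp only [hX, hY, hZ, hs, hg, hR, hd, hpd, PiLp.add_apply, PiLp.smul_apply, tensor_apply,
        Complex.real_smul, hℓ]
    push_cast; ring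
  simp only [hgr] at heq2
  have hvv : ∀ y, (η y * η y * (f (logNorm a (U y)) * f (logNorm a (U y)))) • U y =
      (g y * g y) • U y := fun y => by
    simp only [hg, hℓ]; congr 1; ring
  have hf2 : ∀ y, form2 (A y) (GU y) (g y • (X y + (2 * s y) • Y y + (2 : ℝ) • Z y)) =
      form2 (A y) (X y) (X y + (2 * s y) • Y y + (2 : ℝ) • Z y) := by
    intro y
    simp only [hX, form2]
    refine Finset.sum_congr rfl fun _ _ => Finset.sum_congr rfl fun _ _ =>
      Finset.sum_congr rfl fun _ _ => Finset.sum_congr rfl fun _ _ => ?_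
    simp only [PiLp.smul_apply, Complex.real_smul, map_mul, Complex.conj_ofReal]
    ring
  simp only [hvv, form1_smul_left_right, hf2] at heq2
  have LXYZ : MemLp (fun y => X y + (2 * s y) • Y y + (2 : ℝ) • Z y) 2 (volume.restrict Ω) :=
    LXY.add (LZ.const_smul (2 : ℝ))
  have i2 := hA.integrable_form2 LX LXYZ
  have i1 : Integrable (fun y => form1 (B y) (g y • GU y) (g y • U y)) (volume.restrict Ω) :=
    hB.integrable_form1 LX W.1.1 LV
  rw [integral_sub i2 i1, sub_eq_zero] at heq2
  have heq3 : ∫ y in Ω, form2Re (A y) (X y) (X y + (2 * s y) • Y y + (2 : ℝ) • Z y) =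
      ∫ y in Ω, (form1 (B y) (g y • GU y) (g y • U y)).re := by
    rw [← hA.re_integral_form2 LX LXYZ, heq2]
    exact (integral_re i1).symm
  set V : Pt n → ℝ := fun y => ‖g y • U y‖ / Metric.infDist y (frontier Ω) with hVdef
  have sqV : Integrable (fun y => V y ^ 2) (volume.restrict Ω) := LV.integrable_sq
  set c : ℝ := n * m ^ 2 * K with hc
  have hc0 : 0 ≤ c := by positivity
  have hle := integral_mono_ae (iF.add (i1.re.sub (hA.integrable_form2Re LX LXYZ)))
    ((((sqint LX).const_mul (l / 64 + c / 2)).add ((sqint LZ).const_mul (64 * Fb ^ 2 / l))).add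
      (sqV.const_mul (c / 2))) (by
    filter_upwards [hA.ae_norm_form2_le, hB.ae_norm_form1_le] with y hy1 hy2
    have b1 : -form2Re (A y) (X y) (Z y) ≤ Fb * ‖X y‖ * ‖Z y‖ := by
      rw [form2Re_apply]
      exact (neg_le_abs _).trans ((Complex.abs_re_le_norm _).trans (hy1 _ _))
    have b2 : (form1 (B y) (g y • GU y) (g y • U y)).re ≤ c * ‖X y‖ * V y :=
      (Complex.re_le_norm _).trans (hy2 _ _)
    have b3 : 2 * (Fb * ‖X y‖ * ‖Z y‖) ≤ l / 64 * ‖X y‖ ^ 2 + 64 * Fb ^ 2 / l * ‖Z y‖ ^ 2 := by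
      have h1 : l / 64 * ‖X y‖ ^ 2 + 64 * Fb ^ 2 / l * ‖Z y‖ ^ 2 - 2 * (Fb * ‖X y‖ * ‖Z y‖) =
          (l * ‖X y‖ - 64 * Fb * ‖Z y‖) ^ 2 / (64 * l) := by field_simp; ring
      have h2 : 0 ≤ (l * ‖X y‖ - 64 * Fb * ‖Z y‖) ^ 2 / (64 * l) := by positivity
      linarith
    have b4 : c * ‖X y‖ * V y ≤ c / 2 * ‖X y‖ ^ 2 + c / 2 * V y ^ 2 := by
      linarith [mul_nonneg hc0 (sq_nonneg (‖X y‖ - V y))]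
    simp only [Pi.add_apply, Pi.sub_apply, map_add, map_smul, smul_eq_mul]
    change _ + ((form1 (B y) (g y • GU y) (g y • U y)).re - _) ≤ _
    linarith)
  rw [integral_add' iF (i1.re.sub (hA.integrable_form2Re LX LXYZ)),
    integral_sub' i1.re (hA.integrable_form2Re LX LXYZ), heq3,
    integral_add' (((sqint LX).const_mul (l / 64 + c / 2)).add
      ((sqint LZ).const_mul (64 * Fb ^ 2 / l))) (sqV.const_mul (c / 2)),
    integral_add' ((sqint LX).const_mul (l / 64 + c / 2))
      ((sqint LZ).const_mul (64 * Fb ^ 2 / l)),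
    integral_const_mul, integral_const_mul, integral_const_mul] at hle
  have hΓ : ∀ y, ‖X y + s y • Y y + Z y‖ ≤ (1 + S) * ‖X y‖ + ‖Z y‖ := fun y => by
    have h1 : ‖s y • Y y‖ ≤ S * ‖X y‖ := by
      rw [norm_smul]
      exact mul_le_mul (hP.σ_le _) (hYX y) (norm_nonneg _) (by linarith)
    have := (norm_add_le (X y + s y • Y y) (Z y)).trans
      (add_le_add_left (norm_add_le (X y) (s y • Y y)) _)
    linarith
  have hIΓ : ∫ y in Ω, ‖X y + s y • Y y + Z y‖ ^ 2 ≤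
      2 * (1 + S) ^ 2 * (∫ y in Ω, ‖X y‖ ^ 2) + 2 * ∫ y in Ω, ‖Z y‖ ^ 2 := by
    rw [← integral_const_mul, ← integral_const_mul, ← integral_add ((sqint LX).const_mul _)
      ((sqint LZ).const_mul _)]
    refine integral_mono (sqint LΓ) (((sqint LX).const_mul _).add ((sqint LZ).const_mul _))
      fun y => ?_
    have h1 := pow_le_pow_left₀ (norm_nonneg _) (hΓ y) 2
    linarith [sq_nonneg ((1 + S) * ‖X y‖ - ‖Z y‖)]
  refine ⟨fun y => X y + s y • Y y + Z y, W, hΓ, LX, LZ, ?_⟩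
  set IX := ∫ y in Ω, ‖X y‖ ^ 2 with hIX
  set IZ := ∫ y in Ω, ‖Z y‖ ^ 2 with hIZ
  have hIX0 : 0 ≤ IX := integral_nonneg fun y => sq_nonneg _
  have hIZ0 : 0 ≤ IZ := integral_nonneg fun y => sq_nonneg _
  have hre : ∫ y in Ω, RCLike.re (form1 (B y) (g y • GU y) (g y • U y)) =
    ∫ y in Ω, (form1 (B y) (g y • GU y) (g y • U y)).re := rfl
  rw [hre, sub_self, add_zero] at hle
  have hVI : c / 2 * ∫ y in Ω, V y ^ 2 ≤
      c / 2 * (CH * (2 * (1 + S) ^ 2 * IX + 2 * IZ)) := by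
    gcongr
    exact hV.trans (by gcongr)
  have hCHS : 2 * CH ≤ 2 * CH * (1 + S) ^ 2 := by
    have : (1 : ℝ) ≤ (1 + S) ^ 2 := one_le_pow₀ (by linarith)
    linarith [mul_le_mul_of_nonneg_left this (mul_nonneg zero_le_two hCH)]
  have k1 : c / 2 * IX + c / 2 * (CH * (2 * (1 + S) ^ 2 * IX)) ≤ l / 64 * IX := by
    have := mul_le_mul_of_nonneg_right hKs hIX0
    linarith
  have k2 : c / 2 * (CH * (2 * IZ)) ≤ l / 32 * IZ := by
    have h1 : c * (2 * CH) ≤ l / 32 := by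
      refine le_trans ?_ hKs
      gcongr
      linarith
    have := mul_le_mul_of_nonneg_right h1 hIZ0
    linarith [mul_nonneg (mul_nonneg hc0 hCH) hIZ0]
  -- From the coercive l/16, the cross term between X and Z takes l/64 and the drift takes l/64 by
  -- `hKs`.
  have fin : l / 32 * IX ≤ (8 * (64 * Fb * S) ^ 2 / l + 32 * Fb + 4 * l +
          64 * Fb ^ 2 / l + l / 32) * IZ := by
    linarith
  have : IX = 32 / l * (l / 32 * IX) := by field_simp
  rw [this, mul_assoc]
  gcongr

end PEllipticSystem

namespace PEllipticSystem
open Filter Topology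

variable {n m : ℕ} {Ω : Set (Pt n)} {A : Pt n → Coeff2 n m} {B : Pt n → Coeff1 n m} {Λ : ℝ}

/-! ### Truncated powers with a prescribed exponent -/

/-- `q` lies between `2` and `p`. -/
def BetweenTwo (p q : ℝ) : Prop := (2 ≤ q ∧ q ≤ p) ∨ (p ≤ q ∧ q ≤ 2)

lemma BetweenTwo.pos {p q : ℝ} (hp : 1 < p) (h : BetweenTwo p q) : 0 < q := by
  rcases h with h | h <;> linarith [h.1]

lemma abs_one_sub_two_div_lt {p : ℝ} (hp : 1 < p) : |1 - 2 / p| < 1 := by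
  have h1 : 0 < 2 / p := by positivity
  have h2 : 2 / p < 2 := by rw [div_lt_iff₀ (by linarith)]; linarith
  rw [abs_lt]; constructor <;> linarith

/-- With θ = (1 - 2/q)/(1 - 2/p) the plateau value of σ is (1 - 2/q)/(2/q) = (q - 2)/2, and θ ∈
[0,1] since q lies between 2 and p. The case q = 2 is separate: θ may be 0/0, and the tail bound
e^{-|q-2|M} does not decay, so f = 1 is taken. -/
lemma exists_slowPower_exponent {p q ε M : ℝ} (hp : 1 < p) (hq : BetweenTwo p q) (hε : 0 < ε)
    (hM : 0 < M) : ∃ (a : ℝ) (f c1 c0 σ : ℝ → ℝ),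
      SlowPower (1 - 2 / p) (1 / (1 - |1 - 2 / p|)) ε (q - 2) M a f c1 c0 σ ∧
      (q = 2 → ∀ τ, f τ = 1) := by
  have hmup := abs_one_sub_two_div_lt hp
  have hq0 := hq.pos hp
  rcases eq_or_ne q 2 with rfl | hq2
  · have hcst : ∀ c : ℝ, IsProfile M fun _ : ℝ => c := fun c =>
      { contDiff := contDiff_const, left := fun _ _ => rfl, right := fun _ _ => rfl }
    refine ⟨M, fun _ => 1, fun _ => 0, fun _ => 1, fun _ => 0,
      { prof_f := hcst 1, prof_c1 := hcst 0, prof_c0 := hcst 1, prof_σ := hcst 0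
        f_pos := fun _ => one_pos
        deriv_f := fun _ => by simp
        c1_nonneg := fun _ => le_rfl
        partition := fun _ => by norm_num
        deriv_c1 := fun _ => by simpa using hε.le
        deriv_c0 := fun _ => by simpa using hε.le
        σ_eq := fun _ => by ring
        σ_le := fun _ => by
          rw [abs_zero]
          exact div_nonneg zero_le_one (by linarith)
        c1_far := fun _ _ => rfl
        le_a := le_rfl
        f_sq_eq := fun _ _ => by simp
        f_sq_le := fun _ => by simp }, fun _ _ => rfl⟩
  · have hpq : p ≠ 2 := by
      rintro rfl
      rcases hq with h | h <;> exact hq2 (by linarith)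
    have hp0 : p ≠ 0 := by linarith
    have hm : 1 - 2 / p ≠ 0 := by
      intro h
      have : 2 / p = 1 := by linarith
      rw [div_eq_one_iff_eq hp0] at this
      exact hpq this.symm
    set θ := (1 - 2 / q) / (1 - 2 / p) with hθ
    have hθm : (1 - 2 / p) * θ = 1 - 2 / q := by rw [hθ]; field_simp
    have hθ01 : 0 ≤ θ ∧ θ ≤ 1 := by
      rcases hq with ⟨h1, h2⟩ | ⟨h1, h2⟩
      · have e1 : 2 / q ≤ 1 := by rw [div_le_one hq0]; exact h1
        have e2 : 2 / p ≤ 2 / q := by gcongr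
        exact ⟨div_nonneg (by linarith) (by linarith), div_le_one_of_le₀ (by linarith) (by linarith)⟩
      · have e1 : 1 ≤ 2 / q := by rw [one_le_div hq0]; exact h2
        have e2 : 2 / q ≤ 2 / p := by gcongr
        exact ⟨div_nonneg_of_nonpos (by linarith) (by linarith),
          div_le_one_of_ge (by linarith) (by linarith)⟩
    obtain ⟨a, f, c1, c0, σ, h⟩ := exists_slowPower hmup hθ01.1 hθ01.2 hε hM
    rw [hθm] at h
    have hβ : 2 * ((1 - 2 / q) / (1 - (1 - 2 / q))) = q - 2 := by
      field_simp; ring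
    rw [hβ] at h
    exact ⟨a, f, c1, c0, σ, h, fun h2 => absurd h2 hq2⟩

section SlowPower
variable {mup S ε q M a : ℝ} {f c1 c0 σ : ℝ → ℝ}

lemma SlowPower.apply_logNorm (hP : SlowPower mup S ε (q - 2) M a f c1 c0 σ) {z : Val m}
    (hz : z ≠ 0) : f (logNorm a z) = f (Real.log ‖z‖) := by
  have := hP.prof_f.ofReal.apply_logNorm hz
  exact_mod_cast this

lemma exp_mul_log_norm {z : Val m} (hz : z ≠ 0) (b : ℝ) :
    Real.exp (b * Real.log ‖z‖) = ‖z‖ ^ b := by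
  rw [Real.rpow_def_of_pos (norm_pos_iff.2 hz), mul_comm]

lemma SlowPower.sq_eq_rpow (hP : SlowPower mup S ε (q - 2) M a f c1 c0 σ) {z : Val m}
    (hz : z ≠ 0) (hM : |Real.log ‖z‖| ≤ M) : f (logNorm a z) ^ 2 = ‖z‖ ^ (q - 2) := by
  rw [hP.apply_logNorm hz, hP.f_sq_eq _ hM, exp_mul_log_norm hz]

lemma norm_rpow_sub_two_mul_sq {z : Val m} (hq : 0 < q) :
    ‖z‖ ^ (q - 2) * ‖z‖ ^ 2 = ‖z‖ ^ q := by
  rcases eq_or_ne z 0 with rfl | hz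
  · simp [Real.zero_rpow hq.ne']
  · rw [← Real.rpow_natCast, ← Real.rpow_add (norm_pos_iff.2 hz)]
    simp

lemma SlowPower.sq_mul_norm_sq_le (hP : SlowPower mup S ε (q - 2) M a f c1 c0 σ) (hq : 0 < q)
    (z : Val m) : f (logNorm a z) ^ 2 * ‖z‖ ^ 2 ≤
      ‖z‖ ^ q + Real.exp (-(|q - 2| * M)) * ‖z‖ ^ 2 := by
  rcases eq_or_ne z 0 with rfl | hz
  · simp [Real.zero_rpow hq.ne']
  · rw [hP.apply_logNorm hz, ← norm_rpow_sub_two_mul_sq hq, ← exp_mul_log_norm hz, ← add_mul]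
    gcongr
    exact hP.f_sq_le _

end SlowPower

/-! ### Localization of a solution -/

lemma form2_zero_right (a : Coeff2 n m) (ξ : Tens n m) : form2 a ξ 0 = 0 := by simp [form2]

lemma form1_zero_right (b : Coeff1 n m) (ξ : Tens n m) : form1 b ξ 0 = 0 := by simp [form1]

/-- Multiplying u by a cut-off equal to 1 on the smaller ball gives a function in W^{1,2}_0(Ω) by
the trace condition. On that ball it has the same values and gradient as u, so it satisfies the
equation for test functions supported there. -/
lemma IsWeakSolution.exists_localization {u : Pt n → Val m} {G : Pt n → Tens n m} {x : Pt n}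
    {t R : ℝ} (hΩ : IsOpen Ω) (hu : IsWeakSolution Ω A B u G)
    (htr : HasZeroTraceOn Ω (Metric.ball x R) u) (ht0 : 0 ≤ t) (ht : t < R) :
    ∃ U GU, W0On Ω Ω U GU ∧ (∀ y ∈ Metric.ball x t, U y = u y) ∧
      (∀ᵐ y ∂(volume.restrict Ω), y ∈ Metric.ball x t → GU y = G y) ∧
      ∀ v : Pt n → Val m, IsTest (Ω ∩ Metric.ball x t) v →
        ∫ y in Ω, (form2 (A y) (GU y) (grad v y) - form1 (B y) (GU y) (v y)) = 0 := by
  obtain ⟨C, -, hC⟩ := exists_cutoff n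
  obtain ⟨ζ, hζ, -, -, hζ1, -⟩ := hC x t R ht0 ht
  obtain ⟨GU, hGU⟩ := htr ζ hζ
  have hW := hGU.w0On
  have hUu : ∀ y ∈ Metric.ball x t, ζ y • u y = u y := fun y hy => by rw [hζ1 y hy, one_smul]
  have hG := hu.1.gradient_ae_eq hW le_rfl hΩ Metric.isOpen_ball hUu
  refine ⟨_, GU, hW, hUu, hG, fun v hv => ?_⟩
  rw [← hu.2 v (hv.mono Set.inter_subset_left)]
  refine integral_congr_ae ?_
  filter_upwards [hG] with y hy
  by_cases hyB : y ∈ Metric.ball x t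
  · simp only [hy hyB]
  · have h1 : y ∉ Ω ∩ Metric.ball x t := fun h => hyB h.2
    simp only [hv.eq_zero h1, hv.grad_eq_zero h1, form2_zero_right, form1_zero_right]

/-! ### The truncated estimates -/

lemma ofReal_integral_norm_sq {E : Type*} [NormedAddCommGroup E] {μ : Measure (Pt n)}
    {f : Pt n → E} (hf : MemLp f 2 μ) :
    ENNReal.ofReal (∫ y, ‖f y‖ ^ 2 ∂μ) = ∫⁻ y, ENNReal.ofReal (‖f y‖ ^ 2) ∂μ :=
  ofReal_integral_eq_lintegral_ofReal (hf.integrable_norm_pow (by norm_num))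
    (Eventually.of_forall fun _ => sq_nonneg _)

/-- Estimates for truncated powers, uniform in the truncation. -/
lemma exists_truncated_estimate (n m : ℕ) {p lam lamp CH : ℝ} (Λ : ℝ) (hp : 1 < p)
    (hlam : 0 < lam) (hlamp : 0 < lamp) (hCH : 0 ≤ CH) :
    ∃ K : ℝ, 0 < K ∧ ∃ C : ℝ, 0 < C ∧ ∀ (Ω : Set (Pt n)) (A : Pt n → Coeff2 n m)
      (B : Pt n → Coeff1 n m), IsOpen Ω → IsBoundedCoeff Ω A Λ → IsDriftBound Ω B K →
      (∀ v : Pt n → Val m, IsTest Ω v →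
        ∫⁻ y, ENNReal.ofReal ((‖v y‖ / Metric.infDist y (frontier Ω)) ^ 2) ≤
          ENNReal.ofReal CH * ∫⁻ y, ENNReal.ofReal (‖grad v y‖ ^ 2)) →
      IsPEllipticWith Ω A 2 lam → IsPEllipticWith Ω A p lamp →
      ∀ (U : Pt n → Val m) (GU : Pt n → Tens n m) (x : Pt n) (s t : ℝ), W0On Ω Ω U GU →
      0 ≤ s → s < t →
      (∀ v : Pt n → Val m, IsTest (Ω ∩ Metric.ball x t) v →
        ∫ y in Ω, (form2 (A y) (GU y) (grad v y) - form1 (B y) (GU y) (v y)) = 0) →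
      ∀ q M : ℝ, BetweenTwo p q → 0 < M →
      ∃ (Φ : Pt n → ℝ) (w : Pt n → Val m) (Γ : Pt n → Tens n m),
        (∀ y, 0 < Φ y) ∧
        (∀ y, Φ y ^ 2 * ‖U y‖ ^ 2 ≤ ‖U y‖ ^ q + Real.exp (-(|q - 2| * M)) * ‖U y‖ ^ 2) ∧
        (∀ y, U y ≠ 0 → |Real.log ‖U y‖| ≤ M → Φ y ^ 2 = ‖U y‖ ^ (q - 2)) ∧
        (q = 2 → ∀ y, Φ y = 1) ∧
        AEStronglyMeasurable Φ (volume.restrict Ω) ∧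
        W0On Ω (Ω ∩ Metric.ball x t) w Γ ∧
        (∀ y ∈ Metric.ball x s, w y = Φ y • U y) ∧
        ∫⁻ y in Ω, ENNReal.ofReal (‖Γ y‖ ^ 2) ≤ ENNReal.ofReal (C / (t - s) ^ 2) *
          ∫⁻ y in Metric.ball x t ∩ Ω, ENNReal.ofReal (Φ y ^ 2 * ‖U y‖ ^ 2) ∧
        ∫⁻ y in Metric.ball x s ∩ Ω, ENNReal.ofReal (Φ y ^ 2 * ‖GU y‖ ^ 2) ≤
          ENNReal.ofReal (C / (t - s) ^ 2) *
          ∫⁻ y in Metric.ball x t ∩ Ω, ENNReal.ofReal (Φ y ^ 2 * ‖U y‖ ^ 2) := by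
  obtain ⟨Cη, hCη0, hCη⟩ := exists_cutoff n
  have hmup := abs_one_sub_two_div_lt hp
  set S := 1 / (1 - |1 - 2 / p|) with hSdef
  have hS : 1 ≤ S := by
    rw [hSdef, one_le_div (by linarith)]
    linarith [abs_nonneg (1 - 2 / p)]
  set Fb := formBound n m Λ with hFb
  have hFb0 : 0 ≤ Fb := formBound_nonneg n m Λ
  set l := min lam lamp with hl
  have hl0 : 0 < l := lt_min hlam hlamp
  -- ε and K are fixed by structural constants alone, before q and M; therefore the estimates
  -- survive the removal of the truncation and K serves all exponents between 2 and p.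
  set ε := min 1 (l / 32 / (64 * Fb * S + 32 * Fb + 4 * l)) with hε
  have hden : 0 < 64 * Fb * S + 32 * Fb + 4 * l := by positivity
  have hε0 : 0 < ε := lt_min one_pos (by positivity)
  have hε2 : ε * (64 * Fb * S + 32 * Fb + 4 * l) ≤ l / 32 := by
    rw [← le_div_iff₀ hden]; exact min_le_right _ _
  set K := l / 32 / (n * m ^ 2 * (1 + 2 * CH * (1 + S) ^ 2) + 1) with hKdef
  have hK0 : 0 < K := by positivity
  have hK : n * m ^ 2 * K * (1 + 2 * CH * (1 + S) ^ 2) ≤ l / 32 := by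
    have h1 : K * (n * m ^ 2 * (1 + 2 * CH * (1 + S) ^ 2) + 1) = l / 32 := by
      rw [hKdef]; field_simp
    linarith
  set C₁ := 32 / l * (8 * (64 * Fb * S) ^ 2 / l + 32 * Fb + 4 * l + 64 * Fb ^ 2 / l + l / 32)
    with hC₁
  have hC₁0 : 0 ≤ C₁ := by positivity
  set C₂ := 2 * (1 + S) ^ 2 * C₁ + 2 with hC₂
  have hC₂0 : 0 ≤ C₂ := by positivity
  have hC12 : C₁ ≤ C₂ := by
    have : 1 ≤ (1 + S) ^ 2 := one_le_pow₀ (by linarith)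
    nlinarith
  refine ⟨K, hK0, C₂ * (n * Cη) ^ 2 + 1, by positivity, ?_⟩
  intro Ω A B hΩ hA hB hardy hell2 hellp U GU x s t hU hs hst heq q M hq hM
  obtain ⟨η, hη, hη0, hη1, hηs, hηd⟩ := hCη x s t hs hst
  obtain ⟨a, f, c1, c0, σ, hP, hf1⟩ := exists_slowPower_exponent hp hq hε0 hM
  obtain ⟨Γ, hW, hΓ, LX, LZ, hXZ⟩ := caccioppoli_slowPower hA hB hK0.le hCH hardy hell2 hellp hl0
    (min_le_left _ _) (min_le_right _ _) hmup.le hS (min_le_left _ _) hε2 hK hP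
    (hM.le.trans hP.le_a) hU heq hη hη0
  rw [← hFb, ← hC₁] at hXZ
  set Φ : Pt n → ℝ := fun y => f (logNorm a (U y)) with hΦ
  set X : Pt n → Tens n m := fun y => (η y * Φ y) • GU y with hX
  set Z : Pt n → Tens n m := fun y => tensor (fun h => Φ y * pderiv h η y) (U y) with hZ
  have mΦ : AEStronglyMeasurable Φ (volume.restrict Ω) :=
    hP.prof_f.contDiff.continuous.comp_aestronglyMeasurable
      ((continuous_logNorm a).comp_aestronglyMeasurable hU.1.1)
  have hts : 0 < t - s := by linarith
  have hZle : ∫⁻ y in Ω, ENNReal.ofReal (‖Z y‖ ^ 2) ≤ ENNReal.ofReal ((n * Cη) ^ 2 / (t - s) ^ 2) *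
      ∫⁻ y in Metric.ball x t ∩ Ω, ENNReal.ofReal (Φ y ^ 2 * ‖U y‖ ^ 2) := by
    rw [← Measure.restrict_restrict Metric.isOpen_ball.measurableSet,
      ← lintegral_indicator Metric.isOpen_ball.measurableSet, ← lintegral_const_mul' _ _ (by simp)]
    refine lintegral_mono fun y => ?_
    by_cases hy : y ∈ Metric.ball x t
    · rw [Set.indicator_of_mem hy, ← ENNReal.ofReal_mul (by positivity)]
      refine ENNReal.ofReal_le_ofReal ?_
      have h1 : ‖Z y‖ ≤ (n * (Φ y * (Cη / (t - s)))) * ‖U y‖ := by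
        refine norm_tensor_le (mul_nonneg (hP.f_pos _).le (by positivity)) (fun h => ?_) _
        rw [abs_mul, abs_of_pos (hP.f_pos _)]
        refine mul_le_mul_of_nonneg_left ?_ (hP.f_pos _).le
        simpa [pderiv] using hηd y (EuclideanSpace.single h (1 : ℝ))
      refine (pow_le_pow_left₀ (norm_nonneg _) h1 2).trans_eq ?_
      field_simp
    · rw [Set.indicator_of_notMem hy, mul_zero]
      have : Z y = 0 := by
        ext i
        simp [hZ, hη.pderiv_eq_zero hy]
      simp [this]
  have hXZ' : ∫⁻ y in Ω, ENNReal.ofReal (‖X y‖ ^ 2) ≤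
      ENNReal.ofReal C₁ * ∫⁻ y in Ω, ENNReal.ofReal (‖Z y‖ ^ 2) := by
    rw [← ofReal_integral_norm_sq LX, ← ofReal_integral_norm_sq LZ, ← ENNReal.ofReal_mul hC₁0]
    exact ENNReal.ofReal_le_ofReal hXZ
  have hΓZ : ∫⁻ y in Ω, ENNReal.ofReal (‖Γ y‖ ^ 2) ≤
      ENNReal.ofReal C₂ * ∫⁻ y in Ω, ENNReal.ofReal (‖Z y‖ ^ 2) := by
    rw [← ofReal_integral_norm_sq hW.2.1, ← ofReal_integral_norm_sq LZ, ← ENNReal.ofReal_mul hC₂0]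
    refine ENNReal.ofReal_le_ofReal ?_
    have iX := LX.integrable_norm_pow (p := 2) (by norm_num)
    have iZ := LZ.integrable_norm_pow (p := 2) (by norm_num)
    calc ∫ y in Ω, ‖Γ y‖ ^ 2 ≤ ∫ y in Ω, (2 * (1 + S) ^ 2 * ‖X y‖ ^ 2 + 2 * ‖Z y‖ ^ 2) := by
          refine integral_mono (hW.2.1.integrable_norm_pow (by norm_num))
            ((iX.const_mul _).add (iZ.const_mul _)) fun y => ?_
          have h1 := pow_le_pow_left₀ (norm_nonneg _) (hΓ y) 2
          linarith [sq_nonneg ((1 + S) * ‖X y‖ - ‖Z y‖)]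
      _ = 2 * (1 + S) ^ 2 * (∫ y in Ω, ‖X y‖ ^ 2) + 2 * ∫ y in Ω, ‖Z y‖ ^ 2 := by
          rw [integral_add (iX.const_mul _) (iZ.const_mul _), integral_const_mul,
            integral_const_mul]
      _ ≤ 2 * (1 + S) ^ 2 * (C₁ * ∫ y in Ω, ‖Z y‖ ^ 2) + 2 * ∫ y in Ω, ‖Z y‖ ^ 2 := by
          gcongr
      _ = _ := by rw [hC₂]; ring
  have comb : ∀ {I : ℝ≥0∞} {c : ℝ}, 0 ≤ c → c ≤ C₂ →
      I ≤ ENNReal.ofReal c * ∫⁻ y in Ω, ENNReal.ofReal (‖Z y‖ ^ 2) →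
      I ≤ ENNReal.ofReal ((C₂ * (n * Cη) ^ 2 + 1) / (t - s) ^ 2) *
        ∫⁻ y in Metric.ball x t ∩ Ω, ENNReal.ofReal (Φ y ^ 2 * ‖U y‖ ^ 2) := by
    intro I c hc0 hc hI
    refine hI.trans ((mul_le_mul_right hZle _).trans ?_)
    rw [← mul_assoc, ← ENNReal.ofReal_mul hc0]
    refine mul_le_mul_left (ENNReal.ofReal_le_ofReal ?_) _
    rw [mul_div_assoc', div_le_div_iff_of_pos_right (by positivity)]
    have := mul_le_mul_of_nonneg_right hc (sq_nonneg (n * Cη))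
    linarith
  refine ⟨Φ, _, Γ, fun y => hP.f_pos _, fun y => hP.sq_mul_norm_sq_le (hq.pos hp) _,
    fun y h1 h2 => hP.sq_eq_rpow h1 h2, fun h y => hf1 h _, mΦ, hW,
    fun y hy => by simp only [hηs y hy, one_mul]; rfl, comb hC₂0 le_rfl hΓZ, ?_⟩
  refine comb hC₁0 hC12 (le_trans ?_ hXZ')
  rw [← Measure.restrict_restrict Metric.isOpen_ball.measurableSet,
      ← lintegral_indicator Metric.isOpen_ball.measurableSet]
  refine lintegral_mono fun y => ?_
  by_cases hy : y ∈ Metric.ball x s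
  · rw [Set.indicator_of_mem hy, hX]
    simp only [hηs y hy, one_mul, norm_smul, mul_pow, Real.norm_eq_abs, sq_abs]
    exact le_rfl
  · rw [Set.indicator_of_notMem hy]
    exact zero_le

end PEllipticSystem

namespace PEllipticSystem
open Filter Topology

variable {n m : ℕ} {Ω : Set (Pt n)} {A : Pt n → Coeff2 n m} {B : Pt n → Coeff1 n m} {Λ : ℝ}

/-! ### Sobolev's inequality -/

lemma eLpNorm_fderiv_le (φ : Pt n → Val m) (p : ℝ≥0∞) (μ : Measure (Pt n)) :
    eLpNorm (fderiv ℝ φ) p μ ≤ ENNReal.ofReal n * eLpNorm (grad φ) p μ :=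
  eLpNorm_le_mul_eLpNorm_of_ae_le_mul (Eventually.of_forall fun y => norm_fderiv_le φ y) p

/-- The Gagliardo–Nirenberg–Sobolev inequality is used from p₀ to 2κ, where 1/p₀ = 1/(2κ) + 1/n,
followed by Hölder's inequality from p₀ to 2 on the ball. The condition κ(n - 2) ≤ n means p₀ ≤ 2.
This route includes n = 2, and Hölder's inequality accounts for the power of r. -/
lemma sobolev_test (hn : 2 ≤ n) (m : ℕ) {κ : ℝ} (hκ : 1 ≤ κ) (hκn : κ * ((n : ℝ) - 2) ≤ n) :
    ∃ C : ℝ, 0 < C ∧ ∀ (x : Pt n) (r : ℝ), 0 < r → ∀ φ : Pt n → Val m,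
      IsTest (Metric.ball x (2 * r)) φ → eLpNorm φ (ENNReal.ofReal (2 * κ)) volume ≤
        ENNReal.ofReal (C * r ^ (1 + n / (2 * κ) - n / 2)) * eLpNorm (grad φ) 2 volume := by
  have hn' : (2 : ℝ) ≤ n := by exact_mod_cast hn
  have hn0 : (0 : ℝ) < n := by linarith
  set q₀ : ℝ := 2 * κ with hq₀
  have hq₀0 : 0 < q₀ := by positivity
  set p₀ : ℝ := (q₀⁻¹ + (n : ℝ)⁻¹)⁻¹ with hp₀
  have hp₀0 : 0 < p₀ := by positivity
  have hp₀1 : 1 ≤ p₀ := by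
    rw [hp₀]
    refine (one_le_inv₀ (by positivity)).2 ?_
    have h1 : q₀⁻¹ ≤ 2⁻¹ := by gcongr; linarith
    have h2 : (n : ℝ)⁻¹ ≤ 2⁻¹ := by gcongr
    linarith
  have hp₀2 : p₀ ≤ 2 := by
    rw [hp₀]
    refine inv_le_of_inv_le₀ (by norm_num) ?_
    have : q₀⁻¹ + (n : ℝ)⁻¹ - 2⁻¹ = (n - κ * (n - 2)) / (2 * κ * n) := by
      rw [hq₀]; field_simp; ring
    have h2 : 0 ≤ (n - κ * ((n : ℝ) - 2)) / (2 * κ * n) := div_nonneg (by linarith) (by positivity)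
    linarith
  set V : ℝ := (volume (Metric.ball (0 : Pt n) 1)).toReal with hV
  have hV0 : 0 ≤ V := ENNReal.toReal_nonneg
  set e : ℝ := 1 / p₀ - 1 / 2 with he
  have he0 : 0 ≤ e := by
    rw [he, sub_nonneg]; gcongr
  set S : ℝ := ((SNormLESNormFDerivOfEqConst (Val m) (volume : Measure (Pt n)) p₀ : ℝ≥0) : ℝ)
    with hS
  have hS0 : 0 ≤ S := NNReal.coe_nonneg _
  refine ⟨S * n * (2 ^ n * V) ^ e + 1, by positivity, fun x r hr φ hφ => ?_⟩
  have hgns := eLpNorm_le_eLpNorm_fderiv_of_eq (μ := (volume : Measure (Pt n)))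
    (hφ.1.of_le (by simp)) hφ.2.1 (p := p₀.toNNReal) (p' := q₀.toNNReal)
    (by simpa using hp₀1) (by simp; omega) (by
      simp only [finrank_euclideanSpace, Fintype.card_fin, NNReal.coe_inv,
        Real.coe_toNNReal _ hq₀0.le, Real.coe_toNNReal _ hp₀0.le]
      rw [hp₀, inv_inv]; ring)
  have hgns' : eLpNorm φ (ENNReal.ofReal q₀) volume ≤
      ENNReal.ofReal S * eLpNorm (fderiv ℝ φ) (ENNReal.ofReal p₀) volume := by
    refine hgns.trans_eq ?_
    congr 1
    simp [hS, Real.coe_toNNReal _ hp₀0.le]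
  have hsupp : Function.support (grad φ) ⊆ Metric.ball x (2 * r) := by
    intro y hy
    by_contra h
    exact hy (hφ.grad_eq_zero h)
  have hball : volume (Metric.ball x (2 * r)) = ENNReal.ofReal (2 ^ n * V * r ^ n) := by
    rw [Measure.addHaar_ball_of_pos _ _ (by positivity), finrank_euclideanSpace, Fintype.card_fin,
      hV, ← ENNReal.ofReal_toReal (measure_ball_lt_top (μ := volume) (x := (0 : Pt n))).ne,
      ← ENNReal.ofReal_mul (by positivity)]
    simp only [ENNReal.toReal_ofReal ENNReal.toReal_nonneg]
    congr 1; ring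
  have hhold : eLpNorm (grad φ) (ENNReal.ofReal p₀) volume ≤
      ENNReal.ofReal ((2 ^ n * V) ^ e * r ^ (1 + n / (2 * κ) - n / 2)) *
        eLpNorm (grad φ) 2 volume := by
    rw [← eLpNorm_restrict_eq_of_support_subset (p := ENNReal.ofReal p₀) (μ := volume) hsupp,
      ← eLpNorm_restrict_eq_of_support_subset (p := 2) (μ := volume) hsupp]
    have := eLpNorm_le_eLpNorm_mul_rpow_measure_univ (μ := volume.restrict (Metric.ball x (2 * r)))
      (p := ENNReal.ofReal p₀) (q := 2) (f := grad φ) (by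
        rw [← ENNReal.ofReal_ofNat]; exact ENNReal.ofReal_le_ofReal hp₀2)
      hφ.continuous_grad.aestronglyMeasurable
    refine this.trans_eq ?_
    rw [mul_comm, Measure.restrict_apply_univ, hball, ENNReal.toReal_ofReal hp₀0.le]
    have h2 : (1 / p₀ - 1 / (2 : ℝ≥0∞).toReal) = e := by simp [he]
    rw [h2, ENNReal.ofReal_rpow_of_nonneg (by positivity) he0,
      Real.mul_rpow (by positivity) (by positivity), ← Real.rpow_natCast r n, ← Real.rpow_mul hr.le]
    congr 5
    rw [he, hp₀, one_div, inv_inv, hq₀]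
    field_simp; ring
  calc eLpNorm φ (ENNReal.ofReal q₀) volume
      ≤ ENNReal.ofReal S * eLpNorm (fderiv ℝ φ) (ENNReal.ofReal p₀) volume := hgns'
    _ ≤ ENNReal.ofReal S * (ENNReal.ofReal n *
        (ENNReal.ofReal ((2 ^ n * V) ^ e * r ^ (1 + n / (2 * κ) - n / 2)) *
        eLpNorm (grad φ) 2 volume)) := by
        gcongr
        exact (eLpNorm_fderiv_le φ _ _).trans (by gcongr)
    _ = ENNReal.ofReal (S * n * (2 ^ n * V) ^ e * r ^ (1 + n / (2 * κ) - n / 2)) *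
        eLpNorm (grad φ) 2 volume := by
        rw [← mul_assoc, ← mul_assoc, ← ENNReal.ofReal_mul hS0, ← ENNReal.ofReal_mul (by positivity)]
        congr 2; ring
    _ ≤ _ := by
        gcongr
        linarith

lemma W0On.sobolev {V : Set (Pt n)} {w : Pt n → Val m} {Γ : Pt n → Tens n m} {κ c : ℝ}
    (hκ : 1 ≤ κ) (hc : 0 ≤ c) (hw : W0On Ω V w Γ) (hVΩ : V ⊆ Ω)
    (hsob : ∀ φ : Pt n → Val m, IsTest V φ → eLpNorm φ (ENNReal.ofReal (2 * κ)) volume ≤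
        ENNReal.ofReal c * eLpNorm (grad φ) 2 volume) :
    (∫⁻ y in Ω, ENNReal.ofReal (‖w y‖ ^ (2 * κ))) ^ (1 / κ) ≤
      ENNReal.ofReal (c ^ 2) * ∫⁻ y in Ω, ENNReal.ofReal (‖Γ y‖ ^ 2) := by
  obtain ⟨hw1, hΓ, φ, hφ, -, h2, h3⟩ := hw
  have hκ0 : 0 < κ := by linarith
  have hgr : ∀ k, eLpNorm (grad (φ k)) 2 volume = eLpNorm (grad (φ k)) 2 (volume.restrict Ω) :=
    fun k => by
    refine (eLpNorm_restrict_eq_of_support_subset fun y hy => ?_).symm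
    by_contra h
    exact hy ((hφ k).grad_eq_zero fun h' => h (hVΩ h'))
  have hb : ∀ k, eLpNorm (φ k) (ENNReal.ofReal (2 * κ)) (volume.restrict Ω) ≤
      ENNReal.ofReal c * (eLpNorm Γ 2 (volume.restrict Ω) +
        eLpNorm (fun y => Γ y - grad (φ k) y) 2 (volume.restrict Ω)) := fun k => by
    refine (eLpNorm_mono_measure _ Measure.restrict_le_self).trans ((hsob _ (hφ k)).trans ?_)
    rw [hgr]
    gcongr
    have h : grad (φ k) = Γ - fun y => Γ y - grad (φ k) y := by ext1 y; simp
    calc eLpNorm (grad (φ k)) 2 (volume.restrict Ω)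
        = eLpNorm (Γ - fun y => Γ y - grad (φ k) y) 2 (volume.restrict Ω) := by rw [← h]
      _ ≤ _ := eLpNorm_sub_le hΓ.1 (hΓ.1.sub ((hφ k).memLp_grad 2 Ω).1) (by norm_num)
  have hlim : Tendsto (fun k => ENNReal.ofReal c * (eLpNorm Γ 2 (volume.restrict Ω) +
        eLpNorm (fun y => Γ y - grad (φ k) y) 2 (volume.restrict Ω))) atTop
      (𝓝 (ENNReal.ofReal c * (eLpNorm Γ 2 (volume.restrict Ω) + 0))) :=
    ENNReal.Tendsto.const_mul (tendsto_const_nhds.add h2) (Or.inr ENNReal.ofReal_ne_top)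
  rw [add_zero] at hlim
  have key : eLpNorm w (ENNReal.ofReal (2 * κ)) (volume.restrict Ω) ≤
      ENNReal.ofReal c * eLpNorm Γ 2 (volume.restrict Ω) := by
    refine (Lp.eLpNorm_lim_le_liminf_eLpNorm (fun k => ((hφ k).memLp 2 Ω).1) w h3).trans ?_
    refine (liminf_le_liminf (Eventually.of_forall hb)).trans_eq hlim.liminf_eq
  have e1 : (∫⁻ y in Ω, ENNReal.ofReal (‖w y‖ ^ (2 * κ))) ^ (1 / κ) =
      eLpNorm w (ENNReal.ofReal (2 * κ)) (volume.restrict Ω) ^ 2 := by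
    rw [eLpNorm_eq_lintegral_rpow_enorm_toReal (by simpa using hκ0) ENNReal.ofReal_ne_top,
      ENNReal.toReal_ofReal (by positivity), ← ENNReal.rpow_natCast, ← ENNReal.rpow_mul]
    congr 1
    · refine lintegral_congr fun y => ?_
      rw [← ofReal_norm, ENNReal.ofReal_rpow_of_nonneg (norm_nonneg _) (by positivity)]
    · push_cast; field_simp
  rw [e1, lintegral_ofReal_norm_sq, ENNReal.ofReal_pow hc, ← mul_pow]
  exact pow_le_pow_left₀ zero_le key 2

/-! ### Removing the truncation -/

/-- A form of Fatou's lemma suited to truncations that coincide with their limit from some index on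
at each point. -/
lemma lintegral_le_of_eventually_le {α : Type*} [MeasurableSpace α] {μ : Measure α}
    {F : α → ℝ≥0∞} {Fk : ℕ → α → ℝ≥0∞} (hm : ∀ k, AEMeasurable (Fk k) μ)
    (h : ∀ᵐ y ∂μ, ∀ᶠ k in atTop, F y ≤ Fk k y) {b : ℕ → ℝ≥0∞} {c : ℝ≥0∞}
    (hb : ∀ k, ∫⁻ y, Fk k y ∂μ ≤ b k) (hlim : Tendsto b atTop (𝓝 c)) : ∫⁻ y, F y ∂μ ≤ c :=
  calc ∫⁻ y, F y ∂μ ≤ ∫⁻ y, liminf (fun k => Fk k y) atTop ∂μ := by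
        refine lintegral_mono_ae ?_
        filter_upwards [h] with y hy
        exact le_liminf_of_le (by isBoundedDefault) hy
    _ ≤ liminf (fun k => ∫⁻ y, Fk k y ∂μ) atTop := lintegral_liminf_le' hm
    _ ≤ liminf b atTop := liminf_le_liminf (Eventually.of_forall hb)
    _ = c := hlim.liminf_eq

/-- The local Caccioppoli inequality and the local gain of integrability. -/
lemma exists_local_estimate (n m : ℕ) {p lam lamp CH : ℝ} (Λ : ℝ) (hp : 1 < p)
    (hlam : 0 < lam) (hlamp : 0 < lamp) (hCH : 0 ≤ CH) :
    ∃ K : ℝ, 0 < K ∧ ∃ C : ℝ, 0 < C ∧ ∀ (Ω : Set (Pt n)) (A : Pt n → Coeff2 n m)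
      (B : Pt n → Coeff1 n m), IsOpen Ω → IsBoundedCoeff Ω A Λ → IsDriftBound Ω B K →
      (∀ v : Pt n → Val m, IsTest Ω v →
        ∫⁻ y, ENNReal.ofReal ((‖v y‖ / Metric.infDist y (frontier Ω)) ^ 2) ≤
          ENNReal.ofReal CH * ∫⁻ y, ENNReal.ofReal (‖grad v y‖ ^ 2)) →
      IsPEllipticWith Ω A 2 lam → IsPEllipticWith Ω A p lamp →
      ∀ (u : Pt n → Val m) (G : Pt n → Tens n m), IsWeakSolution Ω A B u G →
      ∀ (x : Pt n) (s t R : ℝ), HasZeroTraceOn Ω (Metric.ball x R) u → 0 ≤ s → s < t → t < R →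
      ∀ q : ℝ, BetweenTwo p q →
        ∫⁻ y in Metric.ball x s ∩ Ω, ENNReal.ofReal (‖u y‖ ^ (q - 2) * ‖G y‖ ^ 2) ≤
          ENNReal.ofReal (C / (t - s) ^ 2) *
            ∫⁻ y in Metric.ball x t ∩ Ω, ENNReal.ofReal (‖u y‖ ^ q) ∧
        ∀ κ c : ℝ, 1 ≤ κ → 0 ≤ c →
          (∀ φ : Pt n → Val m, IsTest (Ω ∩ Metric.ball x t) φ →
            eLpNorm φ (ENNReal.ofReal (2 * κ)) volume ≤
              ENNReal.ofReal c * eLpNorm (grad φ) 2 volume) →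
          (∫⁻ y in Metric.ball x s ∩ Ω, ENNReal.ofReal (‖u y‖ ^ (q * κ))) ^ (1 / κ) ≤
            ENNReal.ofReal (c ^ 2 * (C / (t - s) ^ 2)) *
              ∫⁻ y in Metric.ball x t ∩ Ω, ENNReal.ofReal (‖u y‖ ^ q) := by
  obtain ⟨K, hK, C, hC, H⟩ := exists_truncated_estimate n m Λ hp hlam hlamp hCH
  refine ⟨K, hK, C, hC, ?_⟩
  intro Ω A B hΩ hA hB hardy hell2 hellp u G hu x s t R htr hs hst htR q hq
  have hq0 := hq.pos hp
  obtain ⟨U, GU, hU, hUu, hGU, heq⟩ := hu.exists_localization hΩ htr (hs.trans hst.le) htR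
  choose Φ w Γ hpos hle hfin hone mΦ hW hws hΓ hX using fun k : ℕ =>
    H Ω A B hΩ hA hB hardy hell2 hellp U GU x s t hU hs hst heq q ((k : ℝ) + 1) hq (by positivity)
  have hsub : Metric.ball x s ⊆ Metric.ball x t := Metric.ball_subset_ball hst.le
  have hms : MeasurableSet (Metric.ball x s ∩ Ω) :=
    (Metric.isOpen_ball.inter hΩ).measurableSet
  have hmt : MeasurableSet (Metric.ball x t ∩ Ω) :=
    (Metric.isOpen_ball.inter hΩ).measurableSet
  have hle_meas : volume.restrict (Metric.ball x s ∩ Ω) ≤ volume.restrict Ω :=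
    Measure.restrict_mono Set.inter_subset_right le_rfl
  set N : ℝ≥0∞ := ∫⁻ y in Metric.ball x t ∩ Ω, ENNReal.ofReal (‖u y‖ ^ q) with hN
  set N2 : ℝ≥0∞ := ∫⁻ y in Metric.ball x t ∩ Ω, ENNReal.ofReal (‖U y‖ ^ 2) with hN2
  have hN2fin : N2 ≠ ⊤ := by
    have h1 : N2 ≤ ∫⁻ y in Ω, ENNReal.ofReal (‖U y‖ ^ 2) :=
      lintegral_mono' (Measure.restrict_mono Set.inter_subset_right le_rfl) le_rfl
    refine (h1.trans_lt ?_).ne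
    rw [lintegral_ofReal_norm_sq]
    exact ENNReal.pow_lt_top hU.1.2
  have hNU : N = ∫⁻ y in Metric.ball x t ∩ Ω, ENNReal.ofReal (‖U y‖ ^ q) :=
    setLIntegral_congr_fun hmt fun y hy => by simp only [hUu y hy.1]
  -- the right-hand sides converge
  obtain ⟨δ, hδ, hδle⟩ : ∃ δ : ℕ → ℝ≥0∞, Tendsto δ atTop (𝓝 0) ∧ ∀ k,
      ∫⁻ y in Metric.ball x t ∩ Ω, ENNReal.ofReal (Φ k y ^ 2 * ‖U y‖ ^ 2) ≤ N + δ k := by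
    rcases eq_or_ne q 2 with rfl | hq2
    · refine ⟨fun _ => 0, tendsto_const_nhds, fun k => ?_⟩
      rw [add_zero, hNU]
      refine lintegral_mono fun y => ?_
      simp [hone k rfl y]
    · refine ⟨fun k => ENNReal.ofReal (Real.exp (-(|q - 2| * ((k : ℝ) + 1)))) * N2, ?_, fun k => ?_⟩
      · have h1 : Tendsto (fun k : ℕ => Real.exp (-(|q - 2| * ((k : ℝ) + 1)))) atTop (𝓝 0) := by
          refine Real.tendsto_exp_neg_atTop_nhds_zero.comp ?_
          refine Tendsto.const_mul_atTop (abs_pos.2 (sub_ne_zero.2 hq2)) ?_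
          exact tendsto_atTop_add_const_right _ _ tendsto_natCast_atTop_atTop
        have h2 := ENNReal.Tendsto.mul_const (ENNReal.tendsto_ofReal h1) (Or.inr hN2fin)
        simpa using h2
      · beta_reduce
        rw [hNU, hN2, ← lintegral_const_mul' _ _ ENNReal.ofReal_ne_top]
        have hmeas : AEMeasurable (fun y => ENNReal.ofReal (‖U y‖ ^ q))
            (volume.restrict (Metric.ball x t ∩ Ω)) :=
          ((hU.1.1.norm.aemeasurable.pow_const q).ennreal_ofReal).mono_measure
            (Measure.restrict_mono Set.inter_subset_right le_rfl)
        rw [← lintegral_add_left' hmeas]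
        refine lintegral_mono fun y => ?_
        rw [← ENNReal.ofReal_mul (Real.exp_nonneg _), ← ENNReal.ofReal_add (by positivity)
          (by positivity)]
        exact ENNReal.ofReal_le_ofReal (hle k y)
  have hev : ∀ y, U y ≠ 0 → ∀ᶠ k : ℕ in atTop, Φ k y ^ 2 = ‖U y‖ ^ (q - 2) := fun y hy => by
    obtain ⟨k₀, hk₀⟩ := exists_nat_ge |Real.log ‖U y‖|
    filter_upwards [eventually_ge_atTop k₀] with k hk
    refine hfin k y hy (hk₀.trans ?_)
    have : (k₀ : ℝ) ≤ k := by exact_mod_cast hk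
    linarith
  have hlim : ∀ c : ℝ, Tendsto (fun k => ENNReal.ofReal c * (N + δ k)) atTop
      (𝓝 (ENNReal.ofReal c * N)) := fun c => by
    have := ENNReal.Tendsto.const_mul (a := ENNReal.ofReal c) (tendsto_const_nhds.add hδ)
      (Or.inr ENNReal.ofReal_ne_top) (b := N + 0)
    simpa using this
  refine ⟨?_, fun κ c hκ hc hsob => ?_⟩
  · have e : ∫⁻ y in Metric.ball x s ∩ Ω, ENNReal.ofReal (‖u y‖ ^ (q - 2) * ‖G y‖ ^ 2) =
        ∫⁻ y in Metric.ball x s ∩ Ω, ENNReal.ofReal (‖U y‖ ^ (q - 2) * ‖GU y‖ ^ 2) := by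
      refine lintegral_congr_ae ?_
      filter_upwards [ae_restrict_mem hms, ae_mono hle_meas hGU] with y hy hy2
      rw [hUu y (hsub hy.1), hy2 (hsub hy.1)]
    rw [e]
    refine lintegral_le_of_eventually_le
      (Fk := fun k y => ENNReal.ofReal (Φ k y ^ 2 * ‖GU y‖ ^ 2)) (fun k => ?_)
      (Eventually.of_forall fun y => ?_) (fun k => (hX k).trans (mul_le_mul_right (hδle k) _))
      (hlim _)
    · exact (((mΦ k).aemeasurable.pow_const 2).mul
        (hU.2.1.1.norm.aemeasurable.pow_const 2)).ennreal_ofReal.mono_measure hle_meas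
    · by_cases hy : U y = 0
      -- At zeros of U, for q ≠ 2, the real power 0^{q-2} is 0 even if q < 2, so the integrand
      -- vanishes there.
      · refine Eventually.of_forall fun k => ENNReal.ofReal_le_ofReal ?_
        rcases eq_or_ne q 2 with hq2 | hq2
        · simp [hone k hq2 y, hq2]
        · rw [hy, norm_zero, Real.zero_rpow (sub_ne_zero.2 hq2), zero_mul]
          positivity
      · filter_upwards [hev y hy] with k hk
        rw [hk]
  · have hκ0 : 0 < κ := by linarith
    have e : ∫⁻ y in Metric.ball x s ∩ Ω, ENNReal.ofReal (‖u y‖ ^ (q * κ)) =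
        ∫⁻ y in Metric.ball x s ∩ Ω, ENNReal.ofReal (‖U y‖ ^ (q * κ)) :=
      setLIntegral_congr_fun hms fun y hy => by simp only [hUu y (hsub hy.1)]
    have hroot : ∀ {a b : ℝ≥0∞}, a ≤ b ^ κ → a ^ (1 / κ) ≤ b := fun {a b} h => by
      have := ENNReal.rpow_le_rpow h (z := 1 / κ) (by positivity)
      rwa [← ENNReal.rpow_mul, mul_one_div_cancel hκ0.ne', ENNReal.rpow_one] at this
    have hroot' : ∀ {a b : ℝ≥0∞}, a ^ (1 / κ) ≤ b → a ≤ b ^ κ := fun {a b} h => by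
      have := ENNReal.rpow_le_rpow h hκ0.le
      rwa [← ENNReal.rpow_mul, one_div_mul_cancel hκ0.ne', ENNReal.rpow_one] at this
    rw [e]
    refine hroot ?_
    refine lintegral_le_of_eventually_le
      (Fk := fun k y => ENNReal.ofReal (‖w k y‖ ^ (2 * κ)))
      (b := fun k => (ENNReal.ofReal (c ^ 2 * (C / (t - s) ^ 2)) * (N + δ k)) ^ κ) (fun k => ?_)
      ?_ (fun k => hroot' ?_) ((ENNReal.continuous_rpow_const.tendsto _).comp (hlim _))
    · exact ((hW k).1.1.norm.aemeasurable.pow_const _).ennreal_ofReal.mono_measure hle_meas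
    · filter_upwards [ae_restrict_mem hms] with y hy
      by_cases h0 : U y = 0
      · refine Eventually.of_forall fun k => ?_
        rw [h0, norm_zero, Real.zero_rpow (by positivity)]
        simp
      · filter_upwards [hev y h0] with k hk
        refine ENNReal.ofReal_le_ofReal (le_of_eq ?_)
        rw [hws k y hy.1, Real.rpow_mul (norm_nonneg _), Real.rpow_mul (norm_nonneg _)]
        congr 1
        rw [norm_smul, Real.norm_of_nonneg (hpos k y).le, Real.rpow_two, mul_pow, hk,
          norm_rpow_sub_two_mul_sq hq0]
    · calc (∫⁻ y in Metric.ball x s ∩ Ω, ENNReal.ofReal (‖w k y‖ ^ (2 * κ))) ^ (1 / κ)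
          ≤ (∫⁻ y in Ω, ENNReal.ofReal (‖w k y‖ ^ (2 * κ))) ^ (1 / κ) := by
            gcongr
        _ ≤ ENNReal.ofReal (c ^ 2) * ∫⁻ y in Ω, ENNReal.ofReal (‖Γ k y‖ ^ 2) :=
            (hW k).sobolev hκ hc Set.inter_subset_left hsob
        _ ≤ ENNReal.ofReal (c ^ 2) * (ENNReal.ofReal (C / (t - s) ^ 2) * (N + δ k)) := by
            gcongr
            exact (hΓ k).trans (mul_le_mul_right (hδle k) _)
        _ = _ := by rw [← mul_assoc, ← ENNReal.ofReal_mul (by positivity)]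

end PEllipticSystem

namespace PEllipticSystem
open Filter Topology

/-! ### From a gain of integrability to a reverse Hölder inequality -/

/-- The sequence H·l^k, with l = lam^{1/(1-γ)} and lBH^γ = H, is a supersolution of the recursion.
The a priori bound X puts Φ below a multiple Y of it; each use of the recursion replaces Y by Y^γ,
and Y^{γ^j} tends to 1. Thus X disappears from the conclusion. -/
lemma le_of_forall_le_mul_rpow {Φ : ℕ → ℝ} {B lam γ X : ℝ} (hΦ : ∀ k, 0 ≤ Φ k)
    (hX : ∀ k, Φ k ≤ X) (hB : 0 ≤ B) (hlam : 1 ≤ lam) (hγ0 : 0 ≤ γ) (hγ : γ < 1)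
    (h : ∀ k, Φ k ≤ B * lam ^ k * Φ (k + 1) ^ γ) :
    Φ 0 ≤ (lam ^ (1 / (1 - γ)) * B) ^ (1 / (1 - γ)) := by
  have h1γ : 0 < 1 - γ := by linarith
  rcases hB.eq_or_lt with rfl | hB
  · have := h 0
    simp only [zero_mul] at this
    exact this.trans (by positivity)
  have hlam0 : 0 < lam := by linarith
  set l := lam ^ (1 / (1 - γ)) with hl
  have hl1 : 1 ≤ l := Real.one_le_rpow hlam (by positivity)
  have hl0 : 0 < l := by linarith
  have hlγ : l ^ (1 - γ) = lam := by
    rw [hl, ← Real.rpow_mul hlam0.le, one_div_mul_cancel h1γ.ne', Real.rpow_one]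
  set H := (l * B) ^ (1 / (1 - γ)) with hH
  have hH0 : 0 < H := by positivity
  have hHγ : H ^ (1 - γ) = l * B := by
    rw [hH, ← Real.rpow_mul (by positivity), one_div_mul_cancel h1γ.ne', Real.rpow_one]
  have hHs : l * B * H ^ γ = H := by
    rw [← hHγ, ← Real.rpow_add hH0]; simp
  set Y := max (X / H) 1 with hY
  have hY1 : 1 ≤ Y := le_max_right _ _
  have key : ∀ j k : ℕ, Φ k ≤ H * l ^ k * Y ^ (γ ^ j) := by
    intro j
    induction j with
    | zero =>
      intro k
      rw [pow_zero, Real.rpow_one]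
      have h1 : X / H ≤ Y := le_max_left _ _
      rw [div_le_iff₀ hH0] at h1
      have h2 : (1 : ℝ) ≤ l ^ k := one_le_pow₀ hl1
      calc Φ k ≤ Y * H := (hX k).trans h1
        _ ≤ Y * H * l ^ k := le_mul_of_one_le_right (by positivity) h2
        _ = _ := by ring
    | succ j ih =>
      intro k
      have hlk : lam ^ k * (l ^ (k + 1)) ^ γ ≤ l * l ^ k := by
        have e1 : lam ^ k = l ^ ((1 - γ) * k) := by
          rw [Real.rpow_mul hl0.le, hlγ, Real.rpow_natCast]
        have e2 : (l ^ (k + 1)) ^ γ = l ^ (((k : ℝ) + 1) * γ) := by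
          rw [Real.rpow_mul hl0.le]; norm_cast
        have e3 : l * l ^ k = l ^ ((k : ℝ) + 1) := by
          rw [Real.rpow_add hl0, Real.rpow_natCast, Real.rpow_one, mul_comm]
        rw [e1, e2, e3, ← Real.rpow_add hl0]
        refine Real.rpow_le_rpow_of_exponent_le hl1 ?_
        linarith
      calc Φ k ≤ B * lam ^ k * Φ (k + 1) ^ γ := h k
        _ ≤ B * lam ^ k * (H * l ^ (k + 1) * Y ^ (γ ^ j)) ^ γ := by
            gcongr
            · exact hΦ _
            · exact ih (k + 1)
        _ = (B * H ^ γ) * (lam ^ k * (l ^ (k + 1)) ^ γ) * Y ^ (γ ^ (j + 1)) := by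
            have e : (Y ^ (γ ^ j)) ^ γ = Y ^ (γ ^ (j + 1)) := by
              rw [← Real.rpow_mul (by positivity), pow_succ]
            rw [Real.mul_rpow (by positivity) (by positivity),
              Real.mul_rpow (by positivity) (by positivity), e]
            ring
        _ ≤ (B * H ^ γ) * (l * l ^ k) * Y ^ (γ ^ (j + 1)) := by gcongr
        _ = (l * B * H ^ γ) * l ^ k * Y ^ (γ ^ (j + 1)) := by ring
        _ = _ := by rw [hHs]
  have hlim : Tendsto (fun j : ℕ => H * l ^ 0 * Y ^ (γ ^ j)) atTop (𝓝 (H * l ^ 0 * Y ^ (0 : ℝ))) := by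
    refine Tendsto.const_mul _ ?_
    exact ((Real.continuous_const_rpow (by positivity)).tendsto 0).comp
      (tendsto_pow_atTop_nhds_zero_of_lt_one hγ0 hγ)
  simp only [pow_zero, mul_one, Real.rpow_zero] at hlim
  exact ge_of_tendsto' hlim fun j => by simpa using key j 0

lemma lintegral_rpow_lt_top_of_le {α : Type*} [MeasurableSpace α] {ν : Measure α} {g : α → ℝ≥0∞}
    {q q' : ℝ} (hν : ν Set.univ < ⊤) (hq0 : 0 ≤ q) (hqq : q ≤ q')
    (h : ∫⁻ y, g y ^ q' ∂ν < ⊤) : ∫⁻ y, g y ^ q ∂ν < ⊤ := by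
  refine lt_of_le_of_lt (lintegral_mono (g := fun y => 1 + g y ^ q') fun y => ?_) ?_
  · rcases le_total (g y) 1 with h1 | h1
    · exact (ENNReal.rpow_le_one h1 hq0).trans le_self_add
    · exact (ENNReal.rpow_le_rpow_of_exponent_le h1 hqq).trans le_add_self
  · rw [lintegral_add_left measurable_const]
    simpa using ⟨hν, h⟩

lemma lintegral_rpow_interpolate {α : Type*} [MeasurableSpace α] {ν : Measure α} {g : α → ℝ≥0∞}
    (hg : AEMeasurable g ν) {P Q τ : ℝ} (hQ : 0 ≤ Q) (hτ0 : 0 ≤ τ) (hτ1 : τ ≤ 1)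
    (hP : P = (1 - τ) + Q * τ) :
    ∫⁻ y, g y ^ P ∂ν ≤ (∫⁻ y, g y ∂ν) ^ (1 - τ) * (∫⁻ y, g y ^ Q ∂ν) ^ τ := by
  have h := ENNReal.lintegral_mul_norm_pow_le hg (hg.pow_const Q) (sub_nonneg.2 hτ1) hτ0 (by ring)
  refine le_trans (le_of_eq (lintegral_congr fun y => ?_)) h
  rw [← ENNReal.rpow_mul, ← ENNReal.rpow_add_of_nonneg _ _ (sub_nonneg.2 hτ1) (mul_nonneg hQ hτ0), hP]

/-- Finitely many gains starting from L² show that the L^Q norm, Q = Pκ, is finite on smaller sets.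
Interpolating L^P between L¹ and L^Q in the last gain bounds the L^Q integral by a power γ = κτ of
itself on a larger set. As 1 - γ = (κ - 1)/(Q - 1) > 0, the recursion over radii closes. -/
lemma exists_reverseHolder_of_gain {P κ C : ℝ} (hP : 2 ≤ P) (hκ : 1 < κ) (hC : 0 ≤ C) :
    ∃ C' : ℝ, 0 < C' ∧ ∀ {α : Type} [MeasurableSpace α] (ν : Measure α) (E : ℝ → Set α)
      (g : α → ℝ≥0∞), Monotone E → AEMeasurable g (ν.restrict (E 2)) → ν (E 2) < ⊤ →
      ∫⁻ y in E 2, g y ^ (2 : ℝ) ∂ν < ⊤ →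
      (∀ q s t : ℝ, 2 ≤ q → q ≤ P → 1 ≤ s → s < t → t ≤ 2 →
        (∫⁻ y in E s, g y ^ (q * κ) ∂ν) ^ (1 / κ) ≤
          ENNReal.ofReal (C / (t - s) ^ 2) * ∫⁻ y in E t, g y ^ q ∂ν) →
      (∫⁻ y in E 1, g y ^ (P * κ) ∂ν) ^ (1 / (P * κ)) ≤
        ENNReal.ofReal C' * ∫⁻ y in E 2, g y ∂ν := by
  have hκ0 : 0 < κ := by linarith
  set Q := P * κ with hQ
  have hQ1 : 1 < Q := by rw [hQ]; nlinarith
  have hPQ : P < Q := by rw [hQ]; nlinarith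
  set τ := (P - 1) / (Q - 1) with hτ
  have hτ0 : 0 ≤ τ := div_nonneg (by linarith) (by linarith)
  have hτ1 : τ < 1 := by rw [hτ, div_lt_one (by linarith)]; linarith
  have hPτ : P = (1 - τ) + Q * τ := by
    have : τ * (Q - 1) = P - 1 := by rw [hτ, div_mul_cancel₀]; linarith
    linarith
  set γ := κ * τ with hγ
  have hγ0 : 0 ≤ γ := by positivity
  have h1γ : 1 - γ = (κ - 1) / (Q - 1) := by
    have h0 : Q - 1 ≠ 0 := by linarith
    rw [hγ, hτ, eq_div_iff h0, sub_mul, one_mul, mul_assoc, div_mul_cancel₀ _ h0, hQ]; ring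
  have hγ1 : γ < 1 := by
    have : 0 < 1 - γ := by rw [h1γ]; exact div_pos (by linarith) (by linarith)
    linarith
  -- Homogeneity: the L¹ norm enters the final bound for the integral of g^Q with exponent exactly
  -- Q.
  have hexp : κ * (1 - τ) * (1 / (1 - γ)) = Q := by
    have h0 : Q - 1 ≠ 0 := by linarith
    have h1 : κ - 1 ≠ 0 := by linarith
    have h2 : 1 - τ = P * (κ - 1) / (Q - 1) := by
      rw [eq_div_iff h0, sub_mul, hτ, div_mul_cancel₀ _ h0, hQ]; ring
    rw [h1γ, h2, hQ]
    rw [hQ] at h0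
    field_simp
    exact div_self (by rwa [mul_comm])
  set C₁ := (((4 : ℝ) ^ κ) ^ (1 / (1 - γ)) * (16 * C) ^ κ) ^ (1 / (1 - γ)) with hC₁
  have hC₁0 : 0 ≤ C₁ := by positivity
  refine ⟨C₁ ^ (1 / Q) + 1, by positivity, ?_⟩
  intro α _ ν E g hE hg hν h2 hgain
  have hmono : ∀ {s t : ℝ} (q : ℝ), s ≤ t → ∫⁻ y in E s, g y ^ q ∂ν ≤ ∫⁻ y in E t, g y ^ q ∂ν :=
    fun q hst => lintegral_mono_set (hE hst)
  have hroot' : ∀ {a b : ℝ≥0∞}, a ^ (1 / κ) ≤ b → a ≤ b ^ κ := fun {a b} h => by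
    have := ENNReal.rpow_le_rpow h hκ0.le
    rwa [← ENNReal.rpow_mul, one_div_mul_cancel hκ0.ne', ENNReal.rpow_one] at this
  have hνs : ∀ {s : ℝ}, s ≤ 2 → (ν.restrict (E s)) Set.univ < ⊤ := fun hs => by
    rw [Measure.restrict_apply_univ]
    exact (measure_mono (hE hs)).trans_lt hν
  have gainfin : ∀ q s t : ℝ, 2 ≤ q → q ≤ P → 1 ≤ s → s < t → t ≤ 2 →
      ∫⁻ y in E t, g y ^ q ∂ν < ⊤ → ∫⁻ y in E s, g y ^ (q * κ) ∂ν < ⊤ := by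
    intro q s t hq hqP hs hst ht hfin
    exact (hroot' (hgain q s t hq hqP hs hst ht)).trans_lt
      (ENNReal.rpow_lt_top_of_nonneg hκ0.le (ENNReal.mul_lt_top ENNReal.ofReal_lt_top hfin).ne)
  -- The exponent is capped at P, the largest for which a gain is available. Each step passes to a
  -- smaller set, so finiteness holds only for s < 2.
  have boot : ∀ k : ℕ, ∀ s : ℝ, 1 ≤ s → s < 2 → ∫⁻ y in E s, g y ^ (min P (2 * κ ^ k)) ∂ν < ⊤ := by
    intro k
    induction k with
    | zero =>
      intro s hs1 hs2
      rw [pow_zero, mul_one, min_eq_right hP]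
      exact (hmono 2 hs2.le).trans_lt h2
    | succ k ih =>
      intro s hs1 hs2
      have hk : (1 : ℝ) ≤ κ ^ k := one_le_pow₀ hκ.le
      have hq2 : 2 ≤ min P (2 * κ ^ k) := le_min hP (by linarith)
      have h1 := gainfin _ s ((s + 2) / 2) hq2 (min_le_left _ _) hs1
        (by linarith) (by linarith) (ih _ (by linarith) (by linarith))
      refine lintegral_rpow_lt_top_of_le (hνs hs2.le) (le_min (by linarith) (by positivity)) ?_ h1
      rw [min_mul_of_nonneg _ _ hκ0.le]
      refine min_le_min hPQ.le (le_of_eq ?_)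
      ring
  obtain ⟨k, hk⟩ := pow_unbounded_of_one_lt P hκ
  have finP : ∀ s : ℝ, 1 ≤ s → s < 2 → ∫⁻ y in E s, g y ^ P ∂ν < ⊤ := fun s hs1 hs2 => by
    have := boot k s hs1 hs2
    rwa [min_eq_left (by linarith)] at this
  have finQ : ∀ s : ℝ, 1 ≤ s → s < 2 → ∫⁻ y in E s, g y ^ Q ∂ν < ⊤ := fun s hs1 hs2 =>
    gainfin P s ((s + 2) / 2) hP le_rfl hs1 (by linarith) (by linarith)
      (finP _ (by linarith) (by linarith))
  set N₁ := ∫⁻ y in E 2, g y ∂ν with hN₁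
  have finN₁ : N₁ < ⊤ := by
    have := lintegral_rpow_lt_top_of_le (q := 1) (hνs le_rfl) zero_le_one (by norm_num) h2
    simpa using this
  -- The radii increase from 1 to 3/2 rather than to 2, to stay where the L^Q integral is known to
  -- be finite. The gaps are 2^{-k}/4, so the gain constants grow like 16C·4^k.
  set t : ℕ → ℝ := fun k => 3 / 2 - (1 / 2) ^ (k + 1) with ht
  have htp : ∀ k : ℕ, 0 < ((1 : ℝ) / 2) ^ k ∧ ((1 : ℝ) / 2) ^ k ≤ 1 := fun k =>
    ⟨by positivity, pow_le_one₀ (by norm_num) (by norm_num)⟩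
  have ht1 : ∀ k, 1 ≤ t k := fun k => by
    simp only [ht, pow_succ]; linarith [htp k]
  have ht2 : ∀ k, t k ≤ 3 / 2 := fun k => by
    simp only [ht]; linarith [htp (k + 1)]
  have htd : ∀ k, t (k + 1) - t k = (1 / 2) ^ k / 4 := fun k => by
    simp only [ht, pow_succ]; ring
  have htlt : ∀ k, t k < t (k + 1) := fun k => by
    have := htd k; linarith [htp k]
  set Φ : ℕ → ℝ := fun k => (∫⁻ y in E (t k), g y ^ Q ∂ν).toReal with hΦ
  have finΦ : ∀ k, ∫⁻ y in E (t k), g y ^ Q ∂ν < ⊤ := fun k =>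
    finQ _ (ht1 k) (by linarith [ht2 k])
  have step : ∀ k, Φ k ≤ ((16 * C) ^ κ * N₁.toReal ^ (κ * (1 - τ))) * ((4 : ℝ) ^ κ) ^ k *
      Φ (k + 1) ^ γ := by
    intro k
    have h1 := hgain P (t k) (t (k + 1)) hP le_rfl (ht1 k) (htlt k) (by linarith [ht2 (k + 1)])
    have h3 := lintegral_rpow_interpolate (ν := ν.restrict (E (t (k + 1))))
      (hg.mono_measure (Measure.restrict_mono (hE (by linarith [ht2 (k + 1)])) le_rfl))
      (by linarith : (0 : ℝ) ≤ Q) hτ0 hτ1.le hPτ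
    have h4 : ∫⁻ y in E (t (k + 1)), g y ∂ν ≤ N₁ :=
      lintegral_mono_set (hE (by linarith [ht2 (k + 1)]))
    have h5 : ∫⁻ y in E (t k), g y ^ Q ∂ν ≤ (ENNReal.ofReal (C / (t (k + 1) - t k) ^ 2) *
        (N₁ ^ (1 - τ) * (∫⁻ y in E (t (k + 1)), g y ^ Q ∂ν) ^ τ)) ^ κ := by
      refine hroot' (h1.trans ?_)
      gcongr
      refine h3.trans ?_
      gcongr
    have hfin : (ENNReal.ofReal (C / (t (k + 1) - t k) ^ 2) *
        (N₁ ^ (1 - τ) * (∫⁻ y in E (t (k + 1)), g y ^ Q ∂ν) ^ τ)) ^ κ ≠ ⊤ := by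
      refine ENNReal.rpow_ne_top_of_nonneg hκ0.le (ENNReal.mul_ne_top ENNReal.ofReal_ne_top
        (ENNReal.mul_ne_top ?_ ?_))
      · exact ENNReal.rpow_ne_top_of_nonneg (by linarith) finN₁.ne
      · exact ENNReal.rpow_ne_top_of_nonneg hτ0 (finΦ _).ne
    have h6 := ENNReal.toReal_mono hfin h5
    refine h6.trans_eq ?_
    rw [← ENNReal.toReal_rpow, ENNReal.toReal_mul, ENNReal.toReal_mul, ← ENNReal.toReal_rpow,
      ← ENNReal.toReal_rpow, ENNReal.toReal_ofReal (by positivity), htd]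
    have e1 : C / (((1 : ℝ) / 2) ^ k / 4) ^ 2 = 16 * C * 4 ^ k := by
      have : ((1 : ℝ) / 2) ^ k = (2 ^ k)⁻¹ := by rw [one_div, inv_pow]
      rw [this, show (4 : ℝ) ^ k = 2 ^ k * 2 ^ k by rw [← mul_pow]; norm_num]
      field_simp; norm_num
    have e2 : ∀ a b : ℝ, 0 ≤ a → 0 ≤ b → (a ^ (1 - τ) * b ^ τ) ^ κ = a ^ (κ * (1 - τ)) * b ^ γ :=
      fun a b ha hb => by
      rw [Real.mul_rpow (by positivity) (by positivity), ← Real.rpow_mul ha, ← Real.rpow_mul hb,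
        mul_comm (1 - τ), mul_comm τ]
    rw [e1, Real.mul_rpow (by positivity) (by positivity), Real.mul_rpow (x := 16 * C)
      (by positivity) (by positivity), e2 _ _ ENNReal.toReal_nonneg ENNReal.toReal_nonneg,
      ← Real.rpow_pow_comm (by norm_num : (0 : ℝ) ≤ 4)]
    ring
  have hres := le_of_forall_le_mul_rpow (Φ := Φ) (X := (∫⁻ y in E (3 / 2), g y ^ Q ∂ν).toReal)
    (fun k => ENNReal.toReal_nonneg)
    (fun k => ENNReal.toReal_mono (finQ _ (by norm_num) (by norm_num)).ne (hmono Q (ht2 k)))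
    (by positivity) (Real.one_le_rpow (by norm_num) hκ0.le) hγ0 hγ1 step
  have hres2 : Φ 0 ≤ C₁ * N₁.toReal ^ Q := by
    refine hres.trans_eq ?_
    rw [← mul_assoc, Real.mul_rpow (by positivity) (by positivity),
      ← Real.rpow_mul ENNReal.toReal_nonneg, hexp]
  have hres3 : ∫⁻ y in E 1, g y ^ Q ∂ν ≤ ENNReal.ofReal C₁ * N₁ ^ Q := by
    have e1 : E 1 = E (t 0) := by congr 1; simp only [ht]; norm_num
    rw [e1, ← ENNReal.ofReal_toReal (finΦ 0).ne, ← ENNReal.ofReal_toReal finN₁.ne,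
      ENNReal.ofReal_rpow_of_nonneg ENNReal.toReal_nonneg (by linarith),
      ← ENNReal.ofReal_mul hC₁0]
    exact ENNReal.ofReal_le_ofReal hres2
  calc (∫⁻ y in E 1, g y ^ Q ∂ν) ^ (1 / Q) ≤ (ENNReal.ofReal C₁ * N₁ ^ Q) ^ (1 / Q) :=
        ENNReal.rpow_le_rpow hres3 (by positivity)
    _ = ENNReal.ofReal (C₁ ^ (1 / Q)) * N₁ := by
        rw [ENNReal.mul_rpow_of_nonneg _ _ (by positivity), ← ENNReal.rpow_mul,
          mul_one_div_cancel (by linarith), ENNReal.rpow_one,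
          ENNReal.ofReal_rpow_of_nonneg hC₁0 (by positivity)]
    _ ≤ _ := by gcongr; linarith

end PEllipticSystem

namespace PEllipticSystem
open Filter Topology

variable {n m : ℕ}

/-! ### Volumes of the pieces of a Lipschitz domain -/

/-- Moving from x by r/2 in direction e gives height at least r/2. The height is Lipschitz with
constant 1 + L, so it loses less than r/4 on the small ball. -/
lemma ball_subset_aboveGraph {L : ℝ≥0} {e x : Pt n} {φ : Pt n → ℝ} {r : ℝ} (he : ‖e‖ = 1)
    (hφ : LipschitzWith L φ) (hx : 0 ≤ height e φ x) (hr : 0 < r) :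
    Metric.ball (x + (r / 2) • e) (r / (4 * (1 + L))) ⊆ aboveGraph e φ ∩ Metric.ball x r := by
  intro y hy
  have hL : (0 : ℝ) < 1 + L := by positivity
  rw [Metric.mem_ball] at hy
  have h1 := height_sub_le he hφ (x + (r / 2) • e) y
  rw [height_add_smul he, dist_comm] at h1
  have h2 : (1 + L) * dist y (x + (r / 2) • e) < r / 4 := by
    rw [lt_div_iff₀ (by positivity)] at hy
    linarith
  refine ⟨mem_aboveGraph.2 (by linarith), ?_⟩
  rw [Metric.mem_ball]
  have h3 : dist (x + (r / 2) • e) x = r / 2 := by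
    rw [dist_eq_norm, add_sub_cancel_left, norm_smul, he, mul_one, Real.norm_of_nonneg (by positivity)]
  have h4 : dist y (x + (r / 2) • e) < r / 4 := by
    have : (0 : ℝ) ≤ L * dist y (x + (r / 2) • e) := by positivity
    linarith
  linarith [dist_triangle y (x + (r / 2) • e) x]

lemma height_nonneg_of_mem_closure {L : ℝ≥0} {e x : Pt n} {φ : Pt n → ℝ}
    (hφ : LipschitzWith L φ) (hx : x ∈ closure (aboveGraph e φ)) : 0 ≤ height e φ x := by
  have hcl : IsClosed {y | 0 ≤ height e φ y} := isClosed_le continuous_const (continuous_height hφ)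
  exact closure_minimal (fun y hy => (mem_aboveGraph.1 hy).le) hcl hx

/-- Interior balls of comparable radius. -/
lemma IsLipschitzDomain.exists_ball_subset {L : ℝ≥0} {D : ℝ} {Ω : Set (Pt n)}
    (hΩ : IsLipschitzDomain L D Ω) {x : Pt n} (hx : x ∈ closure Ω) {r : ℝ} (hr : 0 < r) :
    ∃ r' : ℝ, 0 < r' ∧ r' ≤ r ∧ (r' < r → Ω ⊆ Metric.ball x r') ∧
      ∃ z, Metric.ball z (r' / (32 * max D 1 * (1 + L))) ⊆ Metric.ball x r' ∩ Ω := by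
  have hD : 1 ≤ max D 1 := le_max_right _ _
  have hL : (1 : ℝ) ≤ 1 + L := by simp
  set D' := max D 1 with hD'
  rcases hΩ with ⟨e, φ, he, hφ, rfl⟩ | ⟨hopen, -, hbdd, ρ, hρ, hdiam, hloc⟩
  · refine ⟨r, hr, le_rfl, fun h => absurd h (lt_irrefl _), x + (r / 2) • e, ?_⟩
    rw [Set.inter_comm]
    refine (Metric.ball_subset_ball ?_).trans
      (ball_subset_aboveGraph he hφ (height_nonneg_of_mem_closure hφ hx) hr)
    refine div_le_div_of_nonneg_left hr.le (by positivity) ?_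
    nlinarith
  · have hr'0 : 0 < min r (2 * D' * ρ) := lt_min hr (by positivity)
    -- The diameter of Ω is at most Dρ, so a ball about x of radius 2D'ρ contains Ω and larger radii
    -- change nothing.
    set r' := min r (2 * D' * ρ) with hr'
    refine ⟨r', hr'0, min_le_left _ _, fun h => ?_, ?_⟩
    · have h1 : r' = 2 * D' * ρ := by
        rw [hr', min_def] at h ⊢
        split_ifs at h ⊢ with h2
        · exact absurd h (lt_irrefl _)
        · rfl
      intro y hy
      rw [Metric.mem_ball, h1]
      have h2 : dist y x ≤ Metric.diam (closure Ω) :=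
        Metric.dist_le_diam_of_mem hbdd.closure (subset_closure hy) hx
      rw [Metric.diam_closure] at h2
      have h3 : D * ρ ≤ D' * ρ := by gcongr; exact le_max_left _ _
      have h4 : 0 < D' * ρ := by positivity
      linarith
    -- A radius small enough for the graph representation; r' ≤ 2D'ρ makes it comparable to r'.
    · set r₁ := min r' (ρ / 4) with hr₁
      have hr₁0 : 0 < r₁ := lt_min hr'0 (by positivity)
      have hr₁' : r₁ ≤ r' := min_le_left _ _
      have hr₁ρ : r₁ ≤ ρ / 4 := min_le_right _ _
      have hrad : r' / (32 * D' * (1 + L)) ≤ r₁ / (4 * (1 + L)) := by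
        have h1 : r' / (8 * D') ≤ r₁ := by
          refine le_min ?_ ?_
          · exact div_le_self hr'0.le (by linarith)
          · rw [div_le_iff₀ (by positivity)]
            have : r' ≤ 2 * D' * ρ := min_le_right _ _
            linarith
        calc r' / (32 * D' * (1 + L)) = r' / (8 * D') / (4 * (1 + L)) := by
              rw [div_div]; congr 1; ring
          _ ≤ _ := by gcongr
      by_cases hfr : (Metric.ball x (r₁ / 4) ∩ frontier Ω).Nonempty
      · obtain ⟨z, hzx, hz⟩ := hfr
        obtain ⟨e, φ, he, hφ, hgr⟩ := hloc z hz
        rw [Metric.mem_ball, dist_comm] at hzx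
        have hxz : x ∈ Metric.ball z ρ := by rw [Metric.mem_ball]; linarith
        have hxcl : x ∈ closure (aboveGraph e φ) := by
          have h1 : x ∈ closure (Ω ∩ Metric.ball z ρ) :=
            Metric.isOpen_ball.closure_inter ⟨hx, hxz⟩
          rw [hgr] at h1
          exact closure_mono Set.inter_subset_left h1
        refine ⟨x + (r₁ / 2) • e, (Metric.ball_subset_ball hrad).trans fun y hy => ?_⟩
        obtain ⟨hy1, hy2⟩ :=
          ball_subset_aboveGraph he hφ (height_nonneg_of_mem_closure hφ hxcl) hr₁0 hy
        have hyz : y ∈ Metric.ball z ρ := by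
          rw [Metric.mem_ball] at hy2 ⊢
          linarith [dist_triangle y x z]
        have : y ∈ Ω ∩ Metric.ball z ρ := by rw [hgr]; exact ⟨hy1, hyz⟩
        exact ⟨Metric.ball_subset_ball hr₁' hy2, this.1⟩
      -- The ball is connected, meets Ω because x is in the closure, and misses the boundary, so it
      -- lies inside Ω.
      · have hsub : Metric.ball x (r₁ / 4) ⊆ Ω := by
          have hpre : IsPreconnected (Metric.ball x (r₁ / 4)) := (convex_ball x _).isPreconnected
          by_contra hns
          obtain ⟨y, hy, hyΩ⟩ := Set.not_subset.1 hns
          obtain ⟨y', hy', hyx⟩ := Metric.mem_closure_iff.1 hx (r₁ / 4) (by positivity)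
          rw [dist_comm] at hyx
          have hcov : ∀ w ∈ Metric.ball x (r₁ / 4), w ∉ Ω → w ∈ (closure Ω)ᶜ := fun w hw hwΩ hwc =>
            hfr ⟨w, hw, by rw [hopen.frontier_eq]; exact ⟨hwc, hwΩ⟩⟩
          obtain ⟨w, -, hw1, hw2⟩ := hpre Ω (closure Ω)ᶜ hopen isClosed_closure.isOpen_compl
            (fun w hw => or_iff_not_imp_left.2 (hcov w hw)) ⟨y', hyx, hy'⟩ ⟨y, hy, hcov y hy hyΩ⟩
          exact hw2 (subset_closure hw1)
        refine ⟨x, (Metric.ball_subset_ball hrad).trans fun y hy => ?_⟩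
        have h1 : r₁ / (4 * (1 + L)) ≤ r₁ / 4 := by
          refine div_le_div_of_nonneg_left hr₁0.le (by norm_num) ?_
          linarith
        have hy' := Metric.ball_subset_ball h1 hy
        exact ⟨Metric.ball_subset_ball (by linarith) hy', hsub hy'⟩

/-- Passing to the effective radius r' leaves B_r ∩ Ω and B_{2r} ∩ Ω unchanged. The lower volume
bound comes from an interior ball, the upper one from the whole ball. -/
lemma exists_volume_estimates (n : ℕ) (L : ℝ≥0) (D : ℝ) : ∃ a b : ℝ, 0 < a ∧ 0 < b ∧
    ∀ Ω : Set (Pt n), IsLipschitzDomain L D Ω → ∀ x ∈ closure Ω, ∀ r : ℝ, 0 < r →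
      ∃ r' : ℝ, 0 < r' ∧ r' ≤ r ∧ Metric.ball x r ∩ Ω = Metric.ball x r' ∩ Ω ∧
        Metric.ball x (2 * r) ∩ Ω = Metric.ball x (2 * r') ∩ Ω ∧
        ENNReal.ofReal (a * r' ^ n) ≤ volume (Metric.ball x r' ∩ Ω) ∧
        volume (Metric.ball x (2 * r') ∩ Ω) ≤ ENNReal.ofReal (b * r' ^ n) := by
  set V : ℝ := (volume (Metric.ball (0 : Pt n) 1)).toReal with hV
  have hVtop : volume (Metric.ball (0 : Pt n) 1) ≠ ⊤ := measure_ball_lt_top.ne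
  have hV0 : 0 < V := ENNReal.toReal_pos (Metric.measure_ball_pos _ _ one_pos).ne' hVtop
  have hball : ∀ (z : Pt n) (s : ℝ), 0 < s →
      volume (Metric.ball z s) = ENNReal.ofReal (s ^ n * V) := fun z s hs => by
    rw [Measure.addHaar_ball_of_pos _ _ hs, finrank_euclideanSpace, Fintype.card_fin,
      ENNReal.ofReal_mul (by positivity), hV, ENNReal.ofReal_toReal hVtop]
  set c : ℝ := 1 / (32 * max D 1 * (1 + L)) with hc
  have hD : 1 ≤ max D 1 := le_max_right _ _
  have hc0 : 0 < c := by positivity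
  refine ⟨c ^ n * V, 2 ^ n * V, by positivity, by positivity, fun Ω hΩ x hx r hr => ?_⟩
  obtain ⟨r', hr'0, hr', hbig, z, hz⟩ := hΩ.exists_ball_subset hx hr
  have hsets : ∀ s : ℝ, 1 ≤ s → Metric.ball x (s * r) ∩ Ω = Metric.ball x (s * r') ∩ Ω := by
    intro s hs
    rcases hr'.eq_or_lt with h | h
    · rw [h]
    · have h1 := hbig h
      have h2 : ∀ t : ℝ, r' ≤ t → Metric.ball x t ∩ Ω = Ω := fun t ht =>
        Set.inter_eq_right.2 (h1.trans (Metric.ball_subset_ball ht))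
      rw [h2 _ (by nlinarith), h2 _ (by nlinarith)]
  refine ⟨r', hr'0, hr', by simpa using hsets 1 le_rfl, hsets 2 (by norm_num), ?_, ?_⟩
  · refine le_trans (le_of_eq ?_) (measure_mono hz)
    rw [hball _ _ (by positivity)]
    congr 1
    rw [hc, div_pow, div_pow]
    ring
  · refine (measure_mono Set.inter_subset_left).trans_eq ?_
    rw [hball _ _ (by positivity)]
    congr 1
    ring

lemma inv_le_of_volume_estimates {a b ρ : ℝ} {v₁ v₂ : ℝ≥0∞} (ha : 0 < a) (hb : 0 < b)
    (hρ : 0 < ρ) (h1 : ENNReal.ofReal (a * ρ) ≤ v₁) (h2 : v₂ ≤ ENNReal.ofReal (b * ρ)) :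
    v₁⁻¹ ≤ ENNReal.ofReal a⁻¹ * ENNReal.ofReal ρ⁻¹ ∧
    ENNReal.ofReal ρ⁻¹ ≤ ENNReal.ofReal b * v₂⁻¹ := by
  constructor
  · rw [← ENNReal.ofReal_mul (by positivity), ← mul_inv, ENNReal.ofReal_inv_of_pos (by positivity)]
    exact ENNReal.inv_le_inv.2 h1
  · calc ENNReal.ofReal ρ⁻¹ = ENNReal.ofReal (b * (b * ρ)⁻¹) := by
          congr 1; field_simp
      _ = ENNReal.ofReal b * (ENNReal.ofReal (b * ρ))⁻¹ := by
          rw [ENNReal.ofReal_mul hb.le, ENNReal.ofReal_inv_of_pos (by positivity)]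
      _ ≤ _ := by gcongr

/-! ### The main estimates -/

/-- The number k = max(q/P, 1) satisfies k(n - 2) < n strictly, and adding 1/n of the slack keeps
the inequality while making κ > 1. -/
lemma exists_exponent (hn : 2 ≤ n) {P q : ℝ} (hP : 2 ≤ P) (h : q * ((n : ℝ) - 2) < P * n) :
    ∃ κ : ℝ, 1 < κ ∧ κ * ((n : ℝ) - 2) ≤ n ∧ q ≤ P * κ := by
  have hn' : (2 : ℝ) ≤ n := by exact_mod_cast hn
  set k := max (q / P) 1 with hk
  have hk1 : 1 ≤ k := le_max_right _ _
  have hkn : k * ((n : ℝ) - 2) < n := by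
    rw [hk, max_mul_of_nonneg _ _ (by linarith)]
    refine max_lt ?_ (by linarith)
    rw [div_mul_eq_mul_div, div_lt_iff₀ (by linarith)]
    linarith
  have hd : 0 < (n - k * ((n : ℝ) - 2)) / n := div_pos (by linarith) (by linarith)
  refine ⟨k + (n - k * ((n : ℝ) - 2)) / n, by linarith, ?_, ?_⟩
  · have h1 : (n - k * ((n : ℝ) - 2)) / n * (n - 2) ≤ n - k * ((n : ℝ) - 2) := by
      rw [div_mul_eq_mul_div, div_le_iff₀ (by linarith)]
      refine mul_le_mul_of_nonneg_left (by linarith) (by linarith)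
    linarith
  · have h1 : q / P ≤ k := le_max_left _ _
    rw [div_le_iff₀ (by linarith)] at h1
    nlinarith

lemma ofReal_norm_rpow (z : Val m) {q : ℝ} (hq : 0 ≤ q) :
    ENNReal.ofReal (‖z‖ ^ q) = ENNReal.ofReal ‖z‖ ^ q :=
  (ENNReal.ofReal_rpow_of_nonneg (norm_nonneg _) hq).symm

/-- Stated for every exponent between 2 and p, and with max(p,2) in the reverse Hölder range. This
is what allows p₀, which is only a supremum, to be treated, and makes p < 2 harmless. -/
theorem exists_boundary_estimate (hn : 2 ≤ n) (m : ℕ) (L : ℝ≥0) (D Λ : ℝ) {lam p lamp : ℝ}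
    (hlam : 0 < lam) (hp : 1 < p) (hlamp : 0 < lamp) : ∃ K : ℝ, 0 < K ∧
      (∃ C : ℝ, 0 < C ∧ ∀ (Ω : Set (Pt n)) (A : Pt n → Coeff2 n m),
        IsLipschitzDomain L D Ω → IsBoundedCoeff Ω A Λ →
        IsPEllipticWith Ω A 2 lam → IsPEllipticWith Ω A p lamp →
        ∀ q : ℝ, BetweenTwo p q → CaccioppoliEstimate Ω A K q C) ∧
      (∀ q : ℝ, 1 ≤ q → q * ((n : ℝ) - 2) < max p 2 * n →
        ∃ C : ℝ, 0 < C ∧ ∀ (Ω : Set (Pt n)) (A : Pt n → Coeff2 n m),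
          IsLipschitzDomain L D Ω → IsBoundedCoeff Ω A Λ →
          IsPEllipticWith Ω A 2 lam → IsPEllipticWith Ω A p lamp →
          ReverseHolderEstimate Ω A K q C) := by
  obtain ⟨CH, hCH, hardy⟩ := hardy_test hn m L D
  obtain ⟨K, hK, C, hC, H⟩ := exists_local_estimate n m Λ hp hlam hlamp hCH.le
  obtain ⟨a, b, ha, hb, hvol⟩ := exists_volume_estimates n L D
  refine ⟨K, hK, ⟨C * (a⁻¹ * b), by positivity, ?_⟩, fun q hq1 hqn => ?_⟩
  · intro Ω A hΩ hA hell2 hellp q hq B hB u G hu x hx r hr htr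
    obtain ⟨r', hr'0, -, e1, e2, h1, h2⟩ := hvol Ω hΩ x hx r hr
    rw [← e1] at h1
    rw [← e2] at h2
    obtain ⟨i1, i2⟩ := inv_le_of_volume_estimates ha hb (pow_pos hr'0 n) h1 h2
    have hest := (H Ω A B hΩ.isOpen hA hB (hardy Ω hΩ) hell2 hellp u G hu x r (2 * r) (3 * r) htr
      hr.le (by linarith) (by linarith) q hq).1
    rw [setLAverage_eq, setLAverage_eq, ENNReal.div_eq_inv_mul, ENNReal.div_eq_inv_mul]
    calc (volume (Metric.ball x r ∩ Ω))⁻¹ *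
          ∫⁻ y in Metric.ball x r ∩ Ω, ENNReal.ofReal (‖u y‖ ^ (q - 2) * ‖G y‖ ^ 2)
        ≤ (ENNReal.ofReal a⁻¹ * (ENNReal.ofReal b * (volume (Metric.ball x (2 * r) ∩ Ω))⁻¹)) *
          (ENNReal.ofReal (C / (2 * r - r) ^ 2) *
            ∫⁻ y in Metric.ball x (2 * r) ∩ Ω, ENNReal.ofReal (‖u y‖ ^ q)) := by
          refine mul_le_mul' (i1.trans ?_) hest
          gcongr
      _ = (ENNReal.ofReal a⁻¹ * ENNReal.ofReal b * ENNReal.ofReal (C / (2 * r - r) ^ 2)) *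
          ((volume (Metric.ball x (2 * r) ∩ Ω))⁻¹ *
            ∫⁻ y in Metric.ball x (2 * r) ∩ Ω, ENNReal.ofReal (‖u y‖ ^ q)) := by ring
      _ = _ := by
          rw [← ENNReal.ofReal_mul (by positivity), ← ENNReal.ofReal_mul (by positivity)]
          congr 2
          rw [show 2 * r - r = r by ring]
          ring
  set P := max p 2 with hP
  have hP2 : 2 ≤ P := le_max_right _ _
  obtain ⟨κ, hκ1, hκn, hqκ⟩ := exists_exponent hn hP2 hqn
  have hκ0 : 0 < κ := by linarith
  obtain ⟨CS, hCS, hsob⟩ := sobolev_test hn m hκ1.le hκn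
  obtain ⟨C', hC', hRH⟩ := exists_reverseHolder_of_gain (C := CS ^ 2 * C) hP2 hκ1 (by positivity)
  set Q := P * κ with hQ
  have hQ0 : 0 < Q := by positivity
  refine ⟨(a⁻¹) ^ (1 / Q) * C' * b, by positivity, ?_⟩
  intro Ω A hΩ hA hell2 hellp B hB u G hu x hx r hr htr
  obtain ⟨r', hr'0, hr'r, e1, e2, h1, h2⟩ := hvol Ω hΩ x hx r hr
  obtain ⟨i1, i2⟩ := inv_le_of_volume_estimates ha hb (pow_pos hr'0 n) h1 h2
  rw [e1, e2]
  have hopen := hΩ.isOpen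
  obtain ⟨U, GU, hU, hUu, -, -⟩ := hu.exists_localization hopen htr
    (t := 2 * r') (by positivity) (by linarith)
  set E : ℝ → Set (Pt n) := fun s => Metric.ball x (s * r') ∩ Ω with hE
  have hEm : ∀ s, MeasurableSet (E s) := fun s => (Metric.isOpen_ball.inter hopen).measurableSet
  have hEmono : Monotone E := fun s t hst =>
    Set.inter_subset_inter_left _ (Metric.ball_subset_ball (by gcongr))
  have hle2 : volume.restrict (E 2) ≤ volume.restrict Ω :=
    Measure.restrict_mono Set.inter_subset_right le_rfl
  have mu2 : AEStronglyMeasurable u (volume.restrict (E 2)) := by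
    refine (hU.1.1.mono_measure hle2).congr ?_
    filter_upwards [ae_restrict_mem (hEm 2)] with y hy
    exact hUu y hy.1
  -- With the measure r'^{-n}dy the gain inequality becomes independent of scale, as required by the
  -- abstract reverse Hölder lemma.
  set ρ : ℝ≥0∞ := ENNReal.ofReal (r' ^ n)⁻¹ with hρ
  set g : Pt n → ℝ≥0∞ := fun y => ENNReal.ofReal ‖u y‖ with hg
  have hν : ∀ (s : ℝ) (F : Pt n → ℝ≥0∞), ∫⁻ y in E s, F y ∂(ρ • volume) =
      ρ * ∫⁻ y in E s, F y := fun s F => by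
    rw [Measure.restrict_smul, lintegral_smul_measure, smul_eq_mul]
  have main := hRH (ρ • volume) E g hEmono
    (by
      rw [Measure.restrict_smul]
      exact (mu2.norm.aemeasurable.ennreal_ofReal).smul_measure _)
    (by
      rw [Measure.smul_apply, smul_eq_mul]
      exact ENNReal.mul_lt_top ENNReal.ofReal_lt_top
        ((measure_mono Set.inter_subset_left).trans_lt measure_ball_lt_top))
    (by
      rw [hν]
      refine ENNReal.mul_lt_top ENNReal.ofReal_lt_top ?_
      have : ∫⁻ y in E 2, g y ^ (2 : ℝ) = ∫⁻ y in E 2, ENNReal.ofReal (‖U y‖ ^ 2) := by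
        refine setLIntegral_congr_fun (hEm 2) fun y hy => ?_
        simp only [hg, hUu y hy.1]
        rw [← ofReal_norm_rpow _ zero_le_two, Real.rpow_two]
      rw [this]
      refine (lintegral_mono' hle2 le_rfl).trans_lt ?_
      rw [lintegral_ofReal_norm_sq]
      exact ENNReal.pow_lt_top hU.1.2)
    (by
      intro q' s t hq'2 hq'P hs hst ht2
      -- If p ≤ 2 then P = 2 and only q' = 2 occurs.
      have hbt : BetweenTwo p q' := by
        rcases le_total p 2 with h | h
        · rw [hP, max_eq_right h] at hq'P
          exact Or.inr ⟨by linarith, hq'P⟩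
        · rw [hP, max_eq_left h] at hq'P
          exact Or.inl ⟨hq'2, hq'P⟩
      have hgain := (H Ω A B hopen hA hB (hardy Ω hΩ) hell2 hellp u G hu x (s * r') (t * r')
        (3 * r) htr (by positivity) (by gcongr) (by nlinarith) q' hbt).2 κ
        (CS * r' ^ (1 + n / (2 * κ) - n / 2)) hκ1.le (by positivity)
        (fun φ hφ => hsob x r' hr'0 φ (hφ.mono (Set.inter_subset_right.trans
          (Metric.ball_subset_ball (by gcongr)))))
      simp only [ofReal_norm_rpow _ (by positivity : 0 ≤ q' * κ),
        ofReal_norm_rpow _ (by linarith : 0 ≤ q')] at hgain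
      rw [hν, hν, ENNReal.mul_rpow_of_nonneg _ _ (by positivity)]
      refine (mul_le_mul_right hgain _).trans_eq ?_
      rw [← mul_assoc, ← mul_assoc, hρ, ENNReal.ofReal_rpow_of_nonneg (by positivity) (by positivity),
        ← ENNReal.ofReal_mul (by positivity), ← ENNReal.ofReal_mul (by
          have : 0 < t - s := by linarith
          positivity)]
      congr 2
      have x1 : ((r' ^ n)⁻¹) ^ (1 / κ) = r' ^ (-(n / κ)) := by
        rw [← Real.rpow_natCast, ← Real.rpow_neg hr'0.le, ← Real.rpow_mul hr'0.le]
        congr 1; ring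
      have x2 : (r' ^ (1 + n / (2 * κ) - n / 2)) ^ 2 = r' ^ (2 + n / κ - n) := by
        rw [← Real.rpow_natCast, ← Real.rpow_mul hr'0.le]
        congr 1; push_cast; field_simp
      -- The power of r' from Sobolev's inequality and the normalization leave r'², which cancels
      -- the square of the difference of radii.
      have x3 : (r' ^ n)⁻¹ * r' ^ 2 = r' ^ (-(n / κ)) * r' ^ (2 + n / κ - n) := by
        rw [← Real.rpow_add hr'0, ← Real.rpow_natCast, ← Real.rpow_natCast, ← Real.rpow_neg hr'0.le,
          ← Real.rpow_add hr'0]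
        congr 1; push_cast; ring
      have hts : t - s ≠ 0 := by linarith
      rw [x1, mul_pow, x2]
      calc r' ^ (-(n / κ)) * (CS ^ 2 * r' ^ (2 + n / κ - n) * (C / (t * r' - s * r') ^ 2))
          = (r' ^ (-(n / κ)) * r' ^ (2 + n / κ - n)) * CS ^ 2 * (C / (t * r' - s * r') ^ 2) := by ring
        _ = _ := by
          rw [← x3, ← sub_mul]
          field_simp)
  rw [hν, hν] at main
  have E1 : Metric.ball x r' ∩ Ω = E 1 := by simp [hE]
  have E2 : Metric.ball x (2 * r') ∩ Ω = E 2 := rfl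
  rw [E1] at i1 h1 ⊢
  rw [E2] at i2 ⊢
  have hE1pos : volume (E 1) ≠ 0 := by
    refine (lt_of_lt_of_le ?_ h1).ne'
    simp only [ENNReal.ofReal_pos]; positivity
  have hE1top : volume (E 1) ≠ ⊤ :=
    ((measure_mono Set.inter_subset_left).trans_lt measure_ball_lt_top).ne
  set μ₁ : Measure (Pt n) := (volume (E 1))⁻¹ • volume.restrict (E 1) with hμ₁
  have : IsProbabilityMeasure μ₁ := ⟨by
    rw [hμ₁, Measure.smul_apply, Measure.restrict_apply_univ, smul_eq_mul,
      ENNReal.inv_mul_cancel hE1pos hE1top]⟩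
  have mu1 : AEStronglyMeasurable u μ₁ :=
    (mu2.mono_measure (Measure.restrict_mono (hEmono (by norm_num)) le_rfl)).smul_measure _
  -- Jensen's inequality for averages descends from Q to the required exponent q.
  have hjensen := eLpNorm'_le_eLpNorm'_of_exponent_le (by linarith : 0 < q) hqκ μ₁ mu1
  have heq : ∀ s : ℝ, 0 < s → eLpNorm' u s μ₁ =
      ((volume (E 1))⁻¹ * ∫⁻ y in E 1, g y ^ s) ^ (1 / s) := fun s hs => by
    rw [eLpNorm'_eq_lintegral_enorm, hμ₁, lintegral_smul_measure, smul_eq_mul]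
    simp only [hg, ofReal_norm]
  rw [heq q (by linarith), heq Q hQ0] at hjensen
  rw [setLAverage_eq, setLAverage_eq, ENNReal.div_eq_inv_mul, ENNReal.div_eq_inv_mul]
  simp only [ofReal_norm_rpow _ (by linarith : 0 ≤ q)]
  calc ((volume (E 1))⁻¹ * ∫⁻ y in E 1, g y ^ q) ^ (1 / q)
      ≤ ((volume (E 1))⁻¹ * ∫⁻ y in E 1, g y ^ Q) ^ (1 / Q) := hjensen
    _ ≤ ((ENNReal.ofReal a⁻¹ * ρ) * ∫⁻ y in E 1, g y ^ Q) ^ (1 / Q) := by gcongr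
    _ = ENNReal.ofReal ((a⁻¹) ^ (1 / Q)) * (ρ * ∫⁻ y in E 1, g y ^ Q) ^ (1 / Q) := by
        rw [mul_assoc, ENNReal.mul_rpow_of_nonneg _ _ (by positivity),
          ENNReal.ofReal_rpow_of_nonneg (by positivity) (by positivity)]
    _ ≤ ENNReal.ofReal ((a⁻¹) ^ (1 / Q)) * (ENNReal.ofReal C' *
        ((ENNReal.ofReal b * (volume (E 2))⁻¹) * ∫⁻ y in E 2, g y)) := by
        gcongr
        refine main.trans ?_
        gcongr
    _ = _ := by
        rw [ENNReal.ofReal_mul (by positivity), ENNReal.ofReal_mul (by positivity)]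
        ring

end PEllipticSystem

/-! ### The boundary estimate and its ranges of exponents -/

open PEllipticSystem in
theorem theorem3p2 {n m : ℕ} (hn : 2 ≤ n) (L : ℝ≥0) (D Λ lam : ℝ) (hlam : 0 < lam) :
    -- constants depending only on `n`, `m`, `p`, `λ`, `λ_p`, `Λ`, the Lipschitz character (and `q`)
    (∀ p lamp : ℝ, 1 < p → 0 < lamp → ∃ K : ℝ, 0 < K ∧
      (∃ C : ℝ, 0 < C ∧ ∀ (Ω : Set (Pt n)) (A : Pt n → Coeff2 n m),
        IsLipschitzDomain L D Ω → IsBoundedCoeff Ω A Λ →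
        IsPEllipticWith Ω A 2 lam → IsPEllipticWith Ω A p lamp →
        CaccioppoliEstimate Ω A K p C) ∧
      (∀ q : ℝ, 1 ≤ q → q * ((n : ℝ) - 2) < p * n →
        ∃ C : ℝ, 0 < C ∧ ∀ (Ω : Set (Pt n)) (A : Pt n → Coeff2 n m),
          IsLipschitzDomain L D Ω → IsBoundedCoeff Ω A Λ →
          IsPEllipticWith Ω A 2 lam → IsPEllipticWith Ω A p lamp →
          ReverseHolderEstimate Ω A K q C)) ∧
    -- the full ranges of exponents in terms of `p₀`
    (∀ (Ω : Set (Pt n)) (A : Pt n → Coeff2 n m),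
      IsLipschitzDomain L D Ω → IsBoundedCoeff Ω A Λ → IsPEllipticWith Ω A 2 lam →
      (∀ p : ℝ, 2 ≤ p → ENNReal.ofReal p < pZero Ω A →
        ∃ K : ℝ, 0 < K ∧ ∃ C : ℝ, 0 < C ∧ CaccioppoliEstimate Ω A K p C) ∧
      (∀ q : ℝ, 1 ≤ q → ENNReal.ofReal (q * ((n : ℝ) - 2)) < pZero Ω A * n →
        ∃ K : ℝ, 0 < K ∧ ∃ C : ℝ, 0 < C ∧ ReverseHolderEstimate Ω A K q C)) := by
  have hmax : ∀ p : ℝ, p * n ≤ max p 2 * n := fun p => by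
    gcongr
    exact le_max_left _ _
  refine ⟨fun p lamp hp hlamp => ?_, fun Ω A hΩ hA hell => ⟨fun p hp hpp => ?_, fun q hq hqp => ?_⟩⟩
  · obtain ⟨K, hK, ⟨C, hC, h1⟩, h2⟩ := exists_boundary_estimate hn m L D Λ hlam hp hlamp
    refine ⟨K, hK, ⟨C, hC, fun Ω A hΩ hA hell hellp => h1 Ω A hΩ hA hell hellp p ?_⟩,
      fun q hq hqn => h2 q hq (hqn.trans_le (hmax p))⟩
    rcases le_total p 2 with h | h
    · exact Or.inr ⟨le_rfl, h⟩
    · exact Or.inl ⟨h, le_rfl⟩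
  -- Ellipticity need not be known at p itself, only at some p' > p. Since p lies between 2 and p',
  -- the estimate for intermediate exponents applies.
  · simp only [pZero, lt_iSup_iff] at hpp
    obtain ⟨p', ⟨hp', lamp, hlamp, hell'⟩, hlt⟩ := hpp
    have hlt' : p < p' := (ENNReal.ofReal_lt_ofReal_iff (by linarith)).1 hlt
    obtain ⟨K, hK, ⟨C, hC, h1⟩, -⟩ := exists_boundary_estimate hn m L D Λ hlam hp' hlamp
    exact ⟨K, hK, C, hC, h1 Ω A hΩ hA hell hell' p (Or.inl ⟨hp, hlt'.le⟩)⟩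
  -- The strict inequality already holds for some admissible p' in place of p₀; p' may be less than
  -- 2, which the maximum with 2 covers.
  · simp only [pZero, ENNReal.iSup_mul, lt_iSup_iff] at hqp
    obtain ⟨p', ⟨hp', lamp, hlamp, hell'⟩, hlt⟩ := hqp
    have hn0 : (0 : ℝ) < n := by exact_mod_cast (by omega : 0 < n)
    rw [← ENNReal.ofReal_natCast, ← ENNReal.ofReal_mul (by linarith),
      ENNReal.ofReal_lt_ofReal_iff (mul_pos (by linarith) hn0)] at hlt
    obtain ⟨K, hK, -, h2⟩ := exists_boundary_estimate hn m L D Λ hlam hp' hlamp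
    obtain ⟨C, hC, h3⟩ := h2 q hq (hlt.trans_le (hmax p'))
    exact ⟨K, hK, C, hC, h3 Ω A hΩ hA hell hell'⟩
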